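/- Let $k$ be a field and let $\mathbb G$ be $\mathbb Z$ or $\mathbb Z/2$. All dg categories are small, $k$-linear, $\mathbb G$-graded and have identities. For such $\mathcal A$ let $C(\mathcal A)$ be its Hochschild complex, spanned by the cyclically composable words $a_0[a_1|\cdots|a_n]$, $n\ge 0$ (multilinear in the homogeneous morphisms $a_i$), of degree $\sum_i|a_i|-n$, with Hochschild differential $b$. Put $$t^{-1}(a_0[a_1|\cdots|a_n])=(-1)^{(|a_n|-1)\sum_{l<n}(|a_l|-1)}\,a_n[a_0|\cdots|a_{n-1}],\qquad s(a_0[a_1|\cdots|a_n])=1_{\mathrm{cod}(a_0)}[a_0|\cdots|a_n],$$ $N=\sum_{m=0}^{n}t^{-m}$ on words of length $n+1$, and $B=(1-t^{-1})sN$. The negative cyclic complex is $(C(\mathcal A)[[u]],b+uB)$ with $|u|=2$ (a series $\sum_m c_mu^m$ has degree $g$ if $|c_m|=g-2m$ for all $m$), and $HN_*(\mathcal A)$ is its cohomology. $\overline C(\mathcal A)$ is the normalized complex, i.e. the quotient of $C(\mathcal A)$ by the words $a_0[a_1|\cdots|a_n]$ with some $a_m$ ($m\ge1$) an identity, $quot: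 C(\mathcal A)[[u]]\to\overline C(\mathcal A)[[u]]$ is the quotient map, and $\overline{HN}_*(\mathcal A)$ is the cohomology of $(\overline C(\mathcal A)[[u]],b+uB)$. Let $\mathcal A^+$ be obtained from $\mathcal A$ by adjoining a new identity $e_x$ to each object $x$, and let $C^e(\mathcal A)=C(\mathcal A^+)/D$, where $D$ is spanned by the chains $e_x$ and the words $a_0[a_1|\cdots|a_n]$ with $a_m=e_x$ for some $m>0$ and some $x$. Let $\iota(u):C(\mathcal A)[[u]]\to C^e(\mathcal A)[[u]]$ and $p(u):C^e(\mathcal A)[[u]]\to C(\mathcal A)[[u]]$ be the $k[[u]]$-linear extensions of $$\iota(u)(a)=a+u\,s^e s N(a),\quad s^e(a_0[a_1|\cdots|a_n])=e_{\mathrm{cod}(a_0)}[a_0|\cdots|a_n],$$ $$p(u)(a)=a\ \ (a\in C(\mathcal A)),\qquad p(u)(e_x[a_1|\cdots|a_n])=(1-t^{-1})\bigl(1_x[a_1|\cdots|a_n]\bigr)\ \ (n\ge1).$$ A non-unital dg functor (semifunctor) $F:\mathcal A\to\mathcal B$ induces $F_*:C(\mathcal A)\to C(\mathcal B)$, $a_0[a_1|\cdots|a_n]\mapsto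 F(a_0)[F(a_1)|\cdots|F(a_n)]$, and, by putting $F(e_x)=e_{F(x)}$, a map $F^e_*:C^e(\mathcal A)\to C^e(\mathcal B)$. **Lemma.** Let $P,N$ be objects of a dg category $\mathcal A$ and let $P$ be a direct summand of $N$: there are closed morphisms $i:P\to N$, $j:N\to P$ of degree $0$ with $j\circ i=1_P$. Put $\pi=i\circ j$. Let $\{P,N\}$ and $\{N\}$ be the full dg subcategories on the indicated objects (with $P$ and $N$ regarded as two distinct objects of $\{P,N\}$), let $inc:\{N\}\to\{P,N\}$ be the inclusion, and let $F:\{P,N\}\to\{N\}$ be the semifunctor $$f\mapsto i\circ f\circ j\ (f\in\mathrm{End}\,P),\quad f'\mapsto i\circ f'\ (f'\in\mathrm{Hom}(N,P)),\quad f''\mapsto f''\circ j\ (f''\in\mathrm{Hom}(P,N)),\quad g\mapsto g\ (g\in\mathrm{End}\,N).$$ Put $$\gamma_P=1_P+\sum_{m\ge1}(-1)^m\frac{(2m)!}{2(m!)}\,2\cdot1_P[\underbrace{1_P|\cdots|1_P}_{2m}]\,u^m\in C\{P,N\}[[u]],$$ $$\eta_\pi=\pi+\sum_{m\ge1}(-1)^m\frac{(2m)!}{2(m!)}\,(2\pi-1_N)[\underbrace{\pi|\cdots|\pi}_{2m}]\,u^m\in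 C\{N\}[[u]],$$ where the coefficients $(2m)!/(2(m!))$ are integers. Then $$F_*(u):=p(u)\circ F^e_*\circ\iota(u):\ (C\{P,N\}[[u]],b+uB)\to(C\{N\}[[u]],b+uB)$$ is a ($k[[u]]$-linear, degree $0$) cochain map, and 1. $F_*(u)\circ inc_*$ induces the identity on $HN_*\{N\}$; 2. $F_*(u)|_{u=0}=F_*$; 3. $quot(F_*(u)(\gamma_P))=quot(\eta_\pi)$ in $\overline C\{N\}[[u]]$. In particular, the images of $1_P$ and $\eta_\pi$ in $\overline C\{P,N\}[[u]]$ are cocycles of degree $0$ and $[1_P]=[\eta_\pi]$ in $\overline{HN}_*\{P,N\}$. -/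

import Mathlib

namespace NegCyc

universe uk u v w u' v' u₁

/-- A grading ring: a commutative ring `G` with a parity homomorphism to `ℤ/2`.  The two cases of
interest are `G = ℤ` and `G = ℤ/2` (instances below). -/
class GradingRing (G : Type w) extends CommRing G where
  parity : G →+* ZMod 2

instance : GradingRing ℤ := { (inferInstance : CommRing ℤ) with parity := Int.castRingHom (ZMod 2) }

instance : GradingRing (ZMod 2) :=
  { (inferInstance : CommRing (ZMod 2)) with parity := RingHom.id (ZMod 2) }

/-- The sign `(-1) ^ g` of a degree `g`. -/
def sgn (k : Type*) [Field k] {G : Type*} [GradingRing G] (g : G) : k :=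
  open Classical in if GradingRing.parity (G := G) g = 0 then 1 else -1

/-- A `G`-graded `k`-linear quiver. `Hom x y n` is the space of morphisms `x ⟶ y` of degree `n`. -/
structure GradedQuiver (k : Type*) [Field k] (G : Type w) [GradingRing G] where
  Obj : Type u
  Hom : Obj → Obj → G → Type v
  [addCommGroup : ∀ x y n, AddCommGroup (Hom x y n)]
  [module : ∀ x y n, Module k (Hom x y n)]

attribute [instance] GradedQuiver.addCommGroup GradedQuiver.module

/-- A small dg category over `k` (with identities), graded by `G`.  Composition is written in the
usual order, `comp h f g = f ∘ g`. -/
structure DGCat (k : Type*) [Field k] (G : Type w) [GradingRing G]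
    extends GradedQuiver.{u, v} k G where
  d : ∀ {x y : Obj} {n : G}, Hom x y n →ₗ[k] Hom x y (n + 1)
  comp : ∀ {x y z : Obj} {m n p : G}, m + n = p → (Hom y z m →ₗ[k] Hom x y n →ₗ[k] Hom x z p)
  one : ∀ x : Obj, Hom x x 0
  d_d : ∀ {x y : Obj} {n : G} (f : Hom x y n), d (d f) = 0
  leibniz : ∀ {x y z : Obj} {m n p : G} (h : m + n = p) (h₁ : (m + 1) + n = p + 1)
    (h₂ : m + (n + 1) = p + 1) (f : Hom y z m) (g : Hom x y n),
    d (comp h f g) = comp h₁ (d f) g + sgn k m • comp h₂ f (d g)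
  assoc : ∀ {x y z t : Obj} {l m n lm mn p : G} (h₁ : l + m = lm) (h₂ : lm + n = p)
    (h₃ : m + n = mn) (h₄ : l + mn = p) (e : Hom z t l) (f : Hom y z m) (g : Hom x y n),
    comp h₂ (comp h₁ e f) g = comp h₄ e (comp h₃ f g)
  one_comp : ∀ {x y : Obj} {n : G} (h : 0 + n = n) (f : Hom x y n), comp h (one y) f = f
  comp_one : ∀ {x y : Obj} {n : G} (h : n + 0 = n) (f : Hom x y n), comp h f (one x) = f

section Chains

variable {k : Type uk} [Field k] {G : Type w} [GradingRing G]

theorem DGCat.d_one (A : DGCat.{u, v} k G) (x : A.Obj) : A.d (A.one x) = 0 := by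
  have h := A.leibniz (add_zero 0) (by simp) (by simp) (A.one x) (A.one x)
  rw [A.one_comp, A.comp_one (by simp), A.one_comp (by simp)] at h
  simpa [sgn] using h

/-- A homogeneous morphism together with its domain, codomain and degree. -/
structure Letter (Q : GradedQuiver.{u, v} k G) where
  cod : Q.Obj
  dom : Q.Obj
  deg : G
  hom : Q.Hom dom cod deg

/-- A homogeneous morphism seen as a letter. -/
def Letter.of (Q : GradedQuiver.{u, v} k G) {x y : Q.Obj} {n : G} (f : Q.Hom x y n) : Letter Q :=
  ⟨y, x, n, f⟩

/-- A word `[a₀, a₁, …, aₙ]`, standing for `a₀[a₁|…|aₙ]`, is cyclically composable if it is not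
empty, `dom aᵢ = cod aᵢ₊₁` for all `i < n`, and `dom aₙ = cod a₀`. -/
def IsCyclic {Q : GradedQuiver.{u, v} k G} : List (Letter Q) → Prop
  | [] => False
  | a :: l => List.IsChain (fun s t => s.dom = t.cod) (a :: (l ++ [a]))

/-- The relations among words: multilinearity in each letter (within a fixed space of homogeneous
morphisms), and vanishing of the words that are not cyclically composable. -/
def chainRelations (Q : GradedQuiver.{u, v} k G) : Set (List (Letter Q) →₀ k) :=
  {r | ∃ (p q : List (Letter Q)) (x y : Q.Obj) (n : G) (c : k) (f g : Q.Hom x y n),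
      r = Finsupp.single (p ++ Letter.of Q (c • f + g) :: q) 1
        - c • Finsupp.single (p ++ Letter.of Q f :: q) 1
        - Finsupp.single (p ++ Letter.of Q g :: q) 1} ∪
  {r | ∃ l : List (Letter Q), ¬ IsCyclic l ∧ r = Finsupp.single l 1}

/-- The Hochschild chains: the direct sum over all `n ≥ 0`, all objects `x₀, …, xₙ` and all degrees
of the tensor products `Hom(x₁,x₀) ⊗ Hom(x₂,x₁)[1] ⊗ ⋯ ⊗ Hom(x₀,xₙ)[1]`, presented by generators
(the words) and relations. -/
def Chains (Q : GradedQuiver.{u, v} k G) : Type _ :=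
  (List (Letter Q) →₀ k) ⧸ Submodule.span k (chainRelations Q)

noncomputable instance (Q : GradedQuiver.{u, v} k G) : AddCommGroup (Chains Q) :=
  inferInstanceAs (AddCommGroup (_ ⧸ Submodule.span k (chainRelations Q)))

noncomputable instance (Q : GradedQuiver.{u, v} k G) : Module k (Chains Q) :=
  inferInstanceAs (Module k (_ ⧸ Submodule.span k (chainRelations Q)))

/-- The chain `a₀[a₁|…|aₙ]` given by the word `[a₀, a₁, …, aₙ]`. -/
noncomputable def mk {Q : GradedQuiver.{u, v} k G} (l : List (Letter Q)) : Chains Q :=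
  Submodule.Quotient.mk (p := Submodule.span k (chainRelations Q)) (Finsupp.single l 1)

/-- A function on words respects the relations. -/
structure Respects {Q : GradedQuiver.{u, v} k G} {M : Type*} [AddCommGroup M] [Module k M]
    (φ : List (Letter Q) → M) : Prop where
  lin : ∀ (p q : List (Letter Q)) (x y : Q.Obj) (n : G) (c : k) (f g : Q.Hom x y n),
    φ (p ++ Letter.of Q (c • f + g) :: q) =
      c • φ (p ++ Letter.of Q f :: q) + φ (p ++ Letter.of Q g :: q)
  nc : ∀ l, ¬ IsCyclic l → φ l = 0

/-- A function on words that respects the relations defines a linear map on chains. -/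
noncomputable def Chains.lift {Q : GradedQuiver.{u, v} k G} {M : Type*} [AddCommGroup M]
    [Module k M] (φ : List (Letter Q) → M) (h : Respects φ) : Chains Q →ₗ[k] M :=
  Submodule.liftQ (Submodule.span k (chainRelations Q)) (Finsupp.linearCombination k φ) (by
    rw [Submodule.span_le]
    rintro r (⟨p, q, x, y, n, c, f, g, rfl⟩ | ⟨l, hl, rfl⟩)
    · simp [h.lin]
    · simp [h.nc l hl])

@[simp] theorem Chains.lift_mk {Q : GradedQuiver.{u, v} k G} {M : Type*} [AddCommGroup M]
    [Module k M] (φ : List (Letter Q) → M) (h : Respects φ) (l : List (Letter Q)) :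
    Chains.lift φ h (mk l) = φ l := by
  refine (Submodule.liftQ_apply (Submodule.span k (chainRelations Q))
    (Finsupp.linearCombination k φ) (Finsupp.single l 1)).trans ?_
  simp

theorem respects_mk (Q : GradedQuiver.{u, v} k G) : Respects (mk (Q := Q)) where
  lin p q x y n c f g := by
    have h : Finsupp.single (p ++ Letter.of Q (c • f + g) :: q) 1
        - (c • Finsupp.single (p ++ Letter.of Q f :: q) 1
        + Finsupp.single (p ++ Letter.of Q g :: q) 1) ∈ Submodule.span k (chainRelations Q) :=
      Submodule.subset_span (Or.inl ⟨p, q, x, y, n, c, f, g, by abel⟩)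
    exact (Submodule.Quotient.eq _).2 h
  nc l hl := (Submodule.Quotient.mk_eq_zero _).2
    (Submodule.subset_span (Or.inr ⟨l, hl, rfl⟩))

theorem mk_lin_of_eq {Q : GradedQuiver.{u, v} k G} (p q : List (Letter Q)) {x y : Q.Obj} {n : G}
    {c : k} {e f g : Q.Hom x y n} (h : e = c • f + g) :
    mk (p ++ Letter.of Q e :: q) = c • mk (p ++ Letter.of Q f :: q) + mk (p ++ Letter.of Q g :: q) := by
  rw [h]
  exact (respects_mk Q).lin p q x y n c f g

theorem mk_zero {Q : GradedQuiver.{u, v} k G} (p q : List (Letter Q)) (x y : Q.Obj) (n : G) :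
    mk (p ++ Letter.of Q (0 : Q.Hom x y n) :: q) = 0 := by
  have h := (respects_mk Q).lin p q x y n 1 0 0
  simpa using h

/-- The sum of the shifted degrees `|aᵢ| - 1` of the letters of a word. -/
def sdeg {Q : GradedQuiver.{u, v} k G} (l : List (Letter Q)) : G :=
  (l.map (fun a => a.deg - 1)).sum

/-- The chains of degree `g`; the word `a₀[a₁|…|aₙ]` has degree `|a₀| + ⋯ + |aₙ| - n`. -/
noncomputable def Chains.grade (Q : GradedQuiver.{u, v} k G) (g : G) : Submodule k (Chains Q) :=
  Submodule.span k {c | ∃ l : List (Letter Q), sdeg l + 1 = g ∧ c = mk l}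

/-! ### Cyclic composability -/

theorem isCyclic_iff {Q : GradedQuiver.{u, v} k G} (l : List (Letter Q)) :
    IsCyclic l ↔ l ≠ [] ∧ Cycle.Chain (fun s t => s.dom = t.cod) (l : Cycle (Letter Q)) := by
  cases l <;> simp [IsCyclic]

theorem isCyclic_swap {Q : GradedQuiver.{u, v} k G} (p q : List (Letter Q)) :
    IsCyclic (p ++ q) ↔ IsCyclic (q ++ p) := by
  rw [isCyclic_iff, isCyclic_iff]
  have : ((p ++ q : List (Letter Q)) : Cycle (Letter Q)) = (q ++ p : List (Letter Q)) :=
    Quotient.sound List.isRotated_append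
  rw [this]
  simp [and_comm]

/-- Cyclic composability depends only on the domains and codomains of the letters. -/
theorem isCyclic_congr {Q : GradedQuiver.{u, v} k G} {Q' : GradedQuiver.{u', v'} k G}
    (e : Q'.Obj → Q.Obj) (he : Function.Injective e)
    (l : List (Letter Q)) (l' : List (Letter Q'))
    (h : l.map (fun a => (a.cod, a.dom)) = l'.map (fun a => (e a.cod, e a.dom))) :
    IsCyclic l ↔ IsCyclic l' := by
  have h1 : l = [] ↔ l' = [] := by
    rw [← List.map_eq_nil_iff (f := fun a : Letter Q => (a.cod, a.dom)), h, List.map_eq_nil_iff]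
  rw [isCyclic_iff, isCyclic_iff, ne_eq, ne_eq, h1]
  refine and_congr_right fun _ => ?_
  have h2 := Cycle.chain_map (r := fun s t : Q.Obj × Q.Obj => s.2 = t.1)
    (fun a : Letter Q => (a.cod, a.dom)) (s := (l : Cycle (Letter Q)))
  have h3 := Cycle.chain_map (r := fun s t : Q.Obj × Q.Obj => s.2 = t.1)
    (fun a : Letter Q' => (e a.cod, e a.dom)) (s := (l' : Cycle (Letter Q')))
  rw [Cycle.map_coe] at h2 h3
  rw [h, h3] at h2
  simp only [he.eq_iff] at h2
  exact h2.symm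

theorem isCyclic_congr' {Q : GradedQuiver.{u, v} k G} (l l' : List (Letter Q))
    (h : l.map (fun a => (a.cod, a.dom)) = l'.map (fun a => (a.cod, a.dom))) :
    IsCyclic l ↔ IsCyclic l' :=
  isCyclic_congr id Function.injective_id l l' h

theorem isCyclic_merge {Q : GradedQuiver.{u, v} k G} (p q : List (Letter Q)) (a b c : Letter Q)
    (hab : a.dom = b.cod) (h1 : c.cod = a.cod) (h2 : c.dom = b.dom) :
    IsCyclic (p ++ a :: b :: q) ↔ IsCyclic (p ++ c :: q) := by
  rw [isCyclic_swap, isCyclic_swap p]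
  change List.IsChain _ (a :: (b :: (q ++ p) ++ [a])) ↔ List.IsChain _ (c :: ((q ++ p) ++ [c]))
  rcases q ++ p with _ | ⟨z, r⟩
  · simp [hab, h1, h2, eq_comm]
  · simp only [List.cons_append, List.isChain_cons_cons, hab, h2, true_and]
    refine and_congr_right fun _ => ?_
    rw [← List.cons_append, ← List.cons_append, List.isChain_append, List.isChain_append]
    simp [h1]

/-! ### The Hochschild differential -/

section Operators

variable (A : DGCat.{u, v} k G)

/-- The differential of a letter. -/
def Letter.diff (a : Letter A.toGradedQuiver) : Letter A.toGradedQuiver :=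
  Letter.of A.toGradedQuiver (A.d a.hom)

/-- The composition `a ∘ b` of two letters (the zero morphism if they are not composable). -/
noncomputable def Letter.mul (a b : Letter A.toGradedQuiver) : Letter A.toGradedQuiver :=
  open Classical in
  if h : b.cod = a.dom then
    Letter.of A.toGradedQuiver (A.comp (p := a.deg + b.deg) rfl a.hom (h ▸ b.hom))
  else Letter.of A.toGradedQuiver (0 : A.Hom b.dom a.cod (a.deg + b.deg))

/-- The identity of `x` as a letter. -/
def Letter.id (x : A.Obj) : Letter A.toGradedQuiver := Letter.of A.toGradedQuiver (A.one x)

/-- The part of the Hochschild differential that does not involve the cyclic face: for a word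
`a₀ … aₙ`, with `p = a₀ … aᵢ₋₁` the letters already passed, it is the sum over `j ≥ i` of the terms
`(-1) ^ (∑_{l<j} (|a_l| - 1)) · a₀[…|d aⱼ|…]` and
`(-1) ^ (∑_{l<j} (|a_l| - 1) + |aⱼ|) · a₀[…|aⱼ aⱼ₊₁|…]`. -/
noncomputable def barDiff :
    List (Letter A.toGradedQuiver) → List (Letter A.toGradedQuiver) → Chains A.toGradedQuiver
  | _, [] => 0
  | p, [a] => sgn k (sdeg p) • mk (p ++ [a.diff A])
  | p, a :: b :: l =>
      sgn k (sdeg p) • mk (p ++ a.diff A :: b :: l)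
        + (sgn k (sdeg p) * sgn k a.deg) • mk (p ++ a.mul A b :: l)
        + barDiff (p ++ [a]) (b :: l)

/-- The cyclic face
`(-1) ^ (|aₙ| + (|aₙ| - 1) * ∑_{l<n} (|a_l| - 1)) · (aₙ a₀)[a₁|…|aₙ₋₁]` of `a₀[a₁|…|aₙ]`, `n ≥ 1`;
the list is rotated to `aₙ, a₀, …, aₙ₋₁` first. -/
noncomputable def lastFace (l : List (Letter A.toGradedQuiver)) : Chains A.toGradedQuiver :=
  match l.rotate (l.length - 1) with
  | z :: a :: q =>
      (sgn k z.deg * sgn k ((z.deg - 1) * sdeg (a :: q))) • mk (z.mul A a :: q)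
  | _ => 0

/-- The inverse cyclic operator `t⁻¹` on words:
`a₀[a₁|…|aₙ] ↦ (-1) ^ ((|aₙ| - 1) * ∑_{l<n} (|a_l| - 1)) · aₙ[a₀|…|aₙ₋₁]`. -/
noncomputable def tInvWord {Q : GradedQuiver.{u, v} k G} (l : List (Letter Q)) : Chains Q :=
  match l.rotate (l.length - 1) with
  | z :: q => sgn k ((z.deg - 1) * sdeg q) • mk (z :: q)
  | [] => 0

theorem rotate_concat {α : Type*} (q : List α) (z : α) :
    (q ++ [z]).rotate ((q ++ [z]).length - 1) = z :: q := by
  simp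

@[simp] theorem mul_cod (a b : Letter A.toGradedQuiver) : (a.mul A b).cod = a.cod := by
  unfold Letter.mul; split_ifs <;> rfl

@[simp] theorem mul_dom (a b : Letter A.toGradedQuiver) : (a.mul A b).dom = b.dom := by
  unfold Letter.mul; split_ifs <;> rfl

theorem mk_diff_lin (p q : List (Letter A.toGradedQuiver)) (x y : A.Obj) (n : G) (c : k)
    (f g : A.Hom x y n) :
    mk (p ++ (Letter.of A.toGradedQuiver (c • f + g)).diff A :: q) =
      c • mk (p ++ (Letter.of A.toGradedQuiver f).diff A :: q)
        + mk (p ++ (Letter.of A.toGradedQuiver g).diff A :: q) := by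
  have := (respects_mk A.toGradedQuiver).lin p q x y (n + 1) c (A.d f) (A.d g)
  rw [← map_smul, ← map_add] at this
  exact this

theorem mul_of {x y z : A.Obj} {m n : G} (f : A.Hom y z m) (g : A.Hom x y n) :
    (Letter.of A.toGradedQuiver f).mul A (Letter.of A.toGradedQuiver g) =
      Letter.of A.toGradedQuiver (A.comp (p := m + n) rfl f g) :=
  dif_pos rfl

theorem mul_of_ne (a b : Letter A.toGradedQuiver) (h : ¬ b.cod = a.dom) :
    a.mul A b = Letter.of A.toGradedQuiver (0 : A.Hom b.dom a.cod (a.deg + b.deg)) :=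
  dif_neg h

theorem mk_mul_lin_left (p q : List (Letter A.toGradedQuiver)) (b : Letter A.toGradedQuiver)
    (x y : A.Obj) (n : G) (c : k) (f g : A.Hom x y n) :
    mk (p ++ (Letter.of A.toGradedQuiver (c • f + g)).mul A b :: q) =
      c • mk (p ++ (Letter.of A.toGradedQuiver f).mul A b :: q)
        + mk (p ++ (Letter.of A.toGradedQuiver g).mul A b :: q) := by
  by_cases h : b.cod = x
  · obtain ⟨bc, bd, bn, bh⟩ := b
    change bc = x at h
    subst h
    have h : A.comp (p := n + bn) rfl (c • f + g) bh = c • A.comp rfl f bh + A.comp rfl g bh := by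
      rw [map_add, map_smul]; rfl
    have e := fun f : A.Hom bc y n => mul_of A f bh
    change ∀ f, (Letter.of A.toGradedQuiver f).mul A ⟨bc, bd, bn, bh⟩ = _ at e
    rw [e, e, e]
    exact mk_lin_of_eq p q h
  · have e := fun f : A.Hom x y n => mul_of_ne A (Letter.of A.toGradedQuiver f) b h
    have z := fun f : A.Hom x y n =>
      mk_zero p q b.dom (Letter.of A.toGradedQuiver f).cod
        ((Letter.of A.toGradedQuiver f).deg + b.deg)
    rw [e, e, e, z, z, z, smul_zero, add_zero]

theorem mk_mul_lin_right (p q : List (Letter A.toGradedQuiver)) (a : Letter A.toGradedQuiver)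
    (x y : A.Obj) (n : G) (c : k) (f g : A.Hom x y n) :
    mk (p ++ a.mul A (Letter.of A.toGradedQuiver (c • f + g)) :: q) =
      c • mk (p ++ a.mul A (Letter.of A.toGradedQuiver f) :: q)
        + mk (p ++ a.mul A (Letter.of A.toGradedQuiver g) :: q) := by
  by_cases h : y = a.dom
  · obtain ⟨ac, ad, an, ah⟩ := a
    change y = ad at h
    subst h
    have h : A.comp (p := an + n) rfl ah (c • f + g) = c • A.comp rfl ah f + A.comp rfl ah g := by
      rw [map_add, map_smul]
    have e := fun f : A.Hom x y n => mul_of A ah f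
    change ∀ f, Letter.mul A ⟨ac, y, an, ah⟩ (Letter.of A.toGradedQuiver f) = _ at e
    rw [e, e, e]
    exact mk_lin_of_eq p q h
  · have e := fun f : A.Hom x y n => mul_of_ne A a (Letter.of A.toGradedQuiver f) h
    have z := fun f : A.Hom x y n =>
      mk_zero p q (Letter.of A.toGradedQuiver f).dom a.cod
        (a.deg + (Letter.of A.toGradedQuiver f).deg)
    rw [e, e, e, z, z, z, smul_zero, add_zero]

theorem sdeg_lin {Q : GradedQuiver.{u, v} k G} (p q : List (Letter Q)) {x y : Q.Obj} {n : G}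
    (f g : Q.Hom x y n) :
    sdeg (p ++ Letter.of Q f :: q) = sdeg (p ++ Letter.of Q g :: q) := by
  simp [sdeg, Letter.of]

theorem barDiff_lin_pre (p p' l : List (Letter A.toGradedQuiver)) (x y : A.Obj) (n : G) (c : k)
    (f g : A.Hom x y n) :
    barDiff A (p ++ Letter.of A.toGradedQuiver (c • f + g) :: p') l =
      c • barDiff A (p ++ Letter.of A.toGradedQuiver f :: p') l
        + barDiff A (p ++ Letter.of A.toGradedQuiver g :: p') l := by
  have L := fun q => (respects_mk A.toGradedQuiver).lin p q x y n c f g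
  have e1 := sdeg_lin p p' f (c • f + g)
  have e2 := sdeg_lin p p' g (c • f + g)
  induction l generalizing p' with
  | nil => simp [barDiff]
  | cons a l ih =>
    cases l with
    | nil =>
      simp only [barDiff, List.append_assoc, List.cons_append, L, e1, e2]
      module
    | cons b l =>
      have := ih (p' ++ [a]) (sdeg_lin p _ _ _) (sdeg_lin p _ _ _)
      simp only [barDiff, List.append_assoc, List.cons_append, L, e1, e2] at this ⊢
      rw [this]
      module

theorem barDiff_lin (r p q : List (Letter A.toGradedQuiver)) (x y : A.Obj) (n : G) (c : k)
    (f g : A.Hom x y n) :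
    barDiff A r (p ++ Letter.of A.toGradedQuiver (c • f + g) :: q) =
      c • barDiff A r (p ++ Letter.of A.toGradedQuiver f :: q)
        + barDiff A r (p ++ Letter.of A.toGradedQuiver g :: q) := by
  induction p generalizing r with
  | nil =>
    cases q with
    | nil =>
      simp only [barDiff, List.nil_append, mk_diff_lin]
      module
    | cons b q =>
      simp only [barDiff, List.nil_append, mk_diff_lin, mk_mul_lin_left, barDiff_lin_pre]
      simp only [Letter.of]
      module
  | cons a p ih =>
    cases p with
    | nil =>
      have L := (respects_mk A.toGradedQuiver).lin (r ++ [a.diff A]) q x y n c f g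
      have := ih (r ++ [a])
      simp only [List.nil_append, List.append_assoc, List.cons_append] at L this
      simp only [barDiff, List.nil_append, List.cons_append, mk_mul_lin_right, L, this]
      module
    | cons b p =>
      have L1 := (respects_mk A.toGradedQuiver).lin (r ++ a.diff A :: b :: p) q x y n c f g
      have L2 := (respects_mk A.toGradedQuiver).lin (r ++ a.mul A b :: p) q x y n c f g
      have := ih (r ++ [a])
      simp only [List.append_assoc, List.cons_append] at L1 L2 this
      simp only [barDiff, List.cons_append, L1, L2, this]
      module

theorem mk_eq_zero_of_not {Q : GradedQuiver.{u, v} k G} {l : List (Letter Q)}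
    (h : ¬ IsCyclic l) : mk l = 0 := (respects_mk Q).nc l h

theorem not_isCyclic_diff {p q : List (Letter A.toGradedQuiver)} {a : Letter A.toGradedQuiver}
    (h : ¬ IsCyclic (p ++ a :: q)) : ¬ IsCyclic (p ++ a.diff A :: q) := by
  rwa [isCyclic_congr' (p ++ a.diff A :: q) (p ++ a :: q)]
  simp [Letter.diff, Letter.of]

theorem mk_mul_eq_zero {p q : List (Letter A.toGradedQuiver)} {a b : Letter A.toGradedQuiver}
    (h : ¬ IsCyclic (p ++ a :: b :: q)) : mk (p ++ a.mul A b :: q) = 0 := by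
  by_cases hab : b.cod = a.dom
  · exact mk_eq_zero_of_not
      (mt (isCyclic_merge p q a b _ hab.symm (mul_cod A a b) (mul_dom A a b)).2 h)
  · rw [mul_of_ne A a b hab, mk_zero]

theorem barDiff_nc (p l : List (Letter A.toGradedQuiver)) (h : ¬ IsCyclic (p ++ l)) :
    barDiff A p l = 0 := by
  induction l generalizing p with
  | nil => rfl
  | cons a l ih =>
    cases l with
    | nil => simp [barDiff, mk_eq_zero_of_not (not_isCyclic_diff A h)]
    | cons b l =>
      simp [barDiff, mk_eq_zero_of_not (not_isCyclic_diff A h), mk_mul_eq_zero A h,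
        ih (p ++ [a]) (by simpa using h)]

theorem respects_lastFace : Respects (lastFace A) where
  lin p q x y n c f g := by
    have key : ∀ (q : List (Letter A.toGradedQuiver)) (z : Letter A.toGradedQuiver),
        lastFace A (q ++ [z]) = match q with
          | a :: q => (sgn k z.deg * sgn k ((z.deg - 1) * sdeg (a :: q))) • mk (z.mul A a :: q)
          | [] => 0 := by
      intro q z
      unfold lastFace
      rw [rotate_concat]
      cases q <;> rfl
    rcases List.eq_nil_or_concat q with rfl | ⟨q, z, rfl⟩
    · rw [key, key, key]
      cases p with
      | nil => simp
      | cons a p =>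
        have := mk_mul_lin_left A [] p a x y n c f g
        simp only [List.nil_append] at this
        simp only [this]
        simp only [Letter.of]
        module
    · have e : ∀ w : Letter A.toGradedQuiver, p ++ w :: q.concat z = (p ++ w :: q) ++ [z] := by
        intro w; simp
      rw [e, e, e, key, key, key]
      cases p with
      | nil =>
        have := mk_mul_lin_right A [] q z x y n c f g
        simp only [List.nil_append] at this ⊢
        simp only [this, sdeg, List.map_cons]
        simp only [Letter.of]
        module
      | cons a p =>
        have L := (respects_mk A.toGradedQuiver).lin (z.mul A a :: p) q x y n c f g
        have e1 := sdeg_lin (a :: p) q f (c • f + g)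
        have e2 := sdeg_lin (a :: p) q g (c • f + g)
        simp only [List.cons_append] at L e1 e2 ⊢
        simp only [L, e1, e2]
        module
  nc l hl := by
    rcases List.eq_nil_or_concat l with rfl | ⟨q, z, rfl⟩
    · rfl
    · rw [List.concat_eq_append] at hl ⊢
      unfold lastFace
      rw [rotate_concat]
      rw [isCyclic_swap] at hl
      cases q with
      | nil => rfl
      | cons a q =>
        have := mk_mul_eq_zero A (p := []) (q := q) (a := z) (b := a) hl
        simp only [List.nil_append] at this
        simp [this]

theorem respects_b : Respects (fun l => barDiff A [] l + lastFace A l) where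
  lin p q x y n c f g := by
    simp only [barDiff_lin, (respects_lastFace A).lin]
    module
  nc l hl := by
    simp only [(respects_lastFace A).nc l hl, barDiff_nc A [] l hl, add_zero]

/-- The Hochschild differential `b`. -/
noncomputable def hochB : Chains A.toGradedQuiver →ₗ[k] Chains A.toGradedQuiver :=
  Chains.lift _ (respects_b A)

theorem tInvWord_concat {Q : GradedQuiver.{u, v} k G} (q : List (Letter Q)) (z : Letter Q) :
    tInvWord (q ++ [z]) = sgn k ((z.deg - 1) * sdeg q) • mk (z :: q) := by
  unfold tInvWord
  rw [rotate_concat]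

theorem respects_tInvWord (Q : GradedQuiver.{u, v} k G) : Respects (tInvWord (Q := Q)) where
  lin p q x y n c f g := by
    rcases List.eq_nil_or_concat q with rfl | ⟨q, z, rfl⟩
    · have L := (respects_mk Q).lin [] p x y n c f g
      simp only [List.nil_append] at L
      simp only [tInvWord_concat, L]
      simp only [Letter.of]
      module
    · have e : ∀ w : Letter Q, p ++ w :: q.concat z = (p ++ w :: q) ++ [z] := by
        intro w; simp
      have L := (respects_mk Q).lin (z :: p) q x y n c f g
      have e1 := sdeg_lin p q f (c • f + g)
      have e2 := sdeg_lin p q g (c • f + g)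
      simp only [List.cons_append] at L
      simp only [e, tInvWord_concat, L, e1, e2]
      module
  nc l hl := by
    rcases List.eq_nil_or_concat l with rfl | ⟨q, z, rfl⟩
    · rfl
    · rw [List.concat_eq_append] at hl ⊢
      rw [isCyclic_swap] at hl
      rw [tInvWord_concat, mk_eq_zero_of_not (by simpa using hl), smul_zero]

/-- The inverse cyclic operator `t⁻¹`. -/
noncomputable def tInv (Q : GradedQuiver.{u, v} k G) : Chains Q →ₗ[k] Chains Q :=
  Chains.lift _ (respects_tInvWord Q)

theorem respects_norm (Q : GradedQuiver.{u, v} k G) :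
    Respects (fun l : List (Letter Q) => ∑ i ∈ Finset.range l.length, (tInv Q ^ i) (mk l)) where
  lin p q x y n c f g := by
    simp only [(respects_mk Q).lin, map_add, map_smul, Finset.sum_add_distrib, Finset.smul_sum,
      List.length_append, List.length_cons]
  nc l hl := by simp [mk_eq_zero_of_not hl]

/-- The norm operator `N = 1 + t⁻¹ + ⋯ + t⁻ⁿ` on words `a₀[a₁|…|aₙ]`. -/
noncomputable def normOp (Q : GradedQuiver.{u, v} k G) : Chains Q →ₗ[k] Chains Q :=
  Chains.lift _ (respects_norm Q)

/-- The operator `1 - t⁻¹`. -/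
noncomputable def oneSubT (Q : GradedQuiver.{u, v} k G) : Chains Q →ₗ[k] Chains Q :=
  LinearMap.id - tInv Q

/-- `a₀[a₁|…|aₙ] ↦ 1_{cod a₀}[a₀|…|aₙ]` on words. -/
noncomputable def sWord : List (Letter A.toGradedQuiver) → Chains A.toGradedQuiver
  | [] => 0
  | a :: l => mk (Letter.id A a.cod :: a :: l)

theorem respects_sWord : Respects (sWord A) where
  lin p q x y n c f g := by
    cases p with
    | nil => exact (respects_mk _).lin [Letter.id A y] q x y n c f g
    | cons a p => exact (respects_mk _).lin (Letter.id A a.cod :: a :: p) q x y n c f g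
  nc l hl := by
    cases l with
    | nil => rfl
    | cons a l =>
      refine mk_eq_zero_of_not fun h => hl ?_
      exact (isCyclic_merge [] l (Letter.id A a.cod) a a rfl rfl rfl).1 h

/-- The extra degeneracy `s : a₀[a₁|…|aₙ] ↦ 1_{cod a₀}[a₀|…|aₙ]`. -/
noncomputable def sOp : Chains A.toGradedQuiver →ₗ[k] Chains A.toGradedQuiver :=
  Chains.lift _ (respects_sWord A)

/-- Connes' operator `B = (1 - t⁻¹) s N`. -/
noncomputable def connesB : Chains A.toGradedQuiver →ₗ[k] Chains A.toGradedQuiver :=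
  oneSubT A.toGradedQuiver ∘ₗ sOp A ∘ₗ normOp A.toGradedQuiver

/-! ### The normalized complex -/

/-- The submodule spanned by the words `a₀[a₁|…|aₙ]` with an identity among `a₁, …, aₙ`. -/
noncomputable def degenerate : Submodule k (Chains A.toGradedQuiver) :=
  Submodule.span k {c | ∃ (a : Letter A.toGradedQuiver) (p q : List (Letter A.toGradedQuiver))
    (x : A.Obj), c = mk (a :: (p ++ Letter.id A x :: q))}

theorem mk_mem_degenerate (a : Letter A.toGradedQuiver) (p q : List (Letter A.toGradedQuiver))
    (x : A.Obj) : mk (a :: (p ++ Letter.id A x :: q)) ∈ degenerate A :=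
  Submodule.subset_span ⟨a, p, q, x, rfl⟩

theorem barDiff_pre_mem (a : Letter A.toGradedQuiver) (p q l : List (Letter A.toGradedQuiver))
    (x : A.Obj) : barDiff A (a :: (p ++ Letter.id A x :: q)) l ∈ degenerate A := by
  have M := fun r => mk_mem_degenerate A a p r x
  induction l generalizing q with
  | nil => exact zero_mem _
  | cons b l ih =>
    cases l with
    | nil =>
      simp only [barDiff, List.cons_append, List.append_assoc]
      exact Submodule.smul_mem _ _ (M _)
    | cons c l =>
      have := ih (q ++ [b])
      simp only [barDiff, List.cons_append, List.append_assoc] at this ⊢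
      exact add_mem (add_mem (Submodule.smul_mem _ _ (M _)) (Submodule.smul_mem _ _ (M _))) this

theorem letter_mul_id (a : Letter A.toGradedQuiver) : a.mul A (Letter.id A a.dom) = a := by
  obtain ⟨ac, ad, an, ah⟩ := a
  refine (mul_of A ah (A.one ad)).trans ?_
  have : ∀ m (h : an + 0 = m) (h' : m = an), Letter.of A.toGradedQuiver (A.comp h ah (A.one ad)) =
      Letter.of A.toGradedQuiver ah := by
    rintro m h rfl
    rw [A.comp_one]
  exact this _ rfl (add_zero _)

theorem letter_id_mul (a : Letter A.toGradedQuiver) : (Letter.id A a.cod).mul A a = a := by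
  obtain ⟨ac, ad, an, ah⟩ := a
  refine (mul_of A (A.one ac) ah).trans ?_
  have : ∀ m (h : 0 + an = m) (h' : m = an), Letter.of A.toGradedQuiver (A.comp h (A.one ac) ah) =
      Letter.of A.toGradedQuiver ah := by
    rintro m h rfl
    rw [A.one_comp]
  exact this _ rfl (zero_add _)

theorem mk_diff_id (p q : List (Letter A.toGradedQuiver)) (x : A.Obj) :
    mk (p ++ (Letter.id A x).diff A :: q) = 0 := by
  have : (Letter.id A x).diff A = Letter.of A.toGradedQuiver (0 : A.Hom x x (0 + 1)) :=
    congrArg (Letter.of A.toGradedQuiver) (A.d_one x)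
  rw [this, mk_zero]

theorem sgn_mul_self (g : G) : sgn k g * sgn k g = 1 := by
  unfold sgn; split_ifs <;> simp

theorem sgn_add (g h : G) : sgn k (g + h) = sgn k g * sgn k h := by
  unfold sgn
  rw [map_add]
  generalize GradingRing.parity (G := G) g = a
  generalize GradingRing.parity (G := G) h = b
  have ha : ∀ a : ZMod 2, a = 0 ∨ a = 1 := by decide
  have h2 : (1 + 1 : ZMod 2) = 0 := by decide
  rcases ha a with rfl | rfl <;> rcases ha b with rfl | rfl <;> simp [h2]

theorem sgn_zero : sgn k (0 : G) = 1 := by simp [sgn]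

theorem sgn_one : sgn k (1 : G) = -1 := by simp [sgn]

theorem sgn_neg (g : G) : sgn k (-g) = sgn k g := by
  simp [sgn]

theorem sdeg_concat {Q : GradedQuiver.{u, v} k G} (p : List (Letter Q)) (a : Letter Q) :
    sgn k (sdeg (p ++ [a])) = -(sgn k (sdeg p) * sgn k a.deg) := by
  have : sdeg (p ++ [a]) = sdeg p + (a.deg + -1) := by simp [sdeg, sub_eq_add_neg]
  rw [this, sgn_add, sgn_add, sgn_neg, sgn_one]
  ring

theorem isCyclic_adj {Q : GradedQuiver.{u, v} k G} {p q : List (Letter Q)} {a b : Letter Q}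
    (h : IsCyclic (p ++ a :: b :: q)) : a.dom = b.cod := by
  rw [isCyclic_swap] at h
  exact (List.isChain_cons_cons.1 h).1

theorem barDiff_degenerate_head (p q : List (Letter A.toGradedQuiver))
    (a c : Letter A.toGradedQuiver) (x : A.Obj)
    (hc : IsCyclic (p ++ a :: Letter.id A x :: c :: q)) :
    barDiff A p (a :: Letter.id A x :: c :: q) ∈ degenerate A := by
  have h1 : a.dom = x := isCyclic_adj hc
  have h2 : x = c.cod := by
    have : IsCyclic ((p ++ [a]) ++ Letter.id A x :: c :: q) := by simpa using hc
    exact isCyclic_adj this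
  have M : ∀ (b : Letter A.toGradedQuiver) l, mk (p ++ b :: Letter.id A x :: l) ∈ degenerate A := by
    intro b l
    cases p with
    | nil => exact mk_mem_degenerate A b [] l x
    | cons z p => simpa using mk_mem_degenerate A z (p ++ [b]) l x
  have R : barDiff A (p ++ [a] ++ [Letter.id A x]) (c :: q) ∈ degenerate A := by
    cases p with
    | nil => exact barDiff_pre_mem A a [] [] (c :: q) x
    | cons z p => simpa using barDiff_pre_mem A z (p ++ [a]) [] (c :: q) x
  have e1 : a.mul A (Letter.id A x) = a := by rw [← h1, letter_mul_id]
  have e2 : (Letter.id A x).mul A c = c := by rw [h2, letter_id_mul]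
  have e3 : (Letter.id A x).deg = 0 := rfl
  have e4 := mk_diff_id A (p ++ [a]) (c :: q) x
  simp only [barDiff, e1, e2, e3, e4, sgn_zero, sdeg_concat, smul_zero, zero_add, mul_one]
  have : (sgn k (sdeg p) * sgn k a.deg) • mk (p ++ a :: c :: q)
      + (-(sgn k (sdeg p) * sgn k a.deg) • mk (p ++ [a] ++ c :: q)
        + barDiff A (p ++ [a] ++ [Letter.id A x]) (c :: q)) =
      barDiff A (p ++ [a] ++ [Letter.id A x]) (c :: q) := by
    simp only [List.append_assoc, List.cons_append, List.nil_append]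
    module
  rw [add_assoc, this]
  exact add_mem (Submodule.smul_mem _ _ (M _ _)) R

theorem barDiff_degenerate_last (p : List (Letter A.toGradedQuiver))
    (a : Letter A.toGradedQuiver) (x : A.Obj)
    (hc : IsCyclic (p ++ [a, Letter.id A x])) :
    barDiff A p [a, Letter.id A x] - (sgn k (sdeg p) * sgn k a.deg) • mk (p ++ [a])
      ∈ degenerate A := by
  have h1 : a.dom = x := isCyclic_adj hc
  have M : ∀ (b : Letter A.toGradedQuiver) l, mk (p ++ b :: Letter.id A x :: l) ∈ degenerate A := by
    intro b l
    cases p with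
    | nil => exact mk_mem_degenerate A b [] l x
    | cons z p => simpa using mk_mem_degenerate A z (p ++ [b]) l x
  have e1 : a.mul A (Letter.id A x) = a := by rw [← h1, letter_mul_id]
  have e4 := mk_diff_id A (p ++ [a]) [] x
  simp only [barDiff, e1, e4, smul_zero, add_zero, add_sub_cancel_right]
  exact Submodule.smul_mem _ _ (M _ _)

theorem barDiff_degenerate (r p q : List (Letter A.toGradedQuiver))
    (a c : Letter A.toGradedQuiver) (x : A.Obj)
    (hc : IsCyclic (r ++ (p ++ a :: Letter.id A x :: c :: q))) :
    barDiff A r (p ++ a :: Letter.id A x :: c :: q) ∈ degenerate A := by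
  induction p generalizing r with
  | nil => exact barDiff_degenerate_head A r q a c x hc
  | cons y p ih =>
    have M : ∀ (b : Letter A.toGradedQuiver) l l',
        mk (r ++ b :: (l ++ Letter.id A x :: l')) ∈ degenerate A := by
      intro b l l'
      cases r with
      | nil => exact mk_mem_degenerate A b l l' x
      | cons z r => simpa using mk_mem_degenerate A z (r ++ b :: l) l' x
    have := ih (r ++ [y]) (by simpa using hc)
    cases p with
    | nil =>
      simp only [List.nil_append, List.cons_append, barDiff] at this ⊢
      exact add_mem (add_mem (Submodule.smul_mem _ _ (M _ [a] _))
        (Submodule.smul_mem _ _ (M _ [] _))) this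
    | cons z p =>
      simp only [List.cons_append, barDiff] at this ⊢
      exact add_mem (add_mem (Submodule.smul_mem _ _ (by simpa using M _ (z :: (p ++ [a])) (c :: q)))
        (Submodule.smul_mem _ _ (by simpa using M _ (p ++ [a]) (c :: q)))) this

theorem barDiff_degenerate' (r p : List (Letter A.toGradedQuiver))
    (a : Letter A.toGradedQuiver) (x : A.Obj)
    (hc : IsCyclic (r ++ (p ++ [a, Letter.id A x]))) :
    barDiff A r (p ++ [a, Letter.id A x])
      + sgn k (sdeg (r ++ (p ++ [a]))) • mk (r ++ (p ++ [a])) ∈ degenerate A := by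
  induction p generalizing r with
  | nil =>
    have := barDiff_degenerate_last A r a x hc
    simp only [List.nil_append, sdeg_concat]
    rwa [neg_smul, ← sub_eq_add_neg]
  | cons y p ih =>
    have M : ∀ (b : Letter A.toGradedQuiver) l l',
        mk (r ++ b :: (l ++ Letter.id A x :: l')) ∈ degenerate A := by
      intro b l l'
      cases r with
      | nil => exact mk_mem_degenerate A b l l' x
      | cons z r => simpa using mk_mem_degenerate A z (r ++ b :: l) l' x
    have := ih (r ++ [y]) (by simpa using hc)
    cases p with
    | nil =>
      simp only [List.nil_append, List.cons_append, List.append_assoc, barDiff] at this ⊢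
      rw [add_assoc]
      exact add_mem (add_mem (Submodule.smul_mem _ _ (M _ [a] _))
        (Submodule.smul_mem _ _ (M _ [] _))) this
    | cons z p =>
      simp only [List.cons_append, List.append_assoc, List.nil_append, barDiff] at this ⊢
      rw [add_assoc]
      exact add_mem (add_mem (Submodule.smul_mem _ _ (by simpa using M _ (z :: (p ++ [a])) []))
        (Submodule.smul_mem _ _ (by simpa using M _ (p ++ [a]) []))) this

theorem lastFace_concat (q : List (Letter A.toGradedQuiver)) (a z : Letter A.toGradedQuiver) :
    lastFace A (a :: (q ++ [z])) =
      (sgn k z.deg * sgn k ((z.deg - 1) * sdeg (a :: q))) • mk (z.mul A a :: q) := by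
  unfold lastFace
  rw [← List.cons_append, rotate_concat]

theorem hochB_degenerate : degenerate A ≤ (degenerate A).comap (hochB A) := by
  refine Submodule.span_le.2 ?_
  rintro _ ⟨a, p, q, x, rfl⟩
  change hochB A (mk _) ∈ degenerate A
  by_cases hc : IsCyclic (a :: (p ++ Letter.id A x :: q))
  swap
  · rw [mk_eq_zero_of_not hc, map_zero]
    exact zero_mem _
  rw [hochB, Chains.lift_mk]
  -- the letter in front of the identity
  obtain ⟨p', a', hp⟩ : ∃ p' a', a :: p = p' ++ [a'] := by
    rcases List.eq_nil_or_concat (a :: p) with h | ⟨p', a', h⟩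
    · simp at h
    · exact ⟨p', a', by simpa using h⟩
  have hw : ∀ l, a :: (p ++ Letter.id A x :: l) = p' ++ a' :: Letter.id A x :: l := by
    intro l
    rw [← List.cons_append, hp]; simp
  rcases List.eq_nil_or_concat q with rfl | ⟨q, z, rfl⟩
  · rw [lastFace_concat, hw [], hp]
    have key := barDiff_degenerate' A [] p' a' x (by simpa [hw [], hp] using hc)
    have hx : x = a.cod := by
      rw [← List.cons_append, isCyclic_swap] at hc
      exact isCyclic_adj (p := []) hc
    have e : (Letter.id A x).mul A a = a := by rw [hx, letter_id_mul]
    have e3 : (Letter.id A x).deg = 0 := rfl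
    rw [e, e3, sgn_zero, one_mul, zero_sub, neg_one_mul, sgn_neg, hp]
    exact key
  · rw [List.concat_eq_append] at hc ⊢
    refine add_mem ?_ ?_
    · rw [hw] at hc ⊢
      cases q with
      | nil => exact barDiff_degenerate A [] p' [] a' z x hc
      | cons c q => exact barDiff_degenerate A [] p' (q ++ [z]) a' c x hc
    · have e : a :: (p ++ Letter.id A x :: (q ++ [z])) =
          a :: ((p ++ Letter.id A x :: q) ++ [z]) := by simp
      rw [e, lastFace_concat]
      exact Submodule.smul_mem _ _ (mk_mem_degenerate A _ p q x)

/-- The span of the words that contain an identity (in any position). -/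
noncomputable def withId : Submodule k (Chains A.toGradedQuiver) :=
  Submodule.span k {c | ∃ (p q : List (Letter A.toGradedQuiver)) (x : A.Obj),
    c = mk (p ++ Letter.id A x :: q)}

theorem tInv_withId (c : Chains A.toGradedQuiver) (hc : c ∈ withId A) :
    tInv A.toGradedQuiver c ∈ withId A := by
  suffices h : withId A ≤ (withId A).comap (tInv A.toGradedQuiver) from h hc
  refine Submodule.span_le.2 ?_
  rintro _ ⟨p, q, x, rfl⟩
  change tInv A.toGradedQuiver (mk _) ∈ withId A
  rw [tInv, Chains.lift_mk]
  rcases List.eq_nil_or_concat q with rfl | ⟨q, z, rfl⟩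
  · rw [tInvWord_concat]
    exact Submodule.smul_mem _ _ (Submodule.subset_span ⟨[], p, x, rfl⟩)
  · rw [List.concat_eq_append, ← List.cons_append, ← List.append_assoc, tInvWord_concat]
    exact Submodule.smul_mem _ _ (Submodule.subset_span ⟨z :: p, q, x, rfl⟩)

theorem connesB_degenerate : degenerate A ≤ (degenerate A).comap (connesB A) := by
  have h1 : degenerate A ≤ (withId A).comap (normOp A.toGradedQuiver) := by
    refine Submodule.span_le.2 ?_
    rintro _ ⟨a, p, q, x, rfl⟩
    change normOp A.toGradedQuiver (mk _) ∈ withId A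
    rw [normOp, Chains.lift_mk]
    refine sum_mem fun i hi => ?_
    clear hi
    induction i with
    | zero => exact Submodule.subset_span ⟨a :: p, q, x, rfl⟩
    | succ i ih =>
      rw [pow_succ']
      exact tInv_withId A _ ih
  have h2 : withId A ≤ (degenerate A).comap
      (oneSubT A.toGradedQuiver ∘ₗ sOp A) := by
    refine Submodule.span_le.2 ?_
    rintro _ ⟨p, q, x, rfl⟩
    change sOp A (mk _) - tInv A.toGradedQuiver (sOp A (mk _)) ∈ degenerate A
    obtain ⟨y, l, hl⟩ : ∃ y l, p ++ Letter.id A x :: q = y :: l := by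
      cases p with
      | nil => exact ⟨_, _, rfl⟩
      | cons y p => exact ⟨_, _, rfl⟩
    have e : sOp A (mk (p ++ Letter.id A x :: q)) =
        mk (Letter.id A y.cod :: (p ++ Letter.id A x :: q)) := by
      rw [sOp, Chains.lift_mk, hl]; rfl
    rw [e]
    refine sub_mem (mk_mem_degenerate A _ p q x) ?_
    rw [tInv, Chains.lift_mk]
    rcases List.eq_nil_or_concat (p ++ Letter.id A x :: q) with h | ⟨r, z, h⟩
    · simp at h
    · rw [h, List.concat_eq_append, ← List.cons_append, tInvWord_concat]
      exact Submodule.smul_mem _ _ (mk_mem_degenerate A z [] r y.cod)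
  intro c hc
  exact h2 (h1 hc)

/-- The normalized Hochschild chains. -/
abbrev NChains : Type _ := Chains A.toGradedQuiver ⧸ degenerate A

/-- The differential of the normalized Hochschild complex. -/
noncomputable def hochBbar : NChains A →ₗ[k] NChains A :=
  Submodule.mapQ _ _ (hochB A) (hochB_degenerate A)

/-- Connes' operator on the normalized Hochschild complex. -/
noncomputable def connesBbar : NChains A →ₗ[k] NChains A :=
  Submodule.mapQ _ _ (connesB A) (connesB_degenerate A)

/-- The normalized chains of degree `g`. -/
noncomputable def NChains.grade (g : G) : Submodule k (NChains A) :=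
  (Chains.grade A.toGradedQuiver g).map (degenerate A).mkQ

end Operators

/-! ### Semifunctors -/

/-- A degree-preserving map of graded quivers. -/
structure QuiverHom (Q : GradedQuiver.{u, v} k G) (Q' : GradedQuiver.{u', v'} k G) where
  obj : Q.Obj → Q'.Obj
  map : ∀ {x y : Q.Obj} {n : G}, Q.Hom x y n →ₗ[k] Q'.Hom (obj x) (obj y) n

/-- A semifunctor (non-unital dg functor): it preserves differentials and compositions, but not
necessarily identities. -/
structure Semifunctor (A : DGCat.{u, v} k G) (B : DGCat.{u', v'} k G)
    extends QuiverHom A.toGradedQuiver B.toGradedQuiver where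
  map_d : ∀ {x y : A.Obj} {n : G} (f : A.Hom x y n), map (A.d f) = B.d (map f)
  map_comp : ∀ {x y z : A.Obj} {m n p : G} (h : m + n = p) (f : A.Hom y z m) (g : A.Hom x y n),
    map (A.comp h f g) = B.comp h (map f) (map g)

/-- The action of a map of quivers on letters. -/
def QuiverHom.letter {Q : GradedQuiver.{u, v} k G} {Q' : GradedQuiver.{u', v'} k G}
    (F : QuiverHom Q Q') (a : Letter Q) : Letter Q' :=
  Letter.of Q' (F.map a.hom)

theorem isCyclic_lin {Q : GradedQuiver.{u, v} k G} (p q : List (Letter Q)) {x y : Q.Obj} {n : G}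
    (f g : Q.Hom x y n) :
    IsCyclic (p ++ Letter.of Q f :: q) ↔ IsCyclic (p ++ Letter.of Q g :: q) :=
  isCyclic_congr' _ _ (by simp [Letter.of])

theorem mk_letter_lin {Q : GradedQuiver.{u, v} k G} {Q' : GradedQuiver.{u', v'} k G}
    (F : QuiverHom Q Q') (p q : List (Letter Q')) (x y : Q.Obj) (n : G) (c : k)
    (f g : Q.Hom x y n) :
    mk (p ++ F.letter (Letter.of Q (c • f + g)) :: q) =
      c • mk (p ++ F.letter (Letter.of Q f) :: q) + mk (p ++ F.letter (Letter.of Q g) :: q) :=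
  mk_lin_of_eq p q (e := F.map (c • f + g)) (f := F.map f) (g := F.map g)
    (by rw [map_add, map_smul])

open Classical in
theorem respects_map {Q : GradedQuiver.{u, v} k G} {Q' : GradedQuiver.{u', v'} k G}
    (F : QuiverHom Q Q') :
    Respects (fun l : List (Letter Q) => if IsCyclic l then mk (l.map F.letter) else 0) where
  lin p q x y n c f g := by
    simp only [isCyclic_lin p q (c • f + g) 0, isCyclic_lin p q f 0, isCyclic_lin p q g 0,
      List.map_append, List.map_cons, mk_letter_lin]
    split_ifs <;> simp
  nc l hl := if_neg hl

open Classical in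
/-- The map `F_*` induced on Hochschild chains,
`a₀[a₁|…|aₙ] ↦ F(a₀)[F(a₁)|…|F(aₙ)]` on cyclically composable words. -/
noncomputable def Chains.map {Q : GradedQuiver.{u, v} k G} {Q' : GradedQuiver.{u', v'} k G}
    (F : QuiverHom Q Q') : Chains Q →ₗ[k] Chains Q' :=
  Chains.lift _ (respects_map F)

theorem Chains.map_mk {Q : GradedQuiver.{u, v} k G} {Q' : GradedQuiver.{u', v'} k G}
    (F : QuiverHom Q Q') (l : List (Letter Q)) (hl : IsCyclic l) :
    Chains.map F (mk l) = mk (l.map F.letter) := by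
  rw [Chains.map, Chains.lift_mk, if_pos hl]

/-! ### The non-unital Hochschild complex -/

open Classical in
/-- The space of multiples of the adjoined identity among the morphisms `x ⟶ y` of degree `n`:
all of `k` if `x = y` and `n = 0`, and `0` otherwise. -/
noncomputable def extra (Q : GradedQuiver.{u, v} k G) (x y : Q.Obj) (n : G) : Submodule k k :=
  if x = y ∧ n = 0 then ⊤ else ⊥

theorem extra_eq_zero {Q : GradedQuiver.{u, v} k G} {x y : Q.Obj} {n : G} (c : extra Q x y n)
    (h : ¬ (x = y ∧ n = 0)) : c.1 = 0 := by
  have e : extra Q x y n = ⊥ := if_neg h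
  rw [← Submodule.mem_bot k, ← e]
  exact c.2

/-- The graded quiver underlying `A⁺`, obtained by adjoining an identity `e_x` to each object. -/
noncomputable def Plus (Q : GradedQuiver.{u, v} k G) : GradedQuiver.{u, max v uk} k G where
  Obj := Q.Obj
  Hom x y n := Q.Hom x y n × extra Q x y n

/-- The adjoined identity `e_x` as a letter. -/
noncomputable def Plus.e (Q : GradedQuiver.{u, v} k G) (x : Q.Obj) : Letter (Plus Q) :=
  Letter.of (Plus Q) (x := x) (y := x) (n := 0) ((0 : Q.Hom x x 0), ⟨1, by simp [extra]⟩)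

/-- The inclusion `A → A⁺`. -/
noncomputable def Plus.inl (Q : GradedQuiver.{u, v} k G) : QuiverHom Q (Plus Q) where
  obj x := x
  map := fun {x y : Q.Obj} {n : G} => LinearMap.inl k (Q.Hom x y n) (extra Q x y n)

/-- The projection `A⁺ → A` that kills the adjoined identities. -/
noncomputable def Plus.fst (Q : GradedQuiver.{u, v} k G) : QuiverHom (Plus Q) Q where
  obj x := x
  map := fun {x y : Q.Obj} {n : G} => LinearMap.fst k (Q.Hom x y n) (extra Q x y n)

/-- The map `F⁺ : A⁺ → B⁺` with `F⁺(e_x) = e_{F x}`. -/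
noncomputable def Plus.map {Q : GradedQuiver.{u, v} k G} {Q' : GradedQuiver.{u', v'} k G}
    (F : QuiverHom Q Q') : QuiverHom (Plus Q) (Plus Q') where
  obj := F.obj
  map {x y n} := LinearMap.prodMap F.map (Submodule.inclusion (by
    unfold extra
    split_ifs with h1 h2
    · exact le_rfl
    · exact absurd ⟨congrArg F.obj h1.1, h1.2⟩ h2
    · exact bot_le
    · exact le_rfl))

/-- The submodule `D` of the chains of `A⁺` spanned by the chains `e_x` and the words
`a₀[a₁|…|aₙ]` with `aᵢ = e_x` for some `i > 0` and some `x`. -/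
noncomputable def Plus.D (Q : GradedQuiver.{u, v} k G) : Submodule k (Chains (Plus Q)) :=
  Submodule.span k ({c | ∃ x : Q.Obj, c = mk [Plus.e Q x]} ∪
    {c | ∃ (a : Letter (Plus Q)) (p q : List (Letter (Plus Q))) (x : Q.Obj),
      c = mk (a :: (p ++ Plus.e Q x :: q))})

/-- The non-unital Hochschild chains `C^e(A) = C(A⁺) / D`. -/
abbrev EChains (Q : GradedQuiver.{u, v} k G) : Type _ := Chains (Plus Q) ⧸ Plus.D Q

/-- The natural map `C(A) → C(A⁺) → C^e(A)`. -/
noncomputable def jMap (Q : GradedQuiver.{u, v} k G) : Chains Q →ₗ[k] EChains Q :=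
  (Plus.D Q).mkQ ∘ₗ Chains.map (Plus.inl Q)

theorem map_e {Q : GradedQuiver.{u, v} k G} {Q' : GradedQuiver.{u', v'} k G}
    (F : QuiverHom Q Q') (x : Q.Obj) :
    (Plus.map F).letter (Plus.e Q x) = Plus.e Q' (F.obj x) := by
  change Letter.of (Plus Q') (x := F.obj x) (y := F.obj x) (n := (0 : G))
    (F.map (0 : Q.Hom x x 0), _) = _
  simp only [map_zero]
  rfl

theorem map_D {Q : GradedQuiver.{u, v} k G} {Q' : GradedQuiver.{u', v'} k G}
    (F : QuiverHom Q Q') : Plus.D Q ≤ (Plus.D Q').comap (Chains.map (Plus.map F)) := by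
  have h0 : ∀ l : List (Letter (Plus Q)), mk (l.map (Plus.map F).letter) ∈ Plus.D Q' →
      Chains.map (Plus.map F) (mk l) ∈ Plus.D Q' := by
    intro l hl
    by_cases hc : IsCyclic l
    · rwa [Chains.map_mk _ _ hc]
    · rw [mk_eq_zero_of_not hc, map_zero]
      exact zero_mem _
  refine Submodule.span_le.2 ?_
  rintro _ (⟨x, rfl⟩ | ⟨a, p, q, x, rfl⟩)
  · refine h0 _ (Submodule.subset_span (Or.inl ⟨F.obj x, ?_⟩))
    rw [← map_e]; rfl
  · refine h0 _ (Submodule.subset_span (Or.inr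
      ⟨(Plus.map F).letter a, p.map (Plus.map F).letter, q.map (Plus.map F).letter, F.obj x, ?_⟩))
    rw [← map_e]
    simp only [List.map_cons, List.map_append]

/-- The map `F^e_* : C^e(A) → C^e(B)` induced by `F⁺`. -/
noncomputable def EChains.map {Q : GradedQuiver.{u, v} k G} {Q' : GradedQuiver.{u', v'} k G}
    (F : QuiverHom Q Q') : EChains Q →ₗ[k] EChains Q' :=
  Submodule.mapQ _ _ (Chains.map (Plus.map F)) (map_D F)

/-- `a₀[a₁|…|aₙ] ↦ e_{cod a₀}[a₀|…|aₙ]` on words. -/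
noncomputable def seWord (Q : GradedQuiver.{u, v} k G) : List (Letter Q) → Chains (Plus Q)
  | [] => 0
  | a :: l => mk (Plus.e Q a.cod :: (a :: l).map (Plus.inl Q).letter)

theorem respects_seWord (Q : GradedQuiver.{u, v} k G) : Respects (seWord Q) where
  lin p q x y n c f g := by
    cases p with
    | nil => exact mk_letter_lin (Plus.inl Q) [Plus.e Q y] (q.map (Plus.inl Q).letter) x y n c f g
    | cons a p =>
      have := mk_letter_lin (Plus.inl Q)
        (Plus.e Q a.cod :: (a :: p).map (Plus.inl Q).letter) (q.map (Plus.inl Q).letter) x y n c f g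
      simpa only [List.cons_append, seWord, List.map_cons, List.map_append] using this
  nc l hl := by
    cases l with
    | nil => rfl
    | cons a l =>
      refine mk_eq_zero_of_not fun h => hl ?_
      have h1 := (isCyclic_merge [] (l.map (Plus.inl Q).letter) (Plus.e Q a.cod)
        ((Plus.inl Q).letter a) ((Plus.inl Q).letter a) rfl rfl rfl).1 h
      refine (isCyclic_congr (Q := Q) (Q' := Plus Q) (fun x => x) (fun _ _ h => h) (a :: l)
        ((a :: l).map (Plus.inl Q).letter) ?_).2 h1
      rw [List.map_map]
      rfl

/-- The operator `s^e : C(A) → C^e(A)`, `a₀[a₁|…|aₙ] ↦ e_{cod a₀}[a₀|…|aₙ]`. -/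
noncomputable def seOp (Q : GradedQuiver.{u, v} k G) : Chains Q →ₗ[k] EChains Q :=
  (Plus.D Q).mkQ ∘ₗ Chains.lift _ (respects_seWord Q)

section PMap

variable (A : DGCat.{u, v} k G)

/-- The map `p` on words of `A⁺`: for `a₀ = (a, c e_x)` and `a₁, …, aₙ` in `A`, the word
`a₀[a₁|…|aₙ]` goes to `a[a₁|…|aₙ] + c (1 - t⁻¹) 1_x[a₁|…|aₙ]`. -/
noncomputable def pWord : List (Letter (Plus A.toGradedQuiver)) → Chains A.toGradedQuiver
  | [] => 0
  | a :: l => mk ((a :: l).map (Plus.fst A.toGradedQuiver).letter)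
      + a.hom.2.1 • oneSubT A.toGradedQuiver
          (mk (Letter.id A a.cod :: l.map (Plus.fst A.toGradedQuiver).letter))

theorem isCyclic_fst (l : List (Letter (Plus A.toGradedQuiver))) :
    IsCyclic (l.map (Plus.fst A.toGradedQuiver).letter) ↔ IsCyclic l := by
  refine isCyclic_congr (Q := A.toGradedQuiver) (Q' := Plus A.toGradedQuiver) (fun x => x) (fun _ _ h => h) _ _ ?_
  rw [List.map_map]
  rfl

theorem respects_pWord : Respects (pWord A) where
  lin p q x y n c f g := by
    cases p with
    | nil =>
      have := mk_letter_lin (Plus.fst A.toGradedQuiver) []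
        (q.map (Plus.fst A.toGradedQuiver).letter) x y n c f g
      simp only [List.nil_append] at this
      have h2 : (c • f + g).2.1 = c * f.2.1 + g.2.1 := rfl
      simp only [List.nil_append, pWord, List.map_cons, this]
      change _ + (c • f + g).2.1 • _ = c • (_ + f.2.1 • _) + (_ + g.2.1 • _)
      rw [h2]
      change _ + _ • oneSubT A.toGradedQuiver (mk (Letter.id A y :: _)) =
        c • (_ + _ • oneSubT A.toGradedQuiver (mk (Letter.id A y :: _))) +
          (_ + _ • oneSubT A.toGradedQuiver (mk (Letter.id A y :: _)))
      module
    | cons a p =>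
      have L1 := mk_letter_lin (Plus.fst A.toGradedQuiver)
        ((a :: p).map (Plus.fst A.toGradedQuiver).letter)
        (q.map (Plus.fst A.toGradedQuiver).letter) x y n c f g
      have L2 := mk_letter_lin (Plus.fst A.toGradedQuiver)
        (Letter.id A a.cod :: p.map (Plus.fst A.toGradedQuiver).letter)
        (q.map (Plus.fst A.toGradedQuiver).letter) x y n c f g
      simp only [List.cons_append, List.map_cons] at L1 L2
      simp only [List.cons_append, pWord, List.map_cons, List.map_append, L1, L2, map_add,
        map_smul]
      module
  nc l hl := by
    cases l with
    | nil => rfl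
    | cons a l =>
      have h1 : mk ((a :: l).map (Plus.fst A.toGradedQuiver).letter) = 0 :=
        mk_eq_zero_of_not (mt (isCyclic_fst A _).1 hl)
      by_cases h : a.dom = a.cod ∧ a.deg = 0
      · have h2 : mk (Letter.id A a.cod :: l.map (Plus.fst A.toGradedQuiver).letter) = 0 := by
          refine mk_eq_zero_of_not fun hc => hl ?_
          rw [← isCyclic_fst]
          refine (isCyclic_congr' _ _ ?_).1 hc
          change (a.cod, a.cod) :: _ = (a.cod, a.dom) :: _
          rw [h.1]
        simp only [pWord, h1, h2, map_zero, smul_zero, add_zero]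
      · have h2 := extra_eq_zero a.hom.2 h
        simp only [pWord, h1, h2, zero_smul, add_zero]

theorem pWord_D : Plus.D A.toGradedQuiver ≤ LinearMap.ker (Chains.lift _ (respects_pWord A)) := by
  have h0 : ∀ p q (x : A.Obj), mk (p ++ (Plus.fst A.toGradedQuiver).letter
      (Plus.e A.toGradedQuiver x) :: q) = 0 := fun p q x => mk_zero p q x x 0
  refine Submodule.span_le.2 ?_
  rintro _ (⟨x, rfl⟩ | ⟨a, p, q, x, rfl⟩)
  · change Chains.lift _ (respects_pWord A) (mk _) = 0
    rw [Chains.lift_mk]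
    have h1 := h0 [] [] x
    have h2 : tInv A.toGradedQuiver (mk [Letter.id A x]) = mk [Letter.id A x] := by
      have := tInvWord_concat [] (Letter.id A x)
      rw [List.nil_append] at this
      rw [tInv, Chains.lift_mk, this]
      simp [sdeg, sgn_zero]
    simp only [List.nil_append] at h1
    simp only [pWord, List.map_cons, List.map_nil, h1, zero_add]
    change _ • (mk [Letter.id A x] - tInv A.toGradedQuiver (mk [Letter.id A x])) = 0
    rw [h2, sub_self, smul_zero]
  · change Chains.lift _ (respects_pWord A) (mk _) = 0
    rw [Chains.lift_mk]
    have h1 := h0 ((a :: p).map (Plus.fst A.toGradedQuiver).letter)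
      (q.map (Plus.fst A.toGradedQuiver).letter) x
    have h2 := h0 (Letter.id A a.cod :: p.map (Plus.fst A.toGradedQuiver).letter)
      (q.map (Plus.fst A.toGradedQuiver).letter) x
    simp only [List.cons_append, List.map_cons] at h1 h2
    simp only [pWord, List.map_cons, List.map_append, h1, h2, map_zero, smul_zero, add_zero]

/-- The map `p : C^e(A) → C(A)`: it is `a ↦ a` on words in `A`, and
`e_x[a₁|…|aₙ] ↦ (1 - t⁻¹) 1_x[a₁|…|aₙ]` for `n ≥ 1`. -/
noncomputable def pMap : EChains A.toGradedQuiver →ₗ[k] Chains A.toGradedQuiver :=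
  Submodule.liftQ _ (Chains.lift _ (respects_pWord A)) (pWord_D A)

end PMap

/-! ### Negative cyclic complexes -/

section Series

variable {M : Type u} [AddCommGroup M] [Module k M] {M' : Type v} [AddCommGroup M'] [Module k M']
  {M'' : Type u₁} [AddCommGroup M''] [Module k M'']

/-- The `k[[u]]`-linear extension `M[[u]] → M'[[u]]` of a linear map `M → M'`; a power series
`∑ mᵢ uⁱ` is represented by the sequence of its coefficients. -/
def constU (φ : M →ₗ[k] M') : (ℕ → M) →ₗ[k] (ℕ → M') := φ.compLeft ℕ

/-- Multiplication by `u` on `M[[u]]`. -/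
def mulU : (ℕ → M) →ₗ[k] (ℕ → M) where
  toFun f n := match n with
    | 0 => 0
    | n + 1 => f n
  map_add' f g := by
    funext n
    cases n <;> simp
  map_smul' c f := by
    funext n
    cases n <;> simp

/-- The action of `k[[u]]` on `M[[u]]`. -/
noncomputable def smulU (r : PowerSeries k) (f : ℕ → M) : ℕ → M := fun n =>
  ∑ ij ∈ Finset.HasAntidiagonal.antidiagonal n, PowerSeries.coeff ij.1 r • f ij.2

/-- The operator `b + u B` on `M[[u]]`. -/
def negD (b B : M →ₗ[k] M) : (ℕ → M) →ₗ[k] (ℕ → M) := constU b + mulU ∘ₗ constU B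

/-- The elements of `M[[u]]` of degree `g`, where `u` has degree `2`: the series `∑ mᵢ uⁱ` with
`mᵢ` of degree `g - 2 i` for all `i`. -/
def gradeU (gr : G → Submodule k M) (g : G) : Submodule k (ℕ → M) where
  carrier := {f | ∀ n : ℕ, f n ∈ gr (g - 2 * (n : G))}
  add_mem' hf hg n := add_mem (hf n) (hg n)
  zero_mem' n := zero_mem _
  smul_mem' c _ hf n := Submodule.smul_mem _ c (hf n)

/-- The cocycles of degree `g` of the operator `D`. -/
def cocycles (gr : G → Submodule k M) (D : (ℕ → M) →ₗ[k] (ℕ → M)) (g : G) :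
    Submodule k (ℕ → M) :=
  gradeU gr g ⊓ LinearMap.ker D

/-- The coboundaries of degree `g` of the operator `D`. -/
def coboundaries (gr : G → Submodule k M) (D : (ℕ → M) →ₗ[k] (ℕ → M)) (g : G) :
    Submodule k (ℕ → M) :=
  (gradeU gr (g - 1)).map D

/-- The degree `g` cohomology of `M[[u]]` with differential `D`. -/
abbrev Coh (gr : G → Submodule k M) (D : (ℕ → M) →ₗ[k] (ℕ → M)) (g : G) : Type _ :=
  ↥(cocycles gr D g) ⧸ (coboundaries gr D g).comap (cocycles gr D g).subtype

/-- The cohomology class of a cocycle. -/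
def Coh.cls (gr : G → Submodule k M) (D : (ℕ → M) →ₗ[k] (ℕ → M)) {g : G} (z : ℕ → M)
    (hz : z ∈ cocycles gr D g) : Coh gr D g :=
  Submodule.Quotient.mk ⟨z, hz⟩

/-- `φ` is a (degree-preserving, `k[[u]]`-linear) cochain map. -/
structure IsCochainMap (gr : G → Submodule k M) (D : (ℕ → M) →ₗ[k] (ℕ → M))
    (gr' : G → Submodule k M') (D' : (ℕ → M') →ₗ[k] (ℕ → M'))
    (φ : (ℕ → M) →ₗ[k] (ℕ → M')) : Prop where
  map_smulU : ∀ (r : PowerSeries k) (f : ℕ → M), φ (smulU r f) = smulU r (φ f)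
  map_grade : ∀ (g : G) (f : ℕ → M), f ∈ gradeU gr g → φ f ∈ gradeU gr' g
  comm : ∀ f : ℕ → M, φ (D f) = D' (φ f)

theorem IsCochainMap.map_cocycles {gr : G → Submodule k M} {D : (ℕ → M) →ₗ[k] (ℕ → M)}
    {gr' : G → Submodule k M'} {D' : (ℕ → M') →ₗ[k] (ℕ → M')} {φ : (ℕ → M) →ₗ[k] (ℕ → M')}
    (h : IsCochainMap gr D gr' D' φ) (g : G) (f : ℕ → M) (hf : f ∈ cocycles gr D g) :
    φ f ∈ cocycles gr' D' g := by
  refine ⟨h.map_grade g f hf.1, ?_⟩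
  have := LinearMap.mem_ker.1 hf.2
  refine LinearMap.mem_ker.2 ?_
  rw [← h.comm, this, map_zero]

/-- The map induced on cohomology by a cochain map. -/
def Coh.map {gr : G → Submodule k M} {D : (ℕ → M) →ₗ[k] (ℕ → M)}
    {gr' : G → Submodule k M'} {D' : (ℕ → M') →ₗ[k] (ℕ → M')} {φ : (ℕ → M) →ₗ[k] (ℕ → M')}
    (h : IsCochainMap gr D gr' D' φ) (g : G) : Coh gr D g →ₗ[k] Coh gr' D' g :=
  Submodule.mapQ _ _ (φ.restrict (h.map_cocycles g)) (by
    rintro ⟨f, hf⟩ ⟨y, hy, hyf⟩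
    exact ⟨φ y, h.map_grade _ y hy, (h.comm y).symm.trans (congrArg φ hyf)⟩)

end Series

/-- The differential `b + u B` of the negative cyclic complex `C(A)[[u]]`. -/
noncomputable def negCyc (A : DGCat.{u, v} k G) :
    (ℕ → Chains A.toGradedQuiver) →ₗ[k] (ℕ → Chains A.toGradedQuiver) :=
  negD (hochB A) (connesB A)

/-- The differential of the normalized negative cyclic complex. -/
noncomputable def negCycBar (A : DGCat.{u, v} k G) : (ℕ → NChains A) →ₗ[k] (ℕ → NChains A) :=
  negD (hochBbar A) (connesBbar A)

/-- Negative cyclic homology `HN` of `A` in (cohomological) degree `g`. -/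
abbrev HN (A : DGCat.{u, v} k G) (g : G) : Type _ :=
  Coh (Chains.grade A.toGradedQuiver) (negCyc A) g

/-- Normalized negative cyclic homology of `A` in degree `g`. -/
abbrev HNbar (A : DGCat.{u, v} k G) (g : G) : Type _ :=
  Coh (NChains.grade A) (negCycBar A) g

/-- A cochain map between the negative cyclic complexes of `A` and `B`. -/
abbrev IsNegCycMap (A : DGCat.{u, v} k G) (B : DGCat.{u', v'} k G)
    (φ : (ℕ → Chains A.toGradedQuiver) →ₗ[k] (ℕ → Chains B.toGradedQuiver)) : Prop :=
  IsCochainMap (Chains.grade A.toGradedQuiver) (negCyc A)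
    (Chains.grade B.toGradedQuiver) (negCyc B) φ

/-- The quotient map from the negative cyclic complex to the normalized one. -/
noncomputable def quotU (A : DGCat.{u, v} k G) :
    (ℕ → Chains A.toGradedQuiver) →ₗ[k] (ℕ → NChains A) :=
  constU (degenerate A).mkQ

/-- `ι(u) = j + u s^e s N : C(A)[[u]] → C^e(A)[[u]]`. -/
noncomputable def iotaU (A : DGCat.{u, v} k G) :
    (ℕ → Chains A.toGradedQuiver) →ₗ[k] (ℕ → EChains A.toGradedQuiver) :=
  constU (jMap A.toGradedQuiver)
    + mulU ∘ₗ constU (seOp A.toGradedQuiver ∘ₗ sOp A ∘ₗ normOp A.toGradedQuiver)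

/-- The map `F_*(u) = p(u) ∘ F^e_* ∘ ι(u) : C(A)[[u]] → C(B)[[u]]` of a semifunctor `F`. -/
noncomputable def Semifunctor.mapU {A : DGCat.{u, v} k G} {B : DGCat.{u', v'} k G}
    (F : Semifunctor A B) :
    (ℕ → Chains A.toGradedQuiver) →ₗ[k] (ℕ → Chains B.toGradedQuiver) :=
  constU (pMap B) ∘ₗ constU (EChains.map F.toQuiverHom) ∘ₗ iotaU A

/-! ### Direct summands -/

/-- The full dg subcategory of `A` on a family of objects (the index set is the set of objects). -/
def DGCat.full (A : DGCat.{u, v} k G) {I : Type u₁} (o : I → A.Obj) : DGCat.{u₁, v} k G where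
  Obj := I
  Hom x y n := A.Hom (o x) (o y) n
  d := A.d
  comp := A.comp
  one x := A.one (o x)
  d_d := A.d_d
  leibniz := A.leibniz
  assoc := A.assoc
  one_comp := A.one_comp
  comp_one := A.comp_one

/-- `P` is a direct summand of `N` in `A`: closed morphisms `i : P ⟶ N`, `j : N ⟶ P` of degree `0`
with `j ∘ i = 1_P`. -/
structure DirectSummand (A : DGCat.{u, v} k G) (P N : A.Obj) where
  i : A.Hom P N 0
  j : A.Hom N P 0
  d_i : A.d i = 0
  d_j : A.d j = 0
  j_i : A.comp (add_zero 0) j i = A.one P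

/-- The two objects of the category `{P, N}`. -/
inductive PN
  | P
  | N

/-- The objects `P` and `N` of `A` as a family. -/
def pairObj {A : DGCat.{u, v} k G} (P N : A.Obj) : PN → A.Obj
  | .P => P
  | .N => N

/-- The full dg subcategory `{P, N}`. -/
abbrev pairCat (A : DGCat.{u, v} k G) (P N : A.Obj) : DGCat.{0, v} k G :=
  A.full (pairObj P N)

/-- The full dg subcategory `{N}`. -/
abbrev singleCat (A : DGCat.{u, v} k G) (N : A.Obj) : DGCat.{0, v} k G :=
  A.full (fun _ : Unit => N)

/-- The inclusion `{N} → {P, N}`. -/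
def inclusion (A : DGCat.{u, v} k G) (P N : A.Obj) :
    Semifunctor (singleCat A N) (pairCat A P N) where
  obj _ := PN.N
  map := LinearMap.id
  map_d _ := rfl
  map_comp _ _ _ := rfl

namespace DirectSummand

variable {A : DGCat.{u, v} k G} {P N : A.Obj} (S : DirectSummand A P N)

/-- The idempotent `π = i ∘ j`. -/
def idem : A.Hom N N 0 := A.comp (add_zero 0) S.i S.j

/-- The morphism `i : P ⟶ N`, respectively the identity of `N`. -/
def up : (x : PN) → A.Hom (pairObj P N x) N 0
  | .P => S.i
  | .N => A.one N

/-- The morphism `j : N ⟶ P`, respectively the identity of `N`. -/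
def down : (x : PN) → A.Hom N (pairObj P N x) 0
  | .P => S.j
  | .N => A.one N

theorem d_up (x : PN) : A.d (S.up x) = 0 := by
  cases x
  · exact S.d_i
  · exact A.d_one N

theorem d_down (x : PN) : A.d (S.down x) = 0 := by
  cases x
  · exact S.d_j
  · exact A.d_one N

theorem down_up (x : PN) : A.comp (add_zero 0) (S.down x) (S.up x) = A.one (pairObj P N x) := by
  cases x
  · exact S.j_i
  · exact A.one_comp _ _

/-- The map `f ↦ i ∘ f ∘ j` on morphisms of `{P, N}`: it sends `f ∈ End P` to `i ∘ f ∘ j`,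
`f ∈ Hom(N, P)` to `i ∘ f`, `f ∈ Hom(P, N)` to `f ∘ j` and `f ∈ End N` to `f` (compositions with
`1_N` are written out). -/
def conj (x y : PN) (n : G) : A.Hom (pairObj P N x) (pairObj P N y) n →ₗ[k] A.Hom N N n :=
  A.comp (zero_add n) (S.up y) ∘ₗ (A.comp (add_zero n)).flip (S.down x)

theorem conj_apply (x y : PN) (n : G) (f : A.Hom (pairObj P N x) (pairObj P N y) n) :
    S.conj x y n f = A.comp (zero_add n) (S.up y) (A.comp (add_zero n) f (S.down x)) := rfl

theorem conj_d (x y : PN) (n : G) (f : A.Hom (pairObj P N x) (pairObj P N y) n) :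
    S.conj x y (n + 1) (A.d f) = A.d (S.conj x y n f) := by
  rw [conj_apply, conj_apply, A.leibniz (zero_add n) (by ring) (by ring),
    A.leibniz (add_zero n) (by ring) (by ring), d_up, d_down, sgn_zero]
  simp

theorem conj_comp {x y z : PN} {m n p : G} (h : m + n = p)
    (f : A.Hom (pairObj P N y) (pairObj P N z) m) (g : A.Hom (pairObj P N x) (pairObj P N y) n) :
    S.conj x z p (A.comp h f g) = A.comp h (S.conj y z m f) (S.conj x y n g) := by
  subst h
  rw [conj_apply, conj_apply, conj_apply, A.assoc (zero_add m) rfl rfl (zero_add (m + n)),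
    A.assoc (add_zero m) rfl (zero_add n) rfl,
    ← A.assoc (add_zero 0) (zero_add n) (zero_add n) (zero_add n) (S.down y), S.down_up,
    A.one_comp, A.assoc rfl (add_zero (m + n)) (add_zero n) rfl]

/-- The semifunctor `F : {P, N} → {N}`, `f ↦ i ∘ f ∘ j`. -/
def functor : Semifunctor (pairCat A P N) (singleCat A N) where
  obj _ := ()
  map := fun {x y : PN} {n : G} => S.conj x y n
  map_d := fun {x y : PN} {n : G} f => S.conj_d x y n f
  map_comp := fun {x y z : PN} {_ _ _ : G} h f g => S.conj_comp (x := x) (y := y) (z := z) h f g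

end DirectSummand

/-- The integer `(2 i)! / (2 (i !))` (the division is exact for `i ≥ 1`) with sign `(-1) ^ i`. -/
def coef (k : Type*) [Field k] (i : ℕ) : k :=
  (-1) ^ i * ((Nat.factorial (2 * i) / (2 * Nat.factorial i) : ℕ) : k)

/-- The series `γ_x = 1_x + ∑_{i ≥ 1} (-1)^i ((2 i)! / (2 (i !))) 2 · 1_x[1_x|⋯|1_x] u^i`, with
`2 i` letters in the brackets. -/
noncomputable def gammaSeries (A : DGCat.{u, v} k G) (x : A.Obj) : ℕ → Chains A.toGradedQuiver
  | 0 => mk [Letter.id A x]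
  | i + 1 => coef k (i + 1) • (2 : k) •
      mk (Letter.id A x :: List.replicate (2 * (i + 1)) (Letter.id A x))

/-- The series `η_π = π + ∑_{i ≥ 1} (-1)^i ((2 i)! / (2 (i !))) (2 π - 1_x)[π|⋯|π] u^i`, with
`2 i` letters in the brackets. -/
noncomputable def etaSeries (A : DGCat.{u, v} k G) (x : A.Obj) (π : A.Hom x x 0) :
    ℕ → Chains A.toGradedQuiver
  | 0 => mk [Letter.of A.toGradedQuiver π]
  | i + 1 => coef k (i + 1) •
      mk (Letter.of A.toGradedQuiver ((2 : k) • π - A.one x) ::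
        List.replicate (2 * (i + 1)) (Letter.of A.toGradedQuiver π))

/-- The constant series `1_x`. -/
noncomputable def unitSeries (A : DGCat.{u, v} k G) (x : A.Obj) : ℕ → Chains A.toGradedQuiver
  | 0 => mk [Letter.id A x]
  | _ + 1 => 0

end Chains

end NegCyc

open NegCyc

/-!
For a semifunctor `F`, unwinding `p(u) ∘ F^e_* ∘ ι(u)` gives `F_*(u) = F_* + u (1 - t⁻¹) s F_* s N`.
It commutes with `b + uB` because `F_*` commutes with `b`, `b'`, `t`, and because of the classical
identities `b (1 - t⁻¹) = (1 - t⁻¹) b'`, `b' N = N b`, `b' s + s b' = 1` and `N (1 - t⁻¹) = 0`.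
If `F I = 1` for a dg functor `I`, the same identities show that `u (1 - t⁻¹) s s s N` is a homotopy
between `1` and `F_*(u) I_*`.

The series `γ_P` is a cocycle congruent to `1_P` modulo degenerate words, and modulo degenerate
words `F_*(u)` sends it to `η_π`. So `[1_P] = [η_π]` once `inc_* F_*(u)` is known to act as the
identity on `HN_*{P, N}`. The endofunctor `inc F` is a conjugation by closed morphisms, and
inserting these morphisms into words gives a homotopy from `inc_* F_*` to the identity for `b`. For
`b + uB` it is a homotopy from `inc_* F_*(u)` to `1 + uK`, with `K` commuting with `b` and `B`;
inverting `1 + uK` shows that `inc_* F_*(u)` is onto in cohomology, and it is idempotent there.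
-/

namespace NegCyc

universe uk u v w u' v' u₁ v₁

open Finset

variable {k : Type uk} [Field k] {G : Type w} [GradingRing G]

theorem sgn_eq_of_eq_add_two_mul {g h r : G} (e : g = h + 2 * r) : sgn k g = sgn k h := by
  rw [e, sgn_add, two_mul, sgn_add, sgn_mul_self, mul_one]

theorem sgn_sub (g h : G) : sgn k (g - h) = sgn k g * sgn k h := by
  rw [sub_eq_add_neg, sgn_add, sgn_neg]

section Words

variable {Q : GradedQuiver.{u, v} k G} {Q' : GradedQuiver.{u', v'} k G}

@[simp] theorem sdeg_nil : sdeg ([] : List (Letter Q)) = 0 := rfl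

@[simp] theorem sdeg_cons (a : Letter Q) (l : List (Letter Q)) :
    sdeg (a :: l) = (a.deg - 1) + sdeg l := by simp [sdeg]

@[simp] theorem sdeg_append (p q : List (Letter Q)) : sdeg (p ++ q) = sdeg p + sdeg q := by
  simp [sdeg]

theorem IsCyclic.exists_cons {l : List (Letter Q)} (hl : IsCyclic l) : ∃ a q, l = a :: q := by
  cases l with
  | nil => exact absurd hl (by simp [IsCyclic])
  | cons a q => exact ⟨a, q, rfl⟩

theorem mk_nil : mk ([] : List (Letter Q)) = 0 :=
  mk_eq_zero_of_not (by simp [IsCyclic])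

theorem Chains.hom_ext {M : Type*} [AddCommGroup M] [Module k M] {φ ψ : Chains Q →ₗ[k] M}
    (h : ∀ l, IsCyclic l → φ (mk l) = ψ (mk l)) : φ = ψ := by
  refine Submodule.linearMap_qext _ (Finsupp.lhom_ext' fun l => LinearMap.ext_ring ?_)
  change φ (mk l) = ψ (mk l)
  by_cases hl : IsCyclic l
  · exact h l hl
  · rw [mk_eq_zero_of_not hl, map_zero, map_zero]

/-- The chains of tensor length `n`, spanned by the words with `n` letters. The rotation of such
chains has order `n`. -/
noncomputable def Chains.len (Q : GradedQuiver.{u, v} k G) (n : ℕ) : Submodule k (Chains Q) :=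
  Submodule.span k {c | ∃ l : List (Letter Q), l.length = n ∧ c = mk l}

theorem mk_mem_len {l : List (Letter Q)} {n : ℕ} (h : l.length = n) : mk l ∈ Chains.len Q n :=
  Submodule.subset_span ⟨l, h, rfl⟩

theorem Chains.hom_ext_len {M : Type*} [AddCommGroup M] [Module k M] {φ ψ : Chains Q →ₗ[k] M}
    (h : ∀ n, ∀ c ∈ Chains.len Q (n + 1), φ c = ψ c) : φ = ψ :=
  Chains.hom_ext fun _ hl => by
    obtain ⟨a, q, rfl⟩ := hl.exists_cons
    exact h q.length _ (mk_mem_len rfl)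

theorem eqOn_len {M : Type*} [AddCommGroup M] [Module k M] {φ ψ : Chains Q →ₗ[k] M} {n : ℕ}
    (h : ∀ l : List (Letter Q), l.length = n → φ (mk l) = ψ (mk l)) {c : Chains Q}
    (hc : c ∈ Chains.len Q n) : φ c = ψ c :=
  LinearMap.eqOn_span (by rintro _ ⟨l, hl, rfl⟩; exact h l hl) hc

theorem map_mem_len {φ : Chains Q →ₗ[k] Chains Q'} {n m : ℕ}
    (h : ∀ l : List (Letter Q), l.length = n → φ (mk l) ∈ Chains.len Q' m) {c : Chains Q}
    (hc : c ∈ Chains.len Q n) : φ c ∈ Chains.len Q' m :=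
  (Submodule.span_le (p := (Chains.len Q' m).comap φ)).2
    (by rintro _ ⟨l, hl, rfl⟩; exact h l hl) hc

end Words

section Rotation

variable {Q : GradedQuiver.{u, v} k G}

theorem tInv_mk_concat (q : List (Letter Q)) (z : Letter Q) :
    tInv Q (mk (q ++ [z])) = sgn k ((z.deg - 1) * sdeg q) • mk (z :: q) := by
  rw [tInv, Chains.lift_mk, tInvWord_concat]

theorem tInv_pow_mk_append (p q : List (Letter Q)) :
    (tInv Q ^ q.length) (mk (p ++ q)) = sgn k (sdeg p * sdeg q) • mk (q ++ p) := by
  induction q using List.reverseRecOn generalizing p with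
  | nil => simp [sgn_zero]
  | append_singleton q z ih =>
    rw [List.length_append, List.length_singleton, pow_succ, Module.End.mul_apply,
      ← List.append_assoc, tInv_mk_concat, map_smul, ← List.cons_append, ih, smul_smul, ← sgn_add]
    simp only [List.append_assoc, List.cons_append, List.nil_append]
    congr 1
    refine sgn_eq_of_eq_add_two_mul (r := (z.deg - 1) * sdeg q) ?_
    simp only [sdeg_append, sdeg_cons, sdeg_nil]
    ring

theorem tInv_mem_len {n : ℕ} {c : Chains Q} (hc : c ∈ Chains.len Q n) :
    tInv Q c ∈ Chains.len Q n := by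
  refine map_mem_len (fun l hl => ?_) hc
  rcases List.eq_nil_or_concat' l with rfl | ⟨q, z, rfl⟩
  · rw [mk_nil, map_zero]
    exact zero_mem _
  · rw [tInv_mk_concat]
    exact Submodule.smul_mem _ _ (mk_mem_len (by simpa using hl))

theorem tInv_pow_mem_len {n : ℕ} (i : ℕ) {c : Chains Q} (hc : c ∈ Chains.len Q n) :
    (tInv Q ^ i) c ∈ Chains.len Q n := by
  induction i with
  | zero => exact hc
  | succ i ih => rw [pow_succ', Module.End.mul_apply]; exact tInv_mem_len ih

theorem tInv_pow_of_mem_len {n : ℕ} {c : Chains Q} (hc : c ∈ Chains.len Q n) :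
    (tInv Q ^ n) c = c := by
  refine eqOn_len (φ := tInv Q ^ n) (ψ := LinearMap.id) (fun l hl => ?_) hc
  subst hl
  simpa [sgn_zero] using tInv_pow_mk_append [] l

theorem normOp_of_mem_len {n : ℕ} {c : Chains Q} (hc : c ∈ Chains.len Q n) :
    normOp Q c = ∑ i ∈ range n, (tInv Q ^ i) c := by
  rw [← LinearMap.sum_apply]
  refine eqOn_len (fun l hl => ?_) hc
  rw [normOp, Chains.lift_mk, hl, LinearMap.sum_apply]

theorem normOp_mem_len {n : ℕ} {c : Chains Q} (hc : c ∈ Chains.len Q n) :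
    normOp Q c ∈ Chains.len Q n := by
  rw [normOp_of_mem_len hc]
  exact sum_mem fun i _ => tInv_pow_mem_len i hc

theorem sum_tInv_pow_succ {n : ℕ} {c : Chains Q} (hc : c ∈ Chains.len Q n) :
    ∑ i ∈ range n, (tInv Q ^ (i + 1)) c = normOp Q c := by
  rw [normOp_of_mem_len hc]
  refine add_right_cancel (b := (tInv Q ^ 0) c) ?_
  rw [← sum_range_succ' fun i => (tInv Q ^ i) c, sum_range_succ, tInv_pow_of_mem_len hc, pow_zero,
    Module.End.one_apply]

theorem normOp_mul_tInv : normOp Q * tInv Q = normOp Q :=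
  Chains.hom_ext_len fun n c hc => by
    rw [Module.End.mul_apply, normOp_of_mem_len (tInv_mem_len hc), ← sum_tInv_pow_succ hc]
    simp only [pow_succ, Module.End.mul_apply]

theorem tInv_mul_normOp : tInv Q * normOp Q = normOp Q :=
  Chains.hom_ext_len fun n c hc => by
    rw [Module.End.mul_apply, normOp_of_mem_len hc, map_sum, ← normOp_of_mem_len hc,
      ← sum_tInv_pow_succ hc]
    simp only [pow_succ', Module.End.mul_apply]

theorem normOp_mul_tInv_pow (i : ℕ) : normOp Q * tInv Q ^ i = normOp Q := by
  induction i with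
  | zero => rw [pow_zero, mul_one]
  | succ i ih => rw [pow_succ, ← mul_assoc, ih, normOp_mul_tInv]

theorem tInv_pow_mul_normOp (i : ℕ) : tInv Q ^ i * normOp Q = normOp Q := by
  induction i with
  | zero => rw [pow_zero, one_mul]
  | succ i ih => rw [pow_succ, mul_assoc, tInv_mul_normOp, ih]

theorem oneSubT_eq_one_sub : oneSubT Q = 1 - tInv Q := rfl

theorem normOp_mul_oneSubT : normOp Q * oneSubT Q = 0 := by
  rw [oneSubT_eq_one_sub, mul_sub, mul_one, normOp_mul_tInv, sub_self]

theorem oneSubT_mul_normOp : oneSubT Q * normOp Q = 0 := by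
  rw [oneSubT_eq_one_sub, sub_mul, one_mul, tInv_mul_normOp, sub_self]

@[simp] theorem normOp_oneSubT (c : Chains Q) : normOp Q (oneSubT Q c) = 0 :=
  LinearMap.congr_fun normOp_mul_oneSubT c

@[simp] theorem oneSubT_normOp (c : Chains Q) : oneSubT Q (normOp Q c) = 0 :=
  LinearMap.congr_fun oneSubT_mul_normOp c

end Rotation

section HochschildDifferential

variable (A : DGCat.{u, v} k G)

local notation "τ" => tInv (DGCat.toGradedQuiver A)

/-- The differential of the first letter of a word. -/
noncomputable def diffFirstWord : List (Letter A.toGradedQuiver) → Chains A.toGradedQuiver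
  | [] => 0
  | a :: l => mk (a.diff A :: l)

/-- The signed composition of the first two letters of a word. -/
noncomputable def mulFirstWord : List (Letter A.toGradedQuiver) → Chains A.toGradedQuiver
  | a :: b :: l => sgn k a.deg • mk (a.mul A b :: l)
  | _ => 0

theorem respects_diffFirstWord : Respects (diffFirstWord A) where
  lin p q x y n c f g := by
    cases p with
    | nil => exact mk_diff_lin A [] q x y n c f g
    | cons a p => exact (respects_mk _).lin (a.diff A :: p) q x y n c f g
  nc l hl := by
    cases l with
    | nil => rfl
    | cons a l => exact mk_eq_zero_of_not (not_isCyclic_diff A (p := []) hl)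

theorem respects_mulFirstWord : Respects (mulFirstWord A) where
  lin p q x y n c f g := by
    match p, q with
    | [], [] => simp [mulFirstWord]
    | [], b :: q =>
      have h := mk_mul_lin_left A [] q b x y n c f g
      rw [List.nil_append, List.nil_append, List.nil_append] at h
      simp only [List.nil_append, mulFirstWord, h]
      simp only [Letter.of]
      module
    | [a], q =>
      have h := mk_mul_lin_right A [] q a x y n c f g
      rw [List.nil_append, List.nil_append, List.nil_append] at h
      simp only [List.nil_append, List.cons_append, mulFirstWord, h]
      module
    | a :: b :: p, q =>
      have h := (respects_mk _).lin (a.mul A b :: p) q x y n c f g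
      simp only [List.cons_append] at h
      simp only [List.cons_append, mulFirstWord, h]
      module
  nc l hl := by
    match l with
    | [] => rfl
    | [a] => rfl
    | a :: b :: l =>
      exact (congrArg _ (mk_mul_eq_zero A (p := []) hl)).trans (smul_zero _)

/-- The operator `a₀[a₁|⋯] ↦ (d a₀)[a₁|⋯]`, from which all internal terms of `b` arise by
rotation. -/
noncomputable def diffFirst : Module.End k (Chains A.toGradedQuiver) :=
  Chains.lift _ (respects_diffFirstWord A)

/-- The operator `a₀[a₁|a₂|⋯] ↦ (-1) ^ |a₀| (a₀ a₁)[a₂|⋯]`, from which all composition terms of `b`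
arise by rotation. -/
noncomputable def mulFirst : Module.End k (Chains A.toGradedQuiver) :=
  Chains.lift _ (respects_mulFirstWord A)

@[simp] theorem diffFirst_mk_cons (a : Letter A.toGradedQuiver)
    (l : List (Letter A.toGradedQuiver)) : diffFirst A (mk (a :: l)) = mk (a.diff A :: l) :=
  Chains.lift_mk _ _ _

@[simp] theorem mulFirst_mk_cons_cons (a b : Letter A.toGradedQuiver)
    (l : List (Letter A.toGradedQuiver)) :
    mulFirst A (mk (a :: b :: l)) = sgn k a.deg • mk (a.mul A b :: l) :=
  Chains.lift_mk _ _ _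

@[simp] theorem mulFirst_mk_singleton (a : Letter A.toGradedQuiver) : mulFirst A (mk [a]) = 0 :=
  Chains.lift_mk _ _ _

theorem diffFirst_mem_len {n : ℕ} {c : Chains A.toGradedQuiver}
    (hc : c ∈ Chains.len A.toGradedQuiver n) : diffFirst A c ∈ Chains.len A.toGradedQuiver n := by
  refine map_mem_len (fun l hl => ?_) hc
  cases l with
  | nil => rw [mk_nil, map_zero]; exact zero_mem _
  | cons a l => rw [diffFirst_mk_cons]; exact mk_mem_len hl

theorem mulFirst_mem_len {n : ℕ} {c : Chains A.toGradedQuiver}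
    (hc : c ∈ Chains.len A.toGradedQuiver (n + 1)) :
    mulFirst A c ∈ Chains.len A.toGradedQuiver n := by
  refine map_mem_len (fun l hl => ?_) hc
  match l with
  | [] => rw [mk_nil, map_zero]; exact zero_mem _
  | [a] => rw [mulFirst_mk_singleton]; exact zero_mem _
  | a :: b :: l =>
    rw [mulFirst_mk_cons_cons]
    exact Submodule.smul_mem _ _ (mk_mem_len (by simpa using hl))

/-- The differential `b'` of the bar complex, which omits the cyclic face of `b`. -/
noncomputable def barB : Module.End k (Chains A.toGradedQuiver) :=
  Chains.lift (barDiff A []) ⟨barDiff_lin A [], barDiff_nc A []⟩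

@[simp] theorem barB_mk (l : List (Letter A.toGradedQuiver)) : barB A (mk l) = barDiff A [] l :=
  Chains.lift_mk _ _ _

theorem lastFace_eq_mulFirst (l : List (Letter A.toGradedQuiver)) :
    lastFace A l = mulFirst A (tInv A.toGradedQuiver (mk l)) := by
  rcases List.eq_nil_or_concat' l with rfl | ⟨_ | ⟨a, q⟩, z, rfl⟩
  · rw [mk_nil, map_zero, map_zero]; rfl
  · rw [tInv_mk_concat, map_smul, mulFirst_mk_singleton, smul_zero]; rfl
  · rw [tInv_mk_concat, List.cons_append, lastFace_concat, map_smul, mulFirst_mk_cons_cons,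
      smul_smul, mul_comm]

theorem hochB_eq : hochB A = barB A + mulFirst A * τ :=
  Chains.hom_ext fun l _ => by
    rw [hochB, Chains.lift_mk, lastFace_eq_mulFirst, LinearMap.add_apply, barB_mk]; rfl

theorem tInv_pow_diffFirst_tInv_pow (p q : List (Letter A.toGradedQuiver))
    (a : Letter A.toGradedQuiver) :
    (τ ^ p.length * diffFirst A * τ ^ (q.length + 1)) (mk (p ++ a :: q)) =
      sgn k (sdeg p) • mk (p ++ a.diff A :: q) := by
  rw [Module.End.mul_apply, Module.End.mul_apply, ← List.length_cons (a := a),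
    tInv_pow_mk_append, map_smul, map_smul, List.cons_append, diffFirst_mk_cons,
    ← List.cons_append, tInv_pow_mk_append, smul_smul, ← sgn_add]
  congr 1
  refine sgn_eq_of_eq_add_two_mul (r := sdeg p * sdeg (a :: q)) ?_
  simp only [Letter.diff, Letter.of, sdeg_cons]
  ring

theorem Letter.mul_deg (a b : Letter A.toGradedQuiver) : (a.mul A b).deg = a.deg + b.deg := by
  unfold Letter.mul; split_ifs <;> rfl

theorem tInv_pow_mulFirst_tInv_pow (p q : List (Letter A.toGradedQuiver))
    (a b : Letter A.toGradedQuiver) :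
    (τ ^ p.length * mulFirst A * τ ^ (q.length + 1 + 1)) (mk (p ++ a :: b :: q)) =
      (sgn k (sdeg p) * sgn k a.deg) • mk (p ++ a.mul A b :: q) := by
  rw [Module.End.mul_apply, Module.End.mul_apply, ← List.length_cons (a := b),
    ← List.length_cons (a := a), tInv_pow_mk_append, map_smul, map_smul, List.cons_append,
    List.cons_append, mulFirst_mk_cons_cons, map_smul, ← List.cons_append, tInv_pow_mk_append,
    smul_smul, smul_smul, ← sgn_add, ← sgn_add, ← sgn_add]
  congr 1
  refine sgn_eq_of_eq_add_two_mul (r := sdeg p * sdeg (a :: b :: q)) ?_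
  simp only [sdeg_cons, Letter.mul_deg]
  ring

theorem barDiff_add_cyclicFace (p l : List (Letter A.toGradedQuiver))
    (a : Letter A.toGradedQuiver) :
    barDiff A p (a :: l) + mulFirst A (τ (mk (p ++ a :: l))) =
      ∑ ij ∈ antidiagonal l.length, (τ ^ (p.length + ij.1) * (diffFirst A + mulFirst A) *
        τ ^ (ij.2 + 1)) (mk (p ++ a :: l)) := by
  induction l generalizing p a with
  | nil =>
    have cyclic : (τ ^ p.length) (mulFirst A (τ (mk (p ++ [a])))) =
        mulFirst A (τ (mk (p ++ [a]))) :=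
      tInv_pow_of_mem_len (mulFirst_mem_len A (tInv_mem_len (mk_mem_len (by simp))))
    have diff := tInv_pow_diffFirst_tInv_pow A p [] a
    rw [List.length_nil, zero_add, pow_one] at diff
    rw [List.length_nil, Finset.Nat.antidiagonal_zero, sum_singleton, add_zero, zero_add, pow_one,
      mul_add, add_mul, LinearMap.add_apply, diff]
    exact congrArg _ cyclic.symm
  | cons b l ih =>
    have tail := ih (p ++ [a]) b
    have diff := tInv_pow_diffFirst_tInv_pow A p (b :: l) a
    have comp := tInv_pow_mulFirst_tInv_pow A p l a b
    have shift : ∀ i, p.length + 1 + i = p.length + (i + 1) := fun i => by omega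
    simp only [List.append_assoc, List.cons_append, List.nil_append, List.length_append,
      List.length_cons, List.length_nil, zero_add, shift] at tail
    rw [List.length_cons] at diff
    rw [barDiff, add_assoc _ _ (mulFirst A _), tail, List.length_cons, Nat.sum_antidiagonal_succ,
      add_zero, mul_add, add_mul, LinearMap.add_apply, diff, comp]

theorem hochB_of_mem_len {n : ℕ} {c : Chains A.toGradedQuiver}
    (hc : c ∈ Chains.len A.toGradedQuiver (n + 1)) :
    hochB A c = ∑ ij ∈ antidiagonal n,
      (τ ^ ij.1 * (diffFirst A + mulFirst A) * τ ^ (ij.2 + 1)) c := by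
  rw [← LinearMap.sum_apply]
  refine eqOn_len (fun l hl => ?_) hc
  obtain ⟨a, l, rfl⟩ := List.exists_cons_of_length_eq_add_one hl
  obtain rfl : l.length = n := Nat.succ.inj hl
  have h := barDiff_add_cyclicFace A [] l a
  simp only [List.nil_append, List.length_nil, zero_add] at h
  rw [LinearMap.sum_apply, ← h, hochB_eq, LinearMap.add_apply, barB_mk, Module.End.mul_apply]

/-- Both sides compare the sum of `t⁻ⁱ δ t⁻⁽ʲ⁺¹⁾` over `i + j = n + 1`, for
`δ = diffFirst + mulFirst`, with `b`: splitting off the term `i = 0` leaves `t⁻¹ b`,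
splitting off `j = 0` leaves `b t⁻¹`. -/
theorem hochB_mul_tInv : hochB A * τ + τ * mulFirst A * τ =
    τ * hochB A + mulFirst A * τ :=
  Chains.hom_ext_len fun n c hc => by
    set δ := diffFirst A + mulFirst A with hδ
    have hTc := tInv_mem_len hc
    have left : ∑ ij ∈ antidiagonal (n + 1), (τ ^ ij.1 * δ * τ ^ (ij.2 + 1)) c =
        δ (τ c) + τ (hochB A c) := by
      rw [Nat.sum_antidiagonal_succ, hochB_of_mem_len A hc, map_sum]
      congr 1
      · rw [pow_zero, one_mul, Module.End.mul_apply, pow_succ', Module.End.mul_apply,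
          tInv_pow_of_mem_len hc]
      · simp only [pow_succ', Module.End.mul_apply, hδ]
    have right : ∑ ij ∈ antidiagonal (n + 1), (τ ^ ij.1 * δ * τ ^ (ij.2 + 1)) c =
        (τ ^ (n + 1)) (δ (τ c)) + hochB A (τ c) := by
      rw [Nat.sum_antidiagonal_succ', hochB_of_mem_len A hTc, zero_add, pow_one]
      simp only [pow_succ, Module.End.mul_apply, hδ]
    have rotate : (τ ^ (n + 1)) (δ (τ c)) =
        diffFirst A (τ c) + τ (mulFirst A (τ c)) := by
      rw [hδ, LinearMap.add_apply, map_add, tInv_pow_of_mem_len (diffFirst_mem_len A hTc),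
        pow_succ', Module.End.mul_apply, tInv_pow_of_mem_len (mulFirst_mem_len A hTc)]
    have h := left.symm.trans right
    rw [rotate, hδ, LinearMap.add_apply] at h
    simp only [LinearMap.add_apply, Module.End.mul_apply]
    rw [← sub_eq_zero] at h ⊢
    rw [← neg_eq_zero, ← h]
    abel

theorem hochB_mul_oneSubT : hochB A * oneSubT _ = oneSubT _ * barB A := by
  have h := hochB_mul_tInv A
  rw [eq_sub_of_add_eq (hochB_eq A).symm, oneSubT_eq_one_sub]
  linear_combination (norm := noncomm_ring) -h

theorem normOp_mul_hochB : normOp _ * hochB A =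
    normOp _ * (diffFirst A + mulFirst A) * normOp _ :=
  Chains.hom_ext_len fun n c hc => by
    rw [Module.End.mul_apply, hochB_of_mem_len A hc, map_sum]
    simp only [← Module.End.mul_apply, ← mul_assoc, normOp_mul_tInv_pow]
    rw [← Nat.sum_antidiagonal_swap, Nat.sum_antidiagonal_eq_sum_range_succ_mk]
    simp only [Prod.snd_swap, Module.End.mul_apply, ← map_sum]
    rw [sum_tInv_pow_succ hc]

theorem hochB_mul_normOp : hochB A * normOp _ =
    normOp _ * (diffFirst A + mulFirst A) * normOp _ + mulFirst A * normOp _ :=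
  Chains.hom_ext_len fun n c hc => by
    have hNc := normOp_mem_len hc
    rw [Module.End.mul_apply, hochB_of_mem_len A hNc]
    simp only [← Module.End.mul_apply, mul_assoc, tInv_pow_mul_normOp]
    rw [Nat.sum_antidiagonal_eq_sum_range_succ_mk]
    simp only [add_mul, mul_add, LinearMap.add_apply, Module.End.mul_apply, sum_add_distrib]
    rw [← normOp_of_mem_len (diffFirst_mem_len A hNc), sum_range_succ,
      ← normOp_of_mem_len (mulFirst_mem_len A hNc),
      tInv_pow_of_mem_len (mulFirst_mem_len A hNc), add_assoc]

theorem barB_mul_normOp : barB A * normOp _ = normOp _ * hochB A := by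
  rw [eq_sub_of_add_eq (hochB_eq A).symm, sub_mul, mul_assoc, tInv_mul_normOp, hochB_mul_normOp,
    normOp_mul_hochB, add_sub_cancel_right]

theorem hochB_oneSubT (c : Chains A.toGradedQuiver) :
    hochB A (oneSubT _ c) = oneSubT _ (barB A c) :=
  LinearMap.congr_fun (hochB_mul_oneSubT A) c

theorem barB_normOp (c : Chains A.toGradedQuiver) :
    barB A (normOp _ c) = normOp _ (hochB A c) :=
  LinearMap.congr_fun (barB_mul_normOp A) c

end HochschildDifferential

section Contraction

variable (A : DGCat.{u, v} k G)

theorem sOp_mk_of_head {x : A.Obj} {l : List (Letter A.toGradedQuiver)}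
    (h : l.head?.map Letter.cod = some x) : sOp A (mk l) = mk (Letter.id A x :: l) := by
  rw [sOp, Chains.lift_mk]
  cases l with
  | nil => simp at h
  | cons a l =>
    obtain rfl : a.cod = x := by simpa using h
    rfl

theorem sOp_mk_cons (a : Letter A.toGradedQuiver) (l : List (Letter A.toGradedQuiver)) :
    sOp A (mk (a :: l)) = mk (Letter.id A a.cod :: a :: l) :=
  sOp_mk_of_head A rfl

theorem barDiff_id_cons {x : A.Obj} (p l : List (Letter A.toGradedQuiver))
    (h : (p ++ l).head?.map Letter.cod = some x) :
    barDiff A (Letter.id A x :: p) l = -sOp A (barDiff A p l) := by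
  have hs : sgn k (sdeg (Letter.id A x :: p)) = -sgn k (sdeg p) := by
    rw [sdeg_cons, sgn_add, show (Letter.id A x).deg = 0 from rfl, zero_sub, sgn_neg, sgn_one,
      neg_one_mul]
  induction l generalizing p with
  | nil => simp [barDiff]
  | cons a l ih =>
    have e1 : sOp A (mk (p ++ a.diff A :: l)) = mk (Letter.id A x :: (p ++ a.diff A :: l)) :=
      sOp_mk_of_head A (by cases p <;> exact h)
    cases l with
    | nil => simp only [barDiff, hs, List.cons_append, map_smul, e1, neg_smul]
    | cons b l =>
      have e2 : sOp A (mk (p ++ a.mul A b :: l)) = mk (Letter.id A x :: (p ++ a.mul A b :: l)) :=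
        sOp_mk_of_head A (by
          cases p with
          | nil => simpa using h
          | cons => exact h)
      have e3 := ih (p ++ [a]) (by simpa using h) (by
        simp only [sdeg_append, sdeg_cons, sgn_add] at hs ⊢
        rw [← mul_assoc, hs, neg_mul])
      simp only [barDiff, hs, List.cons_append, map_smul, map_add, e1, e2, e3]
      module

theorem barB_mul_sOp : barB A * sOp A = 1 - sOp A * barB A := by
  refine Chains.hom_ext fun l hl => ?_
  obtain ⟨a, l, rfl⟩ := hl.exists_cons
  change barB A (sOp A (mk (a :: l))) = mk (a :: l) - sOp A (barB A (mk (a :: l)))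
  have diff_id := mk_diff_id A [] (a :: l) a.cod
  have tail := barDiff_id_cons A (x := a.cod) [] (a :: l) rfl
  rw [List.nil_append] at diff_id
  simp only [sOp_mk_cons, barB_mk, barDiff, List.nil_append, diff_id, tail, letter_id_mul, sdeg_nil,
    show (Letter.id A a.cod).deg = 0 from rfl, sgn_zero, one_mul, one_smul, zero_add, smul_zero]
  abel

theorem barB_sOp (c : Chains A.toGradedQuiver) : barB A (sOp A c) = c - sOp A (barB A c) :=
  LinearMap.congr_fun (barB_mul_sOp A) c

theorem hochB_connesB (c : Chains A.toGradedQuiver) :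
    hochB A (connesB A c) = -connesB A (hochB A c) := by
  simp only [connesB, LinearMap.comp_apply, hochB_oneSubT, barB_sOp, barB_normOp, map_sub,
    oneSubT_normOp, zero_sub]

theorem connesB_connesB (c : Chains A.toGradedQuiver) : connesB A (connesB A c) = 0 := by
  simp only [connesB, LinearMap.comp_apply, normOp_oneSubT, map_zero]

end Contraction

section Degrees

variable {M M' M'' : Type*} [AddCommGroup M] [Module k M] [AddCommGroup M'] [Module k M']
  [AddCommGroup M''] [Module k M''] {gr : G → Submodule k M} {gr' : G → Submodule k M'}
  {gr'' : G → Submodule k M''}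

/-- The linear map `φ` between graded modules is homogeneous of degree `e`. The grading is a mere
family of submodules, no direct sum decomposition is assumed. -/
def HasDeg (gr : G → Submodule k M) (gr' : G → Submodule k M') (φ : M →ₗ[k] M') (e : G) : Prop :=
  ∀ g, ∀ c ∈ gr g, φ c ∈ gr' (g + e)

theorem HasDeg.comp {ψ : M' →ₗ[k] M''} {φ : M →ₗ[k] M'} {d e f : G} (hψ : HasDeg gr' gr'' ψ d)
    (hφ : HasDeg gr gr' φ e) (h : e + d = f) : HasDeg gr gr'' (ψ ∘ₗ φ) f := fun g c hc => by
  rw [← h, ← add_assoc]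
  exact hψ _ _ (hφ g c hc)

theorem HasDeg.add {φ ψ : M →ₗ[k] M'} {e : G} (hφ : HasDeg gr gr' φ e)
    (hψ : HasDeg gr gr' ψ e) : HasDeg gr gr' (φ + ψ) e :=
  fun g c hc => add_mem (hφ g c hc) (hψ g c hc)

theorem HasDeg.sub {φ ψ : M →ₗ[k] M'} {e : G} (hφ : HasDeg gr gr' φ e)
    (hψ : HasDeg gr gr' ψ e) : HasDeg gr gr' (φ - ψ) e :=
  fun g c hc => sub_mem (hφ g c hc) (hψ g c hc)

theorem hasDeg_id (gr : G → Submodule k M) : HasDeg gr gr LinearMap.id 0 :=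
  fun g c hc => by rwa [add_zero]

end Degrees

section Series

variable {M M' : Type*} [AddCommGroup M] [Module k M] [AddCommGroup M'] [Module k M']

@[simp] theorem constU_apply (φ : M →ₗ[k] M') (f : ℕ → M) (n : ℕ) : constU φ f n = φ (f n) := rfl

@[simp] theorem mulU_zero (f : ℕ → M) : mulU (k := k) f 0 = 0 := rfl

@[simp] theorem mulU_succ (f : ℕ → M) (n : ℕ) : mulU (k := k) f (n + 1) = f n := rfl

@[simp] theorem negD_zero (b B : M →ₗ[k] M) (f : ℕ → M) : negD b B f 0 = b (f 0) :=
  add_zero _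

@[simp] theorem negD_succ (b B : M →ₗ[k] M) (f : ℕ → M) (n : ℕ) :
    negD b B f (n + 1) = b (f (n + 1)) + B (f n) := rfl

theorem constU_smulU (φ : M →ₗ[k] M') (r : PowerSeries k) (f : ℕ → M) :
    constU φ (smulU r f) = smulU r (constU φ f) := by
  funext n
  simp [smulU]

theorem mulU_smulU (r : PowerSeries k) (f : ℕ → M) :
    mulU (k := k) (smulU r f) = smulU r (mulU (k := k) f) := by
  funext n
  cases n with
  | zero => simp [smulU]
  | succ n => simp [smulU, Finset.Nat.sum_antidiagonal_succ']

theorem smulU_add (r : PowerSeries k) (f g : ℕ → M) :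
    smulU r (f + g) = smulU r f + smulU r g := by
  funext n
  simp [smulU, sum_add_distrib]

section Grading

variable {gr : G → Submodule k M} {gr' : G → Submodule k M'} {φ : M →ₗ[k] M'} {f : ℕ → M}

theorem HasDeg.constU_mem_gradeU {e g : G} (hφ : HasDeg gr gr' φ e) (hf : f ∈ gradeU gr g) :
    constU φ f ∈ gradeU gr' (g + e) := fun n => by
  rw [add_sub_right_comm]
  exact hφ _ _ (hf n)

theorem HasDeg.mulU_constU_mem_gradeU {g : G} (hφ : HasDeg gr gr' φ (-2))
    (hf : f ∈ gradeU gr g) : mulU (k := k) (constU φ f) ∈ gradeU gr' g := fun n => by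
  cases n with
  | zero => exact zero_mem _
  | succ n =>
    rw [show g - 2 * ((n + 1 : ℕ) : G) = g - 2 * (n : G) + -2 by push_cast; ring]
    exact hφ _ _ (hf n)

end Grading

theorem isCochainMap_constU_add_mulU {gr : G → Submodule k M} {gr' : G → Submodule k M'}
    {b B : M →ₗ[k] M} {b' B' : M' →ₗ[k] M'} {φ ψ : M →ₗ[k] M'}
    (hφ : HasDeg gr gr' φ 0) (hψ : HasDeg gr gr' ψ (-2)) (hb : ∀ c, φ (b c) = b' (φ c))
    (hbB : ∀ c, φ (B c) + ψ (b c) = b' (ψ c) + B' (φ c)) (hB : ∀ c, ψ (B c) = B' (ψ c)) :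
    IsCochainMap gr (negD b B) gr' (negD b' B') (constU φ + mulU ∘ₗ constU ψ) where
  map_smulU r f := by
    simp only [LinearMap.add_apply, LinearMap.comp_apply, constU_smulU, mulU_smulU, smulU_add]
  map_grade g f hf := add_mem (by simpa using hφ.constU_mem_gradeU hf)
    (hψ.mulU_constU_mem_gradeU hf)
  comm f := by
    funext n
    simp only [LinearMap.add_apply, LinearMap.comp_apply, Pi.add_apply]
    match n with
    | 0 => simp [hb]
    | 1 => simp [hb, add_assoc, hbB]
    | n + 2 =>
      simp only [constU_apply, mulU_succ, negD_succ, Pi.add_apply, map_add, hb, hB]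
      linear_combination (norm := module) hbB (f (n + 1))

theorem isCochainMap_constU {gr : G → Submodule k M} {gr' : G → Submodule k M'}
    {b B : M →ₗ[k] M} {b' B' : M' →ₗ[k] M'} {φ : M →ₗ[k] M'} (hφ : HasDeg gr gr' φ 0)
    (hb : ∀ c, φ (b c) = b' (φ c)) (hB : ∀ c, φ (B c) = B' (φ c)) :
    IsCochainMap gr (negD b B) gr' (negD b' B') (constU φ) where
  map_smulU := constU_smulU φ
  map_grade g f hf := by simpa using hφ.constU_mem_gradeU hf
  comm f := by
    funext n
    cases n <;> simp [hb, hB]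

theorem Coh.map_comp_map_eq_id {gr : G → Submodule k M} {gr' : G → Submodule k M'}
    {D : (ℕ → M) →ₗ[k] (ℕ → M)} {D' : (ℕ → M') →ₗ[k] (ℕ → M')} {Φ : (ℕ → M) →ₗ[k] (ℕ → M')}
    {Ψ : (ℕ → M') →ₗ[k] (ℕ → M)} (hΦ : IsCochainMap gr D gr' D' Φ)
    (hΨ : IsCochainMap gr' D' gr D Ψ) {T : (ℕ → M) → (ℕ → M)} {g : G}
    (hT : ∀ f ∈ gradeU gr g, T f ∈ gradeU gr (g - 1))
    (h : ∀ f ∈ cocycles gr D g, Ψ (Φ f) - f = D (T f)) :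
    Coh.map hΨ g ∘ₗ Coh.map hΦ g = LinearMap.id := by
  refine LinearMap.ext fun x => ?_
  obtain ⟨f, rfl⟩ := Submodule.Quotient.mk_surjective _ x
  exact (Submodule.Quotient.eq _).2 ⟨T f, hT f f.2.1, (h f f.2).symm⟩

section Retraction

variable {gr : G → Submodule k M} {f : ℕ → M}

/-- The series `(1 + u K)⁻¹ f`. -/
def invOneAddU (K : M →ₗ[k] M) (f : ℕ → M) : ℕ → M
  | 0 => f 0
  | n + 1 => f (n + 1) - K (invOneAddU K f n)

theorem invOneAddU_add_mulU (K : M →ₗ[k] M) (f : ℕ → M) :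
    invOneAddU K f + mulU (k := k) (constU K (invOneAddU K f)) = f := by
  funext n
  cases n with
  | zero => exact add_zero _
  | succ n => exact sub_add_cancel _ _

theorem eq_zero_of_add_mulU_eq_zero {K : M →ₗ[k] M}
    (h : f + mulU (k := k) (constU K f) = 0) : f = 0 := by
  funext n
  induction n with
  | zero => simpa using congrFun h 0
  | succ n ih => simpa [ih] using congrFun h (n + 1)

theorem invOneAddU_mem_gradeU {K : M →ₗ[k] M} (hK : HasDeg gr gr K (-2)) {g : G}
    (hf : f ∈ gradeU gr g) : invOneAddU K f ∈ gradeU gr g := fun n => by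
  induction n with
  | zero => exact hf 0
  | succ n ih =>
    refine sub_mem (hf _) ?_
    rw [show g - 2 * ((n + 1 : ℕ) : G) = g - 2 * (n : G) + -2 by push_cast; ring]
    exact hK _ _ ih

theorem invOneAddU_mem_cocycles {K b B : M →ₗ[k] M} (hK : HasDeg gr gr K (-2))
    (hb : ∀ c, b (K c) = K (b c)) (hB : ∀ c, B (K c) = K (B c)) {g : G}
    (hf : f ∈ cocycles gr (negD b B) g) : invOneAddU K f ∈ cocycles gr (negD b B) g := by
  refine ⟨invOneAddU_mem_gradeU hK hf.1,
    LinearMap.mem_ker.2 (eq_zero_of_add_mulU_eq_zero (K := K) ?_)⟩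
  have commute : mulU (k := k) (constU K (negD b B (invOneAddU K f))) =
      negD b B (mulU (k := k) (constU K (invOneAddU K f))) := by
    funext n
    match n with
    | 0 => simp
    | 1 => simp [hb]
    | n + 2 => simp [hb, hB]
  rw [commute, ← map_add, invOneAddU_add_mulU, LinearMap.mem_ker.1 hf.2]

theorem negD_constU_add_constU_negD {b B φ H : M →ₗ[k] M} (ψ : M →ₗ[k] M)
    (homotopy : ∀ c, b (H c) + H (b c) = c - φ c) (f : ℕ → M) :
    negD b B (constU H f) + constU H (negD b B f) =
      f + mulU (k := k) (constU (ψ + (B ∘ₗ H + H ∘ₗ B)) f) -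
        (constU φ + mulU ∘ₗ constU ψ) f := by
  funext n
  cases n with
  | zero => simpa using homotopy _
  | succ n =>
    simp only [Pi.add_apply, Pi.sub_apply, LinearMap.add_apply, LinearMap.comp_apply, negD_succ,
      constU_apply, mulU_succ, map_add]
    linear_combination (norm := module) homotopy (f (n + 1))

/-- With `Φ = φ + u ψ` and `K = ψ + B H + H B`, the homotopy `H` satisfies
`D H + H D = 1 - Φ + u K` for `D = b + u B`. As `K` commutes with `D`, the cocycle `(1 + u K)⁻¹ f`
does what is claimed. -/
theorem exists_sub_eq_negD_constU {b B φ ψ H : M →ₗ[k] M}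
    (hψ : HasDeg gr gr ψ (-2)) (hBdeg : HasDeg gr gr B (-1)) (hH : HasDeg gr gr H (-1))
    (hbB : ∀ c, b (B c) = -B (b c)) (hBB : ∀ c, B (B c) = 0)
    (hφψ : ∀ c, φ (B c) + ψ (b c) = b (ψ c) + B (φ c)) (hψB : ∀ c, ψ (B c) = B (ψ c))
    (homotopy : ∀ c, b (H c) + H (b c) = c - φ c) {e : G} (hf : f ∈ cocycles gr (negD b B) e) :
    ∃ g ∈ cocycles gr (negD b B) e,
      f - (constU φ + mulU ∘ₗ constU ψ) g = negD b B (constU H g) := by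
  set K := ψ + (B ∘ₗ H + H ∘ₗ B) with hK
  have two : (-1 : G) + -1 = -2 := by norm_num
  have hKdeg : HasDeg gr gr K (-2) := hψ.add ((hBdeg.comp hH two).add (hH.comp hBdeg two))
  have hKB (c : M) : B (K c) = K (B c) := by simp [hK, hψB, hBB]
  have hKb (c : M) : b (K c) = K (b c) := by
    have h1 := hφψ c
    have h2 := homotopy (B c)
    have h3 := congrArg B (homotopy c)
    have h4 := congrArg H (hbB c)
    simp only [map_add, map_sub, map_neg] at h1 h2 h3 h4
    simp only [hK, LinearMap.add_apply, LinearMap.comp_apply, map_add, hbB]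
    linear_combination (norm := module) -h1 + h2 - h3 - h4
  have hg := invOneAddU_mem_cocycles hKdeg hKb hKB hf
  refine ⟨invOneAddU K f, hg, ?_⟩
  have homotopyU := negD_constU_add_constU_negD (B := B) ψ homotopy (invOneAddU K f)
  rw [← hK, invOneAddU_add_mulU, LinearMap.mem_ker.1 hg.2, map_zero, add_zero] at homotopyU
  exact homotopyU.symm

end Retraction

end Series

section ChainMaps

variable {Q : GradedQuiver.{u, v} k G} {Q' : GradedQuiver.{u', v'} k G} (F : QuiverHom Q Q')

theorem isCyclic_map {l : List (Letter Q)} (hl : IsCyclic l) : IsCyclic (l.map F.letter) := by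
  obtain ⟨a, l, rfl⟩ := hl.exists_cons
  change List.IsChain _ (F.letter a :: (l.map F.letter ++ [F.letter a]))
  rw [← List.map_singleton, ← List.map_append, ← List.map_cons, List.isChain_map]
  exact List.IsChain.imp (fun s t h => congrArg F.obj h) hl

theorem sdeg_map (l : List (Letter Q)) : sdeg (l.map F.letter) = sdeg l := by
  rw [sdeg, List.map_map]
  rfl

theorem map_map_of_letter {Q'' : GradedQuiver.{u₁, v₁} k G} {F : QuiverHom Q Q'}
    {E : QuiverHom Q' Q''} {I : QuiverHom Q Q''}
    (h : ∀ a, E.letter (F.letter a) = I.letter a) (c : Chains Q) :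
    Chains.map E (Chains.map F c) = Chains.map I c := by
  suffices Chains.map E ∘ₗ Chains.map F = Chains.map I from LinearMap.congr_fun this c
  refine Chains.hom_ext fun l hl => ?_
  rw [LinearMap.comp_apply, Chains.map_mk _ _ hl, Chains.map_mk _ _ (isCyclic_map F hl),
    Chains.map_mk _ _ hl, List.map_map]
  exact congrArg mk (List.map_congr_left fun a _ => h a)

theorem map_tInv (c : Chains Q) : Chains.map F (tInv Q c) = tInv Q' (Chains.map F c) := by
  suffices Chains.map F ∘ₗ tInv Q = tInv Q' ∘ₗ Chains.map F from LinearMap.congr_fun this c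
  refine Chains.hom_ext fun l hl => ?_
  rw [LinearMap.comp_apply, LinearMap.comp_apply, Chains.map_mk F l hl]
  rcases List.eq_nil_or_concat' l with rfl | ⟨q, z, rfl⟩
  · rw [mk_nil, List.map_nil, mk_nil, map_zero, map_zero, map_zero]
  · rw [tInv_mk_concat, map_smul, Chains.map_mk F (z :: q) ((isCyclic_swap _ _).1 hl),
      List.map_append, List.map_singleton, tInv_mk_concat, sdeg_map]
    rfl

theorem map_tInv_pow (i : ℕ) (c : Chains Q) :
    Chains.map F ((tInv Q ^ i) c) = (tInv Q' ^ i) (Chains.map F c) := by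
  induction i with
  | zero => rfl
  | succ i ih => rw [pow_succ', pow_succ', Module.End.mul_apply, Module.End.mul_apply, map_tInv, ih]

theorem map_oneSubT (c : Chains Q) :
    Chains.map F (oneSubT Q c) = oneSubT Q' (Chains.map F c) := by
  simp only [oneSubT_eq_one_sub, LinearMap.sub_apply, Module.End.one_apply, map_sub, map_tInv]

theorem chainsMap_mem_len {n : ℕ} {c : Chains Q} (hc : c ∈ Chains.len Q n) :
    Chains.map F c ∈ Chains.len Q' n := by
  refine map_mem_len (fun l hl => ?_) hc
  by_cases h : IsCyclic l
  · rw [Chains.map_mk F l h]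
    exact mk_mem_len (by rw [List.length_map, hl])
  · rw [mk_eq_zero_of_not h, map_zero]
    exact zero_mem _

theorem map_normOp (c : Chains Q) : Chains.map F (normOp Q c) = normOp Q' (Chains.map F c) := by
  suffices Chains.map F ∘ₗ normOp Q = normOp Q' ∘ₗ Chains.map F from LinearMap.congr_fun this c
  refine Chains.hom_ext_len fun n c hc => ?_
  rw [LinearMap.comp_apply, LinearMap.comp_apply, normOp_of_mem_len hc,
    normOp_of_mem_len (chainsMap_mem_len F hc), map_sum]
  simp only [map_tInv_pow]

end ChainMaps

section ChainDegrees

variable {Q : GradedQuiver.{u, v} k G} {Q' : GradedQuiver.{u', v'} k G}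

theorem mk_mem_grade {g : G} {l : List (Letter Q)} (h : sdeg l + 1 = g) :
    mk l ∈ Chains.grade Q g :=
  Submodule.subset_span ⟨l, h, rfl⟩

theorem HasDeg.of_words {M : Type*} [AddCommGroup M] [Module k M] {gr : G → Submodule k M}
    {φ : Chains Q →ₗ[k] M} {e : G}
    (h : ∀ l : List (Letter Q), IsCyclic l → φ (mk l) ∈ gr (sdeg l + 1 + e)) :
    HasDeg (Chains.grade Q) gr φ e := fun g c hc => by
  refine (Submodule.span_le (p := (gr (g + e)).comap φ)).2 ?_ hc
  rintro _ ⟨l, rfl, rfl⟩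
  by_cases hl : IsCyclic l
  · exact h l hl
  · rw [mk_eq_zero_of_not hl]
    exact zero_mem _

theorem hasDeg_tInv : HasDeg (Chains.grade Q) (Chains.grade Q) (tInv Q) 0 :=
  HasDeg.of_words fun l _ => by
    rcases List.eq_nil_or_concat' l with rfl | ⟨q, z, rfl⟩
    · rw [mk_nil, map_zero]
      exact zero_mem _
    · rw [tInv_mk_concat]
      refine Submodule.smul_mem _ _ (mk_mem_grade ?_)
      simp only [sdeg_cons, sdeg_append, sdeg_nil]
      ring

theorem hasDeg_oneSubT : HasDeg (Chains.grade Q) (Chains.grade Q) (oneSubT Q) 0 :=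
  (hasDeg_id _).sub hasDeg_tInv

theorem hasDeg_tInv_pow (i : ℕ) : HasDeg (Chains.grade Q) (Chains.grade Q) (tInv Q ^ i) 0 := by
  induction i with
  | zero => exact hasDeg_id _
  | succ i ih => exact ih.comp hasDeg_tInv (add_zero 0)

theorem hasDeg_normOp : HasDeg (Chains.grade Q) (Chains.grade Q) (normOp Q) 0 :=
  HasDeg.of_words fun l _ => by
    rw [normOp_of_mem_len (mk_mem_len rfl)]
    exact sum_mem fun i _ => hasDeg_tInv_pow i _ _ (mk_mem_grade rfl)

theorem hasDeg_map (F : QuiverHom Q Q') :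
    HasDeg (Chains.grade Q) (Chains.grade Q') (Chains.map F) 0 :=
  HasDeg.of_words fun l hl => by
    rw [Chains.map_mk F l hl]
    exact mk_mem_grade (by rw [sdeg_map, add_zero])

theorem hasDeg_sOp (A : DGCat.{u, v} k G) :
    HasDeg (Chains.grade A.toGradedQuiver) (Chains.grade A.toGradedQuiver) (sOp A) (-1) :=
  HasDeg.of_words fun l hl => by
    obtain ⟨a, l, rfl⟩ := hl.exists_cons
    rw [sOp_mk_cons]
    refine mk_mem_grade ?_
    simp only [sdeg_cons, show (Letter.id A a.cod).deg = 0 from rfl]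
    ring

theorem hasDeg_connesB (A : DGCat.{u, v} k G) :
    HasDeg (Chains.grade A.toGradedQuiver) (Chains.grade A.toGradedQuiver) (connesB A) (-1) :=
  hasDeg_oneSubT.comp ((hasDeg_sOp A).comp hasDeg_normOp (zero_add _)) (add_zero _)

end ChainDegrees

section Semifunctors

variable {A : DGCat.{u, v} k G} {B : DGCat.{u', v'} k G} (F : Semifunctor A B)

theorem letter_of_comp {x y z : A.Obj} {m n p : G} (h : m + n = p) (f : A.Hom y z m)
    (g : A.Hom x y n) : Letter.of A.toGradedQuiver (A.comp h f g) =
      (Letter.of A.toGradedQuiver f).mul A (Letter.of A.toGradedQuiver g) := by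
  subst h
  exact (mul_of A f g).symm

theorem letter_diff (a : Letter A.toGradedQuiver) :
    F.letter (a.diff A) = (F.letter a).diff B :=
  congrArg (Letter.of B.toGradedQuiver) (F.map_d a.hom)

theorem letter_mul {a b : Letter A.toGradedQuiver} (h : a.dom = b.cod) :
    F.letter (a.mul A b) = (F.letter a).mul B (F.letter b) := by
  obtain ⟨z, y, m, f⟩ := a
  obtain ⟨y, x, n, g⟩ := b
  obtain rfl := h
  refine (congrArg F.letter (letter_of_comp (A := A) rfl f g).symm).trans ?_
  refine Eq.trans ?_ (letter_of_comp (A := B) rfl (F.map f) (F.map g))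
  exact congrArg (Letter.of B.toGradedQuiver) (F.map_comp rfl f g)

theorem map_diffFirst (c : Chains A.toGradedQuiver) :
    Chains.map F.toQuiverHom (diffFirst A c) = diffFirst B (Chains.map F.toQuiverHom c) := by
  suffices Chains.map F.toQuiverHom ∘ₗ diffFirst A = diffFirst B ∘ₗ Chains.map F.toQuiverHom from
    LinearMap.congr_fun this c
  refine Chains.hom_ext fun l hl => ?_
  obtain ⟨a, l, rfl⟩ := hl.exists_cons
  have hdiff : IsCyclic (a.diff A :: l) :=
    (isCyclic_congr' (a.diff A :: l) (a :: l) (by simp [Letter.diff, Letter.of])).2 hl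
  rw [LinearMap.comp_apply, LinearMap.comp_apply, Chains.map_mk _ _ hl, diffFirst_mk_cons,
    Chains.map_mk _ _ hdiff, List.map_cons, List.map_cons, diffFirst_mk_cons, letter_diff]

theorem map_mulFirst (c : Chains A.toGradedQuiver) :
    Chains.map F.toQuiverHom (mulFirst A c) = mulFirst B (Chains.map F.toQuiverHom c) := by
  suffices Chains.map F.toQuiverHom ∘ₗ mulFirst A = mulFirst B ∘ₗ Chains.map F.toQuiverHom from
    LinearMap.congr_fun this c
  refine Chains.hom_ext fun l hl => ?_
  rw [LinearMap.comp_apply, LinearMap.comp_apply, Chains.map_mk _ _ hl]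
  match l with
  | [] => rw [mk_nil, List.map_nil, mk_nil, map_zero, map_zero, map_zero]
  | [a] => rw [mulFirst_mk_singleton, map_zero, List.map_singleton, mulFirst_mk_singleton]
  | a :: b :: l =>
    have hab : a.dom = b.cod := isCyclic_adj (p := []) hl
    have hmul : IsCyclic (a.mul A b :: l) :=
      (isCyclic_merge [] l a b _ hab (mul_cod A a b) (mul_dom A a b)).1 hl
    rw [mulFirst_mk_cons_cons, map_smul, Chains.map_mk _ _ hmul, List.map_cons, List.map_cons,
      List.map_cons, mulFirst_mk_cons_cons, letter_mul F hab]
    rfl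

theorem map_hochB (c : Chains A.toGradedQuiver) :
    Chains.map F.toQuiverHom (hochB A c) = hochB B (Chains.map F.toQuiverHom c) := by
  suffices Chains.map F.toQuiverHom ∘ₗ hochB A = hochB B ∘ₗ Chains.map F.toQuiverHom from
    LinearMap.congr_fun this c
  refine Chains.hom_ext_len fun n c hc => ?_
  rw [LinearMap.comp_apply, LinearMap.comp_apply, hochB_of_mem_len A hc,
    hochB_of_mem_len B (chainsMap_mem_len _ hc), map_sum]
  simp only [Module.End.mul_apply, LinearMap.add_apply, map_tInv_pow, map_add, map_diffFirst,
    map_mulFirst]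

theorem map_barB (c : Chains A.toGradedQuiver) :
    Chains.map F.toQuiverHom (barB A c) = barB B (Chains.map F.toQuiverHom c) := by
  rw [eq_sub_of_add_eq (hochB_eq A).symm, eq_sub_of_add_eq (hochB_eq B).symm]
  simp only [LinearMap.sub_apply, Module.End.mul_apply, map_sub, map_hochB, map_mulFirst, map_tInv]

/-- The operator `(1 - t⁻¹) s F_* s N`, the coefficient of `u` in `F_*(u)`. -/
noncomputable def Semifunctor.mapB : Chains A.toGradedQuiver →ₗ[k] Chains B.toGradedQuiver :=
  oneSubT B.toGradedQuiver ∘ₗ sOp B ∘ₗ Chains.map F.toQuiverHom ∘ₗ sOp A ∘ₗ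
    normOp A.toGradedQuiver

theorem hasDeg_mapB :
    HasDeg (Chains.grade A.toGradedQuiver) (Chains.grade B.toGradedQuiver) F.mapB (-2) :=
  have two : (-1 : G) + -1 = -2 := by norm_num
  hasDeg_oneSubT.comp ((hasDeg_sOp B).comp ((hasDeg_map _).comp
    ((hasDeg_sOp A).comp hasDeg_normOp (zero_add _)) (add_zero _)) two) (add_zero _)

theorem map_connesB_add_mapB_hochB (c : Chains A.toGradedQuiver) :
    Chains.map F.toQuiverHom (connesB A c) + F.mapB (hochB A c) =
      hochB B (F.mapB c) + connesB B (Chains.map F.toQuiverHom c) := by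
  simp only [Semifunctor.mapB, connesB, LinearMap.comp_apply, hochB_oneSubT, barB_sOp, ← map_barB,
    barB_normOp, map_sub, map_oneSubT, map_normOp]
  abel

theorem mapB_connesB (c : Chains A.toGradedQuiver) : F.mapB (connesB A c) = 0 := by
  simp only [Semifunctor.mapB, connesB, LinearMap.comp_apply, normOp_oneSubT, map_zero]

theorem connesB_mapB (c : Chains A.toGradedQuiver) : connesB B (F.mapB c) = 0 := by
  simp only [Semifunctor.mapB, connesB, LinearMap.comp_apply, normOp_oneSubT, map_zero]

theorem plusMap_letter_comp_inl_letter :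
    (Plus.map F.toQuiverHom).letter ∘ (Plus.inl A.toGradedQuiver).letter =
      (Plus.inl B.toGradedQuiver).letter ∘ F.letter := rfl

theorem pMap_map_mkQ (c : Chains (Plus A.toGradedQuiver)) :
    pMap B (EChains.map F.toQuiverHom ((Plus.D A.toGradedQuiver).mkQ c)) =
      Chains.lift _ (respects_pWord B) (Chains.map (Plus.map F.toQuiverHom) c) := rfl

theorem pMap_map_jMap (c : Chains A.toGradedQuiver) :
    pMap B (EChains.map F.toQuiverHom (jMap A.toGradedQuiver c)) =
      Chains.map F.toQuiverHom c := by
  suffices pMap B ∘ₗ EChains.map F.toQuiverHom ∘ₗ jMap A.toGradedQuiver =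
      Chains.map F.toQuiverHom from LinearMap.congr_fun this c
  refine Chains.hom_ext fun l hl => ?_
  rw [LinearMap.comp_apply, LinearMap.comp_apply, jMap, LinearMap.comp_apply, pMap_map_mkQ,
    Chains.map_mk _ _ hl, Chains.map_mk _ _ (isCyclic_map _ hl), Chains.map_mk _ _ hl,
    Chains.lift_mk, List.map_map, plusMap_letter_comp_inl_letter]
  obtain ⟨a, l, rfl⟩ := hl.exists_cons
  rw [List.map_cons, pWord, ← List.map_cons (f := _ ∘ F.letter), List.map_map]
  change _ + (0 : k) • _ = _
  rw [zero_smul, add_zero]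
  rfl

theorem pMap_map_seOp (c : Chains A.toGradedQuiver) :
    pMap B (EChains.map F.toQuiverHom (seOp A.toGradedQuiver c)) =
      oneSubT B.toGradedQuiver (sOp B (Chains.map F.toQuiverHom c)) := by
  suffices pMap B ∘ₗ EChains.map F.toQuiverHom ∘ₗ seOp A.toGradedQuiver =
      oneSubT B.toGradedQuiver ∘ₗ sOp B ∘ₗ Chains.map F.toQuiverHom from
    LinearMap.congr_fun this c
  refine Chains.hom_ext fun l hl => ?_
  rw [LinearMap.comp_apply, LinearMap.comp_apply, seOp, LinearMap.comp_apply, pMap_map_mkQ,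
    Chains.lift_mk, LinearMap.comp_apply, LinearMap.comp_apply, Chains.map_mk _ _ hl]
  obtain ⟨a, l, rfl⟩ := hl.exists_cons
  have hcyc : IsCyclic (Plus.e A.toGradedQuiver a.cod ::
      (a :: l).map (Plus.inl A.toGradedQuiver).letter) :=
    (isCyclic_merge [] _ (Plus.e A.toGradedQuiver a.cod) _
      ((Plus.inl A.toGradedQuiver).letter a) rfl rfl rfl).2 (isCyclic_map _ hl)
  have hfst : mk ((Plus.e B.toGradedQuiver (F.obj a.cod) ::
      (a :: l).map ((Plus.inl B.toGradedQuiver).letter ∘ F.letter)).map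
        (Plus.fst B.toGradedQuiver).letter) = 0 := by
    rw [List.map_cons, List.map_map]
    exact mk_zero (Q := B.toGradedQuiver) [] ((a :: l).map F.letter) _ _ 0
  rw [seWord, Chains.map_mk _ _ hcyc, List.map_cons, map_e, List.map_map,
    plusMap_letter_comp_inl_letter, Chains.lift_mk, pWord, hfst, zero_add,
    List.map_map, List.map_cons (f := F.letter), sOp_mk_cons]
  exact one_smul k _

theorem mapU_eq : F.mapU = constU (Chains.map F.toQuiverHom) + mulU ∘ₗ constU F.mapB := by
  refine LinearMap.ext fun f => funext fun n => ?_
  cases n with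
  | zero =>
    change pMap B (EChains.map F.toQuiverHom (jMap A.toGradedQuiver (f 0) + 0)) = _ + 0
    rw [add_zero, add_zero, pMap_map_jMap]
    rfl
  | succ n =>
    change pMap B (EChains.map F.toQuiverHom (jMap A.toGradedQuiver (f (n + 1)) +
      seOp A.toGradedQuiver (sOp A (normOp A.toGradedQuiver (f n))))) = _
    rw [map_add, map_add, pMap_map_jMap, pMap_map_seOp]
    rfl

theorem mapU_zero (f : ℕ → Chains A.toGradedQuiver) :
    F.mapU f 0 = Chains.map F.toQuiverHom (f 0) := by
  rw [mapU_eq]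
  exact add_zero _

theorem mapU_succ (f : ℕ → Chains A.toGradedQuiver) (n : ℕ) :
    F.mapU f (n + 1) = Chains.map F.toQuiverHom (f (n + 1)) + F.mapB (f n) := by
  rw [mapU_eq]
  rfl

theorem isNegCycMap_mapU : IsNegCycMap A B F.mapU := by
  rw [mapU_eq]
  exact isCochainMap_constU_add_mulU (hasDeg_map _) (hasDeg_mapB F) (map_hochB F)
    (map_connesB_add_mapB_hochB F) fun c => by rw [mapB_connesB, connesB_mapB]

end Semifunctors

section Unital

variable {A : DGCat.{u, v} k G} {B : DGCat.{u', v'} k G} {F : Semifunctor A B}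

/-- A dg functor: a semifunctor that preserves identities. -/
def Semifunctor.IsUnital (F : Semifunctor A B) : Prop :=
  ∀ x : A.Obj, F.map (A.one x) = B.one (F.obj x)

theorem Semifunctor.IsUnital.letter_id (hF : F.IsUnital) (x : A.Obj) :
    F.letter (Letter.id A x) = Letter.id B (F.obj x) :=
  congrArg (Letter.of B.toGradedQuiver) (hF x)

theorem isCyclic_id_cons {a : Letter A.toGradedQuiver} {l : List (Letter A.toGradedQuiver)}
    (h : IsCyclic (a :: l)) : IsCyclic (Letter.id A a.cod :: a :: l) :=
  (isCyclic_merge [] l (Letter.id A a.cod) a a rfl rfl rfl).2 h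

theorem Semifunctor.IsUnital.map_sOp (hF : F.IsUnital) (c : Chains A.toGradedQuiver) :
    Chains.map F.toQuiverHom (sOp A c) = sOp B (Chains.map F.toQuiverHom c) := by
  suffices Chains.map F.toQuiverHom ∘ₗ sOp A = sOp B ∘ₗ Chains.map F.toQuiverHom from
    LinearMap.congr_fun this c
  refine Chains.hom_ext fun l hl => ?_
  obtain ⟨a, l, rfl⟩ := hl.exists_cons
  rw [LinearMap.comp_apply, LinearMap.comp_apply, Chains.map_mk _ _ hl, sOp_mk_cons,
    Chains.map_mk _ _ (isCyclic_id_cons hl), List.map_cons, hF.letter_id, List.map_cons,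
    sOp_mk_cons]
  rfl

theorem Semifunctor.IsUnital.map_connesB (hF : F.IsUnital) (c : Chains A.toGradedQuiver) :
    Chains.map F.toQuiverHom (connesB A c) = connesB B (Chains.map F.toQuiverHom c) := by
  simp only [connesB, LinearMap.comp_apply, map_oneSubT, hF.map_sOp, map_normOp]

theorem Semifunctor.IsUnital.isNegCycMap (hF : F.IsUnital) :
    IsNegCycMap A B (constU (Chains.map F.toQuiverHom)) :=
  isCochainMap_constU (hasDeg_map _) (map_hochB F) hF.map_connesB

theorem Semifunctor.IsUnital.map_mem_degenerate (hF : F.IsUnital) {c : Chains A.toGradedQuiver}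
    (hc : c ∈ degenerate A) : Chains.map F.toQuiverHom c ∈ degenerate B := by
  refine (Submodule.span_le (p := (degenerate B).comap (Chains.map F.toQuiverHom))).2 ?_ hc
  rintro _ ⟨a, p, q, x, rfl⟩
  change Chains.map F.toQuiverHom (NegCyc.mk _) ∈ degenerate B
  by_cases h : IsCyclic (a :: (p ++ Letter.id A x :: q))
  · rw [Chains.map_mk _ _ h, List.map_cons, List.map_append, List.map_cons, hF.letter_id]
    exact mk_mem_degenerate B _ _ _ _
  · rw [mk_eq_zero_of_not h, map_zero]
    exact zero_mem _

end Unital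

section Normalized

variable (A : DGCat.{u, v} k G)

theorem isCochainMap_quotU : IsCochainMap (Chains.grade A.toGradedQuiver) (negCyc A)
    (NChains.grade A) (negCycBar A) (quotU A) :=
  isCochainMap_constU (fun g c hc => by rw [add_zero]; exact Submodule.mem_map_of_mem hc)
    (fun _ => rfl) fun _ => rfl

theorem quotU_eq_iff {f f' : ℕ → Chains A.toGradedQuiver} :
    quotU A f = quotU A f' ↔ ∀ n, f n - f' n ∈ degenerate A :=
  funext_iff.trans <| forall_congr' fun _ => Submodule.Quotient.eq _

end Normalized

section Homotopy

variable (A : DGCat.{u, v} k G)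

/-- The operator `(1 - t⁻¹) s s s N`, whose `u`-multiple is a homotopy from the identity to
`F_*(u) I_*` for a dg functor `I` and a semifunctor `F` with `F I = 1`. -/
noncomputable def tripleS : Chains A.toGradedQuiver →ₗ[k] Chains A.toGradedQuiver :=
  oneSubT A.toGradedQuiver ∘ₗ sOp A ∘ₗ sOp A ∘ₗ sOp A ∘ₗ normOp A.toGradedQuiver

theorem hasDeg_tripleS :
    HasDeg (Chains.grade A.toGradedQuiver) (Chains.grade A.toGradedQuiver) (tripleS A) (-3) :=
  have two : (-1 : G) + -1 = -2 := by norm_num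
  have three : (-2 : G) + -1 = -3 := by norm_num
  hasDeg_oneSubT.comp ((hasDeg_sOp A).comp ((hasDeg_sOp A).comp
    ((hasDeg_sOp A).comp hasDeg_normOp (zero_add _)) two) three) (add_zero _)

theorem hochB_tripleS (c : Chains A.toGradedQuiver) :
    hochB A (tripleS A c) =
      oneSubT A.toGradedQuiver (sOp A (sOp A (normOp A.toGradedQuiver c)))
        - tripleS A (hochB A c) := by
  simp only [tripleS, LinearMap.comp_apply, hochB_oneSubT, barB_sOp, barB_normOp, map_sub]
  abel

theorem connesB_tripleS (c : Chains A.toGradedQuiver) : connesB A (tripleS A c) = 0 := by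
  simp only [tripleS, connesB, LinearMap.comp_apply, normOp_oneSubT, map_zero]

theorem tripleS_connesB (c : Chains A.toGradedQuiver) : tripleS A (connesB A c) = 0 := by
  simp only [tripleS, connesB, LinearMap.comp_apply, normOp_oneSubT, map_zero]

theorem mulU_tripleS_mem_gradeU {g : G} {f : ℕ → Chains A.toGradedQuiver}
    (hf : f ∈ gradeU (Chains.grade A.toGradedQuiver) g) :
    mulU (k := k) (constU (tripleS A) f) ∈ gradeU (Chains.grade A.toGradedQuiver) (g - 1) := by
  intro n
  cases n with
  | zero => exact zero_mem _
  | succ n =>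
    rw [show g - 1 - 2 * ((n + 1 : ℕ) : G) = g - 2 * (n : G) + -3 by push_cast; ring]
    exact hasDeg_tripleS A _ _ (hf n)

theorem negCyc_mulU_tripleS (f : ℕ → Chains A.toGradedQuiver) :
    negCyc A (mulU (k := k) (constU (tripleS A) f))
        + mulU (k := k) (constU (tripleS A) (negCyc A f)) =
      mulU (k := k) (constU
        (oneSubT A.toGradedQuiver ∘ₗ sOp A ∘ₗ sOp A ∘ₗ normOp A.toGradedQuiver) f) := by
  funext n
  match n with
  | 0 => simp [negCyc]
  | 1 => simp [negCyc, hochB_tripleS]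
  | n + 2 => simp [negCyc, hochB_tripleS, connesB_tripleS, tripleS_connesB]

end Homotopy

section Retraction

variable {A : DGCat.{u, v} k G} {B : DGCat.{u', v'} k G} {F : Semifunctor A B}
  {I : Semifunctor B A}

theorem mapU_constU_map (hI : I.IsUnital)
    (hFI : ∀ c, Chains.map F.toQuiverHom (Chains.map I.toQuiverHom c) = c)
    (f : ℕ → Chains B.toGradedQuiver) :
    F.mapU (constU (Chains.map I.toQuiverHom) f) =
      f + (negCyc B (mulU (k := k) (constU (tripleS B) f))
        + mulU (k := k) (constU (tripleS B) (negCyc B f))) := by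
  have mapB_map (c : Chains B.toGradedQuiver) : F.mapB (Chains.map I.toQuiverHom c) =
      oneSubT B.toGradedQuiver (sOp B (sOp B (normOp B.toGradedQuiver c))) := by
    simp only [Semifunctor.mapB, LinearMap.comp_apply, ← map_normOp, ← hI.map_sOp, hFI]
  rw [negCyc_mulU_tripleS]
  funext n
  cases n with
  | zero => simp [mapU_zero, hFI]
  | succ n => simp [mapU_succ, hFI, mapB_map]

theorem coh_map_mapU_comp_coh_map (hI : I.IsUnital)
    (hFI : ∀ c, Chains.map F.toQuiverHom (Chains.map I.toQuiverHom c) = c)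
    (hF : IsNegCycMap A B F.mapU)
    (hmap : IsNegCycMap B A (constU (Chains.map I.toQuiverHom))) (g : G) :
    Coh.map hF g ∘ₗ Coh.map hmap g = (LinearMap.id : HN B g →ₗ[k] HN B g) :=
  Coh.map_comp_map_eq_id hmap hF (fun _ => mulU_tripleS_mem_gradeU B) fun f hf => by
    rw [mapU_constU_map hI hFI, LinearMap.mem_ker.1 hf.2, map_zero, map_zero, add_zero,
      add_sub_cancel_left]

end Retraction

section Coefficients

theorem factorial_div_two_mul_factorial (n : ℕ) :
    (2 * (n + 1)).factorial / (2 * (n + 1).factorial) =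
      (2 * n + 1) * ((2 * n).factorial / n.factorial) := by
  have hdvd : n.factorial ∣ (2 * n).factorial := Nat.factorial_dvd_factorial (by lia)
  rw [← Nat.mul_div_assoc _ hdvd, ← Nat.factorial_succ, Nat.factorial_succ n, ← mul_assoc,
    show (2 * (n + 1)).factorial = 2 * (n + 1) * (2 * n + 1).factorial from Nat.factorial_succ _,
    Nat.mul_div_mul_left _ _ (by positivity)]

theorem two_mul_factorial_div (n : ℕ) :
    2 * ((2 * (n + 1)).factorial / (2 * (n + 1).factorial)) =
      (2 * (n + 1)).factorial / (n + 1).factorial := by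
  have hdvd : 2 * (n + 1).factorial ∣ (2 * (n + 1)).factorial := by
    rw [Nat.factorial_succ, ← mul_assoc, show 2 * (n + 1) = 2 * n + 1 + 1 by ring,
      Nat.factorial_succ (2 * n + 1)]
    exact mul_dvd_mul_left _ (Nat.factorial_dvd_factorial (by lia))
  rw [← Nat.mul_div_assoc _ hdvd, Nat.mul_div_mul_left _ _ two_pos]

/-- The coefficient `(-1) ^ n (2 n)! / n!` of `1_x[1_x|⋯|1_x] u^n` in `γ_x`, which is also correct
for `n = 0`. -/
noncomputable def gammaCoef (k : Type*) [Field k] (n : ℕ) : k :=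
  (-1) ^ n * (((2 * n).factorial / n.factorial : ℕ) : k)

theorem gammaCoef_succ (k : Type*) [Field k] (n : ℕ) :
    gammaCoef k (n + 1) = 2 * coef k (n + 1) := by
  rw [gammaCoef, coef, ← two_mul_factorial_div]
  push_cast
  ring

theorem coef_succ (k : Type*) [Field k] (n : ℕ) :
    coef k (n + 1) = -((2 * (n : k) + 1) * gammaCoef k n) := by
  rw [gammaCoef, coef, factorial_div_two_mul_factorial]
  push_cast
  ring

theorem sgn_natCast (n : ℕ) : sgn k (n : G) = (-1) ^ n := by
  induction n with
  | zero => simp [sgn_zero]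
  | succ n ih => rw [Nat.cast_succ, sgn_add, ih, sgn_one, pow_succ]

end Coefficients

section Gamma

variable (A : DGCat.{u, v} k G) (x : A.Obj)

/-- The word `1_x[1_x|⋯|1_x]` with `n` letters. -/
noncomputable def idWord (n : ℕ) : Chains A.toGradedQuiver := mk (List.replicate n (Letter.id A x))

theorem gammaSeries_eq (n : ℕ) :
    gammaSeries A x n = gammaCoef k n • idWord A x (2 * n + 1) := by
  cases n with
  | zero => exact ((congrArg (· • _) (by simp [gammaCoef])).trans (one_smul k _)).symm
  | succ n =>
    rw [gammaSeries, smul_smul, gammaCoef_succ, mul_comm]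
    rfl

theorem sdeg_replicate_id (n : ℕ) :
    sdeg (List.replicate n (Letter.id A x)) = -(n : G) := by
  induction n with
  | zero => simp
  | succ n ih =>
    rw [List.replicate_succ, sdeg_cons, ih, show (Letter.id A x).deg = 0 from rfl]
    push_cast
    ring

theorem tInv_idWord (n : ℕ) :
    tInv A.toGradedQuiver (idWord A x (n + 1)) = (-1 : k) ^ n • idWord A x (n + 1) := by
  rw [idWord, List.replicate_succ', tInv_mk_concat, sdeg_replicate_id,
    show (Letter.id A x).deg = 0 from rfl, zero_sub, neg_mul_neg, one_mul, sgn_natCast,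
    ← List.replicate_succ, ← List.replicate_succ']

theorem tInv_idWord_of_odd (n : ℕ) :
    tInv A.toGradedQuiver (idWord A x (2 * n + 1)) = idWord A x (2 * n + 1) := by
  rw [tInv_idWord, pow_mul, neg_one_sq, one_pow, one_smul]

theorem sOp_idWord (n : ℕ) : sOp A (idWord A x (n + 1)) = idWord A x (n + 2) :=
  sOp_mk_cons A _ _

theorem normOp_idWord (n : ℕ) :
    normOp A.toGradedQuiver (idWord A x (2 * n + 1)) =
      (2 * (n : k) + 1) • idWord A x (2 * n + 1) := by
  have tInv_pow (i : ℕ) :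
      (tInv A.toGradedQuiver ^ i) (idWord A x (2 * n + 1)) = idWord A x (2 * n + 1) := by
    rw [Module.End.pow_apply]
    exact Function.iterate_fixed (tInv_idWord_of_odd A x n) i
  rw [normOp_of_mem_len (c := idWord A x _) (mk_mem_len List.length_replicate)]
  simp only [tInv_pow, sum_const, card_range]
  rw [← Nat.cast_smul_eq_nsmul k]
  push_cast
  rfl

theorem barB_idWord_succ (n : ℕ) :
    barB A (idWord A x (n + 2)) = idWord A x (n + 1) - sOp A (barB A (idWord A x (n + 1))) := by
  rw [← sOp_idWord, barB_sOp]

theorem barB_idWord (n : ℕ) :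
    barB A (idWord A x (2 * n + 1)) = 0 ∧
      barB A (idWord A x (2 * n + 2)) = idWord A x (2 * n + 1) := by
  suffices odd : barB A (idWord A x (2 * n + 1)) = 0 from
    ⟨odd, by rw [barB_idWord_succ, odd, map_zero, sub_zero]⟩
  induction n with
  | zero =>
    rw [idWord, barB_mk]
    exact (congrArg _ (mk_diff_id A [] [] x)).trans (smul_zero (sgn k (0 : G)))
  | succ n ih =>
    rw [show 2 * (n + 1) + 1 = 2 * n + 1 + 2 by ring, barB_idWord_succ, barB_idWord_succ, ih,
      map_zero, sub_zero, sOp_idWord, sub_self]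

theorem hochB_idWord_one : hochB A (idWord A x 1) = 0 := by
  rw [hochB_eq, LinearMap.add_apply, Module.End.mul_apply, (barB_idWord A x 0).1, zero_add,
    tInv_idWord_of_odd A x 0]
  exact mulFirst_mk_singleton A _

theorem hochB_idWord (n : ℕ) :
    hochB A (idWord A x (2 * (n + 1) + 1)) = idWord A x (2 * n + 2) := by
  rw [hochB_eq, LinearMap.add_apply, Module.End.mul_apply, (barB_idWord A x (n + 1)).1, zero_add,
    tInv_idWord_of_odd A x (n + 1), idWord, List.replicate_succ, mul_add_one, List.replicate_succ,
    mulFirst_mk_cons_cons, show (Letter.id A x).deg = 0 from rfl, sgn_zero, one_smul]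
  exact congrArg (fun a => mk (a :: _)) (letter_id_mul A (Letter.id A x))

theorem connesB_idWord (n : ℕ) :
    connesB A (idWord A x (2 * n + 1)) = ((2 * (n : k) + 1) * 2) • idWord A x (2 * n + 2) := by
  rw [connesB, LinearMap.comp_apply, LinearMap.comp_apply, normOp_idWord, map_smul, map_smul,
    sOp_idWord, oneSubT_eq_one_sub, LinearMap.sub_apply, Module.End.one_apply, tInv_idWord,
    pow_succ, pow_mul, neg_one_sq, one_pow, one_mul]
  module

theorem gammaSeries_mem_cocycles :
    gammaSeries A x ∈ cocycles (Chains.grade A.toGradedQuiver) (negCyc A) 0 := by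
  refine ⟨fun n => ?_, LinearMap.mem_ker.2 (funext fun n => ?_)⟩
  · rw [gammaSeries_eq]
    refine Submodule.smul_mem _ _ (mk_mem_grade ?_)
    rw [sdeg_replicate_id]
    push_cast
    ring
  · rw [negCyc]
    cases n with
    | zero =>
      rw [negD_zero, gammaSeries_eq, map_smul, hochB_idWord_one, smul_zero, Pi.zero_apply]
    | succ n =>
      rw [negD_succ, gammaSeries_eq, gammaSeries_eq, map_smul, map_smul, connesB_idWord,
        hochB_idWord, gammaCoef_succ, coef_succ, Pi.zero_apply]
      module

theorem quotU_gammaSeries : quotU A (gammaSeries A x) = quotU A (unitSeries A x) := by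
  rw [quotU_eq_iff]
  intro n
  cases n with
  | zero =>
    rw [gammaSeries, unitSeries, sub_self]
    exact zero_mem _
  | succ n =>
    rw [unitSeries, sub_zero, gammaSeries_eq]
    exact Submodule.smul_mem _ _ (mk_mem_degenerate A _ [] _ x)

end Gamma

section Idempotent

variable {A : DGCat.{u, v} k G} {B : DGCat.{u', v'} k G} (F : Semifunctor A B) (x : A.Obj)

theorem isCyclic_of_forall {Q : GradedQuiver.{u, v} k G} {x : Q.Obj} {a : Letter Q}
    {l : List (Letter Q)} (h : ∀ b ∈ a :: l, b.dom = x ∧ b.cod = x) : IsCyclic (a :: l) := by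
  have mem (b : Letter Q) (hb : b ∈ a :: (l ++ [a])) : b ∈ a :: l := by
    simp only [List.mem_cons, List.mem_append, List.not_mem_nil, or_false] at hb ⊢
    tauto
  refine (List.pairwise_of_forall_mem_list fun b hb c hc => ?_).isChain
  exact (h b (mem b hb)).1.trans (h c (mem c hc)).2.symm

theorem isCyclic_of_cons_replicate (f π : A.Hom x x 0) (n : ℕ) :
    IsCyclic (Letter.of A.toGradedQuiver f ::
      List.replicate n (Letter.of A.toGradedQuiver π)) :=
  isCyclic_of_forall (x := x) fun b hb => by
    rcases List.mem_cons.1 hb with rfl | hb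
    · exact ⟨rfl, rfl⟩
    · rw [List.eq_of_mem_replicate hb]
      exact ⟨rfl, rfl⟩

theorem map_idWord (n : ℕ) :
    Chains.map F.toQuiverHom (idWord A x (n + 1)) =
      mk (List.replicate (n + 1) (Letter.of B.toGradedQuiver (F.map (A.one x)))) := by
  refine (Chains.map_mk _ _ (isCyclic_of_cons_replicate x (A.one x) (A.one x) n)).trans ?_
  rw [← List.replicate_succ, List.map_replicate]
  rfl

theorem mk_two_smul_sub_cons (π : A.Hom x x 0) (l : List (Letter A.toGradedQuiver)) :
    mk (Letter.of A.toGradedQuiver ((2 : k) • π - A.one x) :: l) =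
      (2 : k) • mk (Letter.of A.toGradedQuiver π :: l) - mk (Letter.id A x :: l) := by
  have hsub := mk_lin_of_eq [] l (Q := A.toGradedQuiver) (c := (-1 : k))
    (e := (2 : k) • π - A.one x) (f := A.one x) (g := (2 : k) • π) (by module)
  have htwo := mk_lin_of_eq [] l (Q := A.toGradedQuiver) (c := (2 : k))
    (e := (2 : k) • π) (f := π) (g := 0) (by module)
  have hzero := mk_zero [] l (Q := A.toGradedQuiver) x x 0
  simp only [List.nil_append] at hsub htwo hzero
  rw [hsub, htwo, hzero, Letter.id]
  module

theorem mapB_idWord_sub_mem_degenerate (n : ℕ) :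
    F.mapB (idWord A x (2 * n + 1)) -
      (2 * (n : k) + 1) • mk (Letter.id B (F.obj x) :: List.replicate (2 * (n + 1))
        (Letter.of B.toGradedQuiver (F.map (A.one x)))) ∈ degenerate B := by
  set π := Letter.of B.toGradedQuiver (F.map (A.one x)) with hπ
  have hs : sOp B (mk (List.replicate (2 * n + 2) π)) =
      mk (Letter.id B (F.obj x) :: List.replicate (2 * n + 2) π) := sOp_mk_cons B _ _
  rw [Semifunctor.mapB, LinearMap.comp_apply, LinearMap.comp_apply, LinearMap.comp_apply,
    LinearMap.comp_apply, normOp_idWord, map_smul, map_smul, map_smul, map_smul, sOp_idWord,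
    map_idWord, ← hπ, hs, ← smul_sub, oneSubT_eq_one_sub, LinearMap.sub_apply,
    Module.End.one_apply, show 2 * (n + 1) = 2 * n + 1 + 1 by ring, List.replicate_succ',
    ← List.cons_append, tInv_mk_concat, List.cons_append, sub_sub_cancel_left]
  exact Submodule.smul_mem _ _ (neg_mem (Submodule.smul_mem _ _ (mk_mem_degenerate B _ [] _ _)))

theorem quotU_mapU_gammaSeries :
    quotU B (F.mapU (gammaSeries A x)) =
      quotU B (etaSeries B (F.obj x) (F.map (A.one x))) := by
  rw [quotU_eq_iff]
  intro n
  cases n with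
  | zero =>
    rw [mapU_zero, gammaSeries, etaSeries, show mk [Letter.id A x] = idWord A x 1 from rfl,
      map_idWord F x 0, List.replicate_one, sub_self]
    exact zero_mem _
  | succ n =>
    rw [mapU_succ, gammaSeries_eq, gammaSeries_eq, map_smul, map_smul, map_idWord,
      etaSeries, mk_two_smul_sub_cons]
    convert Submodule.smul_mem _ (gammaCoef k n) (mapB_idWord_sub_mem_degenerate F x n) using 1
    rw [gammaCoef_succ, coef_succ, List.replicate_succ]
    module

variable {F} in
theorem Semifunctor.IsUnital.map_etaSeries (hF : F.IsUnital) (π : A.Hom x x 0) :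
    constU (Chains.map F.toQuiverHom) (etaSeries A x π) = etaSeries B (F.obj x) (F.map π) := by
  funext n
  cases n with
  | zero => exact Chains.map_mk _ _ (isCyclic_of_cons_replicate x π π 0)
  | succ n =>
    rw [constU_apply, etaSeries, etaSeries, map_smul]
    refine congrArg _ ((Chains.map_mk _ _ (isCyclic_of_cons_replicate x _ π _)).trans ?_)
    rw [List.map_cons, List.map_replicate, ← hF x, ← map_smul, ← map_sub]
    rfl

end Idempotent
/-- Linear combinations of arbitrary, possibly non-composable words of letters. The insertion
operators below do not preserve cyclic composability of all words, so they live here. -/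
abbrev Words (Q : GradedQuiver.{u, v} k G) := List (Letter Q) →₀ k

section Words

variable {Q : GradedQuiver.{u, v} k G} {M : Type*} [AddCommGroup M] [Module k M]

/-- A word as a basis element of `Words Q`. -/
noncomputable def word (l : List (Letter Q)) : Words Q := Finsupp.single l 1

namespace Words

/-- The linear extension of a map on words. -/
noncomputable def lift (φ : List (Letter Q) → M) : Words Q →ₗ[k] M := Finsupp.linearCombination k φ

/-- Prepending a letter. -/
noncomputable def prepend (a : Letter Q) : Words Q →ₗ[k] Words Q := lift fun l => word (a :: l)

@[simp]
theorem lift_word (φ : List (Letter Q) → M) (l : List (Letter Q)) : lift φ (word l) = φ l := by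
  simp [lift, word]

@[simp]
theorem prepend_word (a : Letter Q) (l : List (Letter Q)) : prepend a (word l) = word (a :: l) :=
  lift_word _ l

theorem hom_ext {f g : Words Q →ₗ[k] M} (h : ∀ l, f (word l) = g (word l)) : f = g :=
  Finsupp.lhom_ext' fun l => LinearMap.ext_ring (h l)

theorem lift_prepend (φ : List (Letter Q) → M) (a : Letter Q) (w : Words Q) :
    lift φ (prepend a w) = lift (fun l => φ (a :: l)) w := by
  suffices h : lift φ ∘ₗ prepend a = lift fun l => φ (a :: l) from LinearMap.congr_fun h w
  exact hom_ext fun l => by simp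

theorem lift_smul_add (c : k) (φ ψ : List (Letter Q) → M) (w : Words Q) :
    lift (fun l => c • φ l + ψ l) w = c • lift φ w + lift ψ w := by
  suffices h : lift (fun l => c • φ l + ψ l) = c • lift φ + lift ψ from LinearMap.congr_fun h w
  exact hom_ext fun l => by simp

theorem map_lift {M' : Type*} [AddCommGroup M'] [Module k M'] (f : M →ₗ[k] M')
    (φ : List (Letter Q) → M) (w : Words Q) : f (lift φ w) = lift (fun l => f (φ l)) w := by
  suffices h : f ∘ₗ lift φ = lift fun l => f (φ l) from LinearMap.congr_fun h w
  exact hom_ext fun l => by simp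

theorem smul_lift (c : k) (φ : List (Letter Q) → M) (w : Words Q) :
    c • lift φ w = lift (fun l => c • φ l) w :=
  map_lift (c • LinearMap.id) φ w

theorem prepend_mem_span {S T : Set (List (Letter Q))} {a : Letter Q} (h : ∀ l ∈ S, a :: l ∈ T)
    {w : Words Q} (hw : w ∈ Submodule.span k (word '' S)) :
    prepend a w ∈ Submodule.span k (word '' T) := by
  refine Submodule.span_le (p := (Submodule.span k (word '' T)).comap (prepend a)).2 ?_ hw
  rintro _ ⟨l, hl, rfl⟩
  exact Submodule.subset_span ⟨a :: l, h l hl, (prepend_word a l).symm⟩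

theorem lift_congr {S : Set (List (Letter Q))} {φ ψ : List (Letter Q) → M}
    (h : ∀ l ∈ S, φ l = ψ l) {w : Words Q} (hw : w ∈ Submodule.span k (word '' S)) :
    lift φ w = lift ψ w := by
  refine LinearMap.eqOn_span (s := word '' S) ?_ hw
  rintro _ ⟨l, hl, rfl⟩
  simpa using h l hl

theorem lift_mem {S : Set (List (Letter Q))} {φ : List (Letter Q) → M} {N : Submodule k M}
    (h : ∀ l ∈ S, φ l ∈ N) {w : Words Q} (hw : w ∈ Submodule.span k (word '' S)) :
    lift φ w ∈ N := by
  refine Submodule.span_le (p := N.comap (lift φ)).2 ?_ hw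
  rintro _ ⟨l, hl, rfl⟩
  simpa using h l hl

end Words

end Words

section WordDifferential

variable (A : DGCat.{u, v} k G)

open Words

/-- Composition of a letter with the first letter of a word; zero on the empty word. -/
noncomputable def mulHead (a : Letter A.toGradedQuiver) :
    Words A.toGradedQuiver →ₗ[k] Words A.toGradedQuiver :=
  lift fun
    | [] => 0
    | b :: l => word (a.mul A b :: l)

/-- The bar differential `b'` of a word, before passing to chains. -/
noncomputable def wordDiff : List (Letter A.toGradedQuiver) → Words A.toGradedQuiver
  | [] => 0
  | a :: l => word (a.diff A :: l) + sgn k a.deg • (mulHead A a (word l) - prepend a (wordDiff l))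

@[simp]
theorem mulHead_word_nil (a : Letter A.toGradedQuiver) : mulHead A a (word []) = 0 :=
  lift_word _ _

@[simp]
theorem mulHead_word_cons (a b : Letter A.toGradedQuiver) (l : List (Letter A.toGradedQuiver)) :
    mulHead A a (word (b :: l)) = word (a.mul A b :: l) :=
  lift_word _ _

@[simp]
theorem mulHead_prepend (a b : Letter A.toGradedQuiver) (w : Words A.toGradedQuiver) :
    mulHead A a (prepend b w) = prepend (a.mul A b) w := by
  suffices h : mulHead A a ∘ₗ prepend b = prepend (a.mul A b) from LinearMap.congr_fun h w
  exact hom_ext fun l => by simp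

theorem lift_wordDiff_prepend (a : Letter A.toGradedQuiver) (w : Words A.toGradedQuiver) :
    lift (wordDiff A) (prepend a w) = prepend (a.diff A) w +
      sgn k a.deg • (mulHead A a w - prepend a (lift (wordDiff A) w)) := by
  suffices h : lift (wordDiff A) ∘ₗ prepend a = prepend (a.diff A) +
      sgn k a.deg • (mulHead A a - prepend a ∘ₗ lift (wordDiff A)) from LinearMap.congr_fun h w
  exact hom_ext fun l => by simp [wordDiff]

theorem barDiff_eq_lift_wordDiff (p l : List (Letter A.toGradedQuiver)) :
    barDiff A p l = sgn k (sdeg p) • lift (fun q => mk (p ++ q)) (wordDiff A l) := by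
  induction l generalizing p with
  | nil => simp [barDiff, wordDiff]
  | cons a l ih =>
    have ih' := ih (p ++ [a])
    simp only [sdeg_concat, List.append_assoc, List.cons_append, List.nil_append] at ih'
    cases l with
    | nil => simp [barDiff, wordDiff]
    | cons b l =>
      rw [barDiff, wordDiff, ih']
      simp only [map_add, map_sub, map_smul, lift_word, mulHead_word_cons, lift_prepend]
      module

theorem barB_lift_mk (w : Words A.toGradedQuiver) :
    barB A (lift mk w) = lift mk (lift (wordDiff A) w) := by
  rw [map_lift, map_lift]
  congr 2
  funext l
  rw [barB_mk, barDiff_eq_lift_wordDiff, sdeg_nil, sgn_zero, one_smul]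
  rfl

theorem wordDiff_mem_span (l : List (Letter A.toGradedQuiver)) :
    wordDiff A l ∈ Submodule.span k
      (word '' {q | ∀ p, IsCyclic (p ++ l) → IsCyclic (p ++ q)}) := by
  induction l with
  | nil => exact zero_mem _
  | cons a l ih =>
    refine add_mem (Submodule.subset_span ⟨_, fun p h => ?_, rfl⟩)
      (Submodule.smul_mem _ _ (sub_mem ?_ (prepend_mem_span (fun q hq => ?_) ih)))
    · exact (isCyclic_congr' _ _ (by simp [Letter.diff, Letter.of])).1 h
    · cases l with
      | nil => simp
      | cons b l =>
        rw [mulHead_word_cons]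
        exact Submodule.subset_span ⟨_, fun p h =>
          (isCyclic_merge p l a b _ (isCyclic_adj h) (mul_cod A a b) (mul_dom A a b)).1 h, rfl⟩
    · intro p h
      simpa using hq (p ++ [a]) (by simpa using h)

end WordDifferential

section Insertion

variable {A : DGCat.{u, v} k G} {F : Semifunctor A A}

open Words

/-- The signed sum `∑ ± F(l₁) u l₂` over the decompositions `l = l₁ l₂`, with the Koszul sign of
moving `u` past `F(l₁)`. The object `x` is used only for the empty word. -/
noncomputable def insertion {e : G} (u : ∀ x, A.Hom x (F.obj x) e) :
    List (Letter A.toGradedQuiver) → A.Obj → Words A.toGradedQuiver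
  | [], x => word [Letter.of A.toGradedQuiver (u x)]
  | a :: l, _ => word (Letter.of A.toGradedQuiver (u a.cod) :: a :: l) +
      sgn k ((a.deg - 1) * (e - 1)) • prepend (F.letter a) (insertion u l a.dom)

theorem insertion_mem_span {e : G} (u : ∀ x, A.Hom x (F.obj x) e)
    (l : List (Letter A.toGradedQuiver)) (x : A.Obj) :
    insertion u l x ∈ Submodule.span k (word '' {q | sdeg q = sdeg l + (e - 1)}) := by
  induction l generalizing x with
  | nil =>
    refine Submodule.subset_span ⟨_, ?_, rfl⟩
    change sdeg [_] = _
    rw [sdeg_cons, sdeg_nil, add_comm]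
    rfl
  | cons a l ih =>
    refine add_mem (Submodule.subset_span ⟨_, ?_, rfl⟩)
      (Submodule.smul_mem _ _ (prepend_mem_span (fun q hq => ?_) (ih a.dom)))
    · exact (sdeg_cons _ _).trans (add_comm _ _)
    · change sdeg (F.letter a :: q) = sdeg (a :: l) + (e - 1)
      rw [sdeg_cons, sdeg_cons, show sdeg q = _ from hq, ← add_assoc]
      rfl

theorem insertion_concat {e : G} (u : ∀ x, A.Hom x (F.obj x) e)
    {c z : Letter A.toGradedQuiver} {q : List (Letter A.toGradedQuiver)}
    (h : (c :: (q ++ [z])).IsChain fun s t => s.dom = t.cod) :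
    insertion u (q ++ [z]) c.dom = lift (fun r => word (r ++ [z])) (insertion u q c.dom) +
      sgn k (sdeg (q ++ [z]) * (e - 1)) •
        word ((q ++ [z]).map F.letter ++ [Letter.of A.toGradedQuiver (u z.dom)]) := by
  induction q generalizing c with
  | nil =>
    rw [show c.dom = z.cod from (List.isChain_cons_cons.1 h).1]
    simp [insertion]
  | cons a q ih =>
    have ih := ih h.of_cons
    simp only [insertion, List.cons_append, List.map_cons, ih, map_add, map_smul, lift_word,
      lift_prepend, prepend_word, sdeg_cons, add_mul, sgn_add, map_lift]
    module

/-- A map on words is multilinear in the letters. -/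
def IsMultilinear {Q : GradedQuiver.{u, v} k G} {M : Type*} [AddCommGroup M] [Module k M]
    (φ : List (Letter Q) → M) : Prop :=
  ∀ (p q : List (Letter Q)) (x y : Q.Obj) (n : G) (c : k) (f g : Q.Hom x y n),
    φ (p ++ Letter.of Q (c • f + g) :: q) =
      c • φ (p ++ Letter.of Q f :: q) + φ (p ++ Letter.of Q g :: q)

theorem IsMultilinear.cons {Q : GradedQuiver.{u, v} k G} {M : Type*} [AddCommGroup M] [Module k M]
    {φ : List (Letter Q) → M} (hφ : IsMultilinear φ) (a : Letter Q) :
    IsMultilinear fun l => φ (a :: l) :=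
  fun p => hφ (a :: p)

theorem IsMultilinear.lift_insertion {M : Type*} [AddCommGroup M] [Module k M]
    {φ : List (Letter A.toGradedQuiver) → M} (hφ : IsMultilinear φ) {e : G}
    (u : ∀ x, A.Hom x (F.obj x) e) (z : A.Obj) :
    IsMultilinear fun l => lift φ (insertion u l z) := by
  intro p q x y n c f g
  induction p generalizing φ z with
  | nil =>
    have hF (r) : φ (F.letter (Letter.of A.toGradedQuiver (c • f + g)) :: r) =
        c • φ (F.letter (Letter.of A.toGradedQuiver f) :: r) +
          φ (F.letter (Letter.of A.toGradedQuiver g) :: r) := by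
      have h := hφ [] r _ _ n c (F.map f) (F.map g)
      rwa [← map_smul, ← map_add] at h
    have hu := hφ [Letter.of A.toGradedQuiver (u y)] q x y n c f g
    simp only [List.cons_append, List.nil_append] at hu
    simp only [List.nil_append, insertion, map_add, map_smul, lift_word, lift_prepend, hF,
      lift_smul_add]
    change φ (Letter.of A.toGradedQuiver (u y) :: _ :: q) +
        sgn k ((n - 1) * (e - 1)) • (c • lift _ (insertion u q x) + lift _ (insertion u q x)) =
      c • (φ (Letter.of A.toGradedQuiver (u y) :: _ :: q) +
        sgn k ((n - 1) * (e - 1)) • lift _ (insertion u q x)) +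
      (φ (Letter.of A.toGradedQuiver (u y) :: _ :: q) +
        sgn k ((n - 1) * (e - 1)) • lift _ (insertion u q x))
    rw [hu]
    module
  | cons a p ih =>
    have hp := hφ (Letter.of A.toGradedQuiver (u a.cod) :: a :: p) q x y n c f g
    have ih' := ih (hφ.cons (F.letter a)) a.dom
    simp only [List.cons_append, insertion, map_add, map_smul, lift_word, lift_prepend] at hp ih' ⊢
    rw [hp, ih']
    module

end Insertion

theorem sgn_eq_one_or_eq_neg_one (g : G) : sgn k g = 1 ∨ sgn k g = -1 := by
  unfold sgn
  split_ifs <;> simp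

theorem isChain_of_isCyclic {Q : GradedQuiver.{u, v} k G} {a : Letter Q} {l : List (Letter Q)}
    (h : IsCyclic (a :: l)) : (a :: l).IsChain fun s t => s.dom = t.cod := by
  change List.IsChain _ (a :: (l ++ [a])) at h
  rw [← List.cons_append] at h
  exact h.left_of_append

theorem mulFirst_tInv_mk_cons_concat (A : DGCat.{u, v} k G) (b z : Letter A.toGradedQuiver)
    (r : List (Letter A.toGradedQuiver)) :
    mulFirst A (tInv A.toGradedQuiver (mk (b :: (r ++ [z])))) =
      (sgn k ((z.deg - 1) * sdeg (b :: r)) * sgn k z.deg) • mk (z.mul A b :: r) := by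
  rw [← List.cons_append, tInv_mk_concat, map_smul, mulFirst_mk_cons_cons, smul_smul]

theorem Letter.mul_assoc {A : DGCat.{u, v} k G} {a b c : Letter A.toGradedQuiver}
    (hab : a.dom = b.cod) (hbc : b.dom = c.cod) :
    (a.mul A b).mul A c = a.mul A (b.mul A c) := by
  obtain ⟨_, y, n, f⟩ := a
  obtain ⟨_, z, m, g⟩ := b
  obtain ⟨_, _, r, h⟩ := c
  obtain rfl : y = _ := hab
  obtain rfl : z = _ := hbc
  change ((Letter.of A.toGradedQuiver f).mul A (Letter.of A.toGradedQuiver g)).mul A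
    (Letter.of A.toGradedQuiver h) = (Letter.of A.toGradedQuiver f).mul A
      ((Letter.of A.toGradedQuiver g).mul A (Letter.of A.toGradedQuiver h))
  rw [mul_of A f g, ← letter_of_comp (add_assoc n m r), A.assoc rfl (add_assoc _ _ _) rfl rfl,
    letter_of_comp, letter_of_comp]

/-- Data exhibiting the endofunctor `F` as `f ↦ up ∘ f ∘ down` for closed morphisms `up` and `down`
with `down ∘ up = 1`. Such an `F` acts trivially on Hochschild homology. -/
structure Conjugation {A : DGCat.{u, v} k G} (F : Semifunctor A A) where
  intro ::
  up : ∀ x, A.Hom x (F.obj x) 0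
  down : ∀ x, A.Hom (F.obj x) x 0
  d_up : ∀ x, A.d (up x) = 0
  d_down : ∀ x, A.d (down x) = 0
  down_up : ∀ x, A.comp (add_zero 0) (down x) (up x) = A.one x
  map_eq : ∀ {x y : A.Obj} {n : G} (f : A.Hom x y n),
    F.map f = A.comp (zero_add n) (up y) (A.comp (add_zero n) f (down x))

namespace Conjugation

variable {A : DGCat.{u, v} k G} {F : Semifunctor A A} (C : Conjugation F)

open Words

section Letters

/-- The morphism `up x` as a letter. -/
def upLetter (x : A.Obj) : Letter A.toGradedQuiver := Letter.of A.toGradedQuiver (C.up x)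

/-- The morphism `down x` as a letter. -/
def downLetter (x : A.Obj) : Letter A.toGradedQuiver := Letter.of A.toGradedQuiver (C.down x)

/-- The letter `a ∘ down`, which starts the words of the homotopy `C.wordHomotopy`. -/
noncomputable def mulDown (a : Letter A.toGradedQuiver) : Letter A.toGradedQuiver :=
  a.mul A (C.downLetter a.dom)

theorem mulDown_cod (a : Letter A.toGradedQuiver) : (C.mulDown a).cod = a.cod := mul_cod _ _ _

theorem mulDown_dom (a : Letter A.toGradedQuiver) : (C.mulDown a).dom = F.obj a.dom := mul_dom _ _ _

@[simp]
theorem mulDown_deg (a : Letter A.toGradedQuiver) : (C.mulDown a).deg = a.deg :=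
  (Letter.mul_deg A a _).trans (add_zero _)

theorem downLetter_mul_upLetter (x : A.Obj) :
    (C.downLetter x).mul A (C.upLetter x) = Letter.id A x := by
  rw [downLetter, upLetter, ← letter_of_comp (add_zero 0), C.down_up]
  rfl

theorem upLetter_mul_mulDown (a : Letter A.toGradedQuiver) :
    (C.upLetter a.cod).mul A (C.mulDown a) = F.letter a := by
  refine Eq.symm ((congrArg (Letter.of A.toGradedQuiver) (C.map_eq a.hom)).trans ?_)
  rw [letter_of_comp, letter_of_comp]
  rfl

@[simp]
theorem mulDown_mul_upLetter (a : Letter A.toGradedQuiver) :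
    (C.mulDown a).mul A (C.upLetter a.dom) = a := by
  rw [mulDown, Letter.mul_assoc rfl rfl, downLetter_mul_upLetter, letter_mul_id]

@[simp]
theorem letter_mul_upLetter (a : Letter A.toGradedQuiver) :
    (F.letter a).mul A (C.upLetter a.dom) = (C.upLetter a.cod).mul A a := by
  rw [← upLetter_mul_mulDown, Letter.mul_assoc (C.mulDown_cod a).symm (C.mulDown_dom a),
    mulDown_mul_upLetter]

theorem mul_mulDown {a b : Letter A.toGradedQuiver} (h : a.dom = b.cod) :
    a.mul A (C.mulDown b) = C.mulDown (a.mul A b) := by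
  rw [mulDown, mulDown, mul_dom, Letter.mul_assoc h rfl]

theorem mulDown_mul_letter {a b : Letter A.toGradedQuiver} (h : a.dom = b.cod) :
    (C.mulDown a).mul A (F.letter b) = C.mulDown (a.mul A b) := by
  rw [← C.upLetter_mul_mulDown, ← h, ← Letter.mul_assoc (b := C.upLetter a.dom) (C.mulDown_dom a)
    (h.trans (C.mulDown_cod b).symm), mulDown_mul_upLetter, mul_mulDown C h]

theorem mulDown_diff (a : Letter A.toGradedQuiver) :
    C.mulDown (a.diff A) = (C.mulDown a).diff A := by
  have leibniz := A.leibniz (add_zero a.deg) (add_zero (a.deg + 1)) (by rw [zero_add]) a.hom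
    (C.down a.dom)
  rw [C.d_down, map_zero, smul_zero, add_zero] at leibniz
  calc C.mulDown (a.diff A)
      = Letter.of A.toGradedQuiver
          (A.comp (add_zero (a.deg + 1)) (A.d a.hom) (C.down a.dom)) :=
        (letter_of_comp _ _ _).symm
    _ = Letter.of A.toGradedQuiver (A.d (A.comp (add_zero a.deg) a.hom (C.down a.dom))) :=
        congrArg _ leibniz.symm
    _ = (C.mulDown a).diff A :=
        congrArg (fun b : Letter A.toGradedQuiver => b.diff A) (letter_of_comp _ _ _)

end Letters

section Insertion

theorem insertion_up_cons (a : Letter A.toGradedQuiver) (l : List (Letter A.toGradedQuiver))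
    (x : A.Obj) : insertion C.up (a :: l) x =
      prepend (C.upLetter a.cod) (word (a :: l)) -
        sgn k a.deg • prepend (F.letter a) (insertion C.up l a.dom) := by
  rw [insertion, zero_sub, mul_neg_one, sgn_neg, sgn_sub, sgn_one, mul_neg_one, neg_smul,
    ← sub_eq_add_neg, prepend_word]
  rfl

theorem insertion_d_up_cons (a : Letter A.toGradedQuiver) (l : List (Letter A.toGradedQuiver))
    (x : A.Obj) : insertion (fun y => A.d (C.up y)) (a :: l) x =
      prepend ((C.upLetter a.cod).diff A) (word (a :: l)) +
        prepend (F.letter a) (insertion (fun y => A.d (C.up y)) l a.dom) := by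
  have sign : sgn k ((a.deg - 1) * (0 + 1 - 1)) = 1 := by
    rw [zero_add, sub_self, mul_zero, sgn_zero]
  rw [insertion, sign, one_smul, prepend_word]
  rfl

theorem lift_insertion_up_prepend (a : Letter A.toGradedQuiver) (w : Words A.toGradedQuiver)
    (x : A.Obj) : lift (insertion C.up · x) (prepend a w) =
      prepend (C.upLetter a.cod) (prepend a w) -
        sgn k a.deg • prepend (F.letter a) (lift (insertion C.up · a.dom) w) := by
  suffices h : lift (insertion C.up · x) ∘ₗ prepend a =
      prepend (C.upLetter a.cod) ∘ₗ prepend a -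
        sgn k a.deg • (prepend (F.letter a) ∘ₗ lift (insertion C.up · a.dom)) from
    LinearMap.congr_fun h w
  exact hom_ext fun l => by simp [insertion_up_cons]

/-- The naturality `F a ∘ up = up ∘ a` cancels the inner terms. -/
theorem mulHead_insertion_up {a : Letter A.toGradedQuiver} {l : List (Letter A.toGradedQuiver)}
    (hl : (a :: l).IsChain fun s t => s.dom = t.cod) (x : A.Obj) :
    mulHead A (F.letter a) (insertion C.up l a.dom) =
      word ((C.upLetter a.cod).mul A a :: l) -
        sgn k a.deg • prepend (C.upLetter a.cod) (mulHead A a (word l)) +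
        sgn k a.deg • lift (insertion C.up · x) (mulHead A a (word l)) := by
  cases l with
  | nil =>
    change mulHead A (F.letter a) (word [C.upLetter a.dom]) = _
    simp
  | cons b l =>
    have hab : a.dom = b.cod := (List.isChain_cons_cons.1 hl).1
    simp only [insertion_up_cons, map_sub, map_smul, mulHead_prepend, mulHead_word_cons, lift_word,
      mul_cod, mul_dom, Letter.mul_deg, letter_mul F hab, prepend_word]
    rw [← hab, letter_mul_upLetter, sgn_add]
    linear_combination (norm := module) sgn_mul_self (k := k) a.deg •
      (sgn k b.deg • prepend ((F.letter a).mul A (F.letter b)) (insertion C.up l b.dom))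

theorem wordDiff_insertion_up {l : List (Letter A.toGradedQuiver)}
    (hl : l.IsChain fun s t => s.dom = t.cod) (x : A.Obj) :
    lift (wordDiff A) (insertion C.up l x) + lift (insertion C.up · x) (wordDiff A l) =
      insertion (fun y => A.d (C.up y)) l x := by
  induction l generalizing x with
  | nil =>
    change lift (wordDiff A) (word [C.upLetter x]) + lift (insertion C.up · x) 0 = _
    simp only [lift_word, wordDiff, insertion, mulHead_word_nil, map_zero, sub_zero, smul_zero,
      add_zero]
    rfl
  | cons a l ih =>
    have ih := congrArg (prepend (F.letter a)) (ih hl.of_cons a.dom)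
    rw [map_add] at ih
    have hdeg : (F.letter a).deg = a.deg := rfl
    have hup : (C.upLetter a.cod).deg = 0 := rfl
    have hdiff : (a.diff A).deg = a.deg + 1 := rfl
    have hcod : (a.diff A).cod = a.cod := rfl
    have hdom : (a.diff A).dom = a.dom := rfl
    simp only [insertion_up_cons, insertion_d_up_cons, lift_word, wordDiff, map_add, map_sub,
      map_smul, lift_wordDiff_prepend, lift_insertion_up_prepend, mulHead_insertion_up C hl x,
      letter_diff, mulHead_word_cons, prepend_word, hdeg, hup, hdiff, hcod, hdom, sgn_zero,
      sgn_add, sgn_one] at ih ⊢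
    rcases sgn_eq_one_or_eq_neg_one (k := k) a.deg with sign | sign <;>
    · rw [sign]
      linear_combination (norm := module) ih

end Insertion

section Homotopy

/-- The homotopy on words, `a₀[a₁|…|aₙ] ↦ ∑ᵢ ± (a₀ ∘ down)[F a₁|…|F aᵢ|up|aᵢ₊₁|…|aₙ]`. -/
noncomputable def wordHomotopy : List (Letter A.toGradedQuiver) → Words A.toGradedQuiver
  | [] => 0
  | a :: l => sgn k a.deg • prepend (C.mulDown a) (insertion C.up l a.dom)

theorem wordHomotopy_cons (a : Letter A.toGradedQuiver) (l : List (Letter A.toGradedQuiver)) :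
    C.wordHomotopy (a :: l) = sgn k a.deg • prepend (C.mulDown a) (insertion C.up l a.dom) := rfl

theorem lift_wordHomotopy_prepend (a : Letter A.toGradedQuiver) (w : Words A.toGradedQuiver) :
    lift C.wordHomotopy (prepend a w) =
      sgn k a.deg • prepend (C.mulDown a) (lift (insertion C.up · a.dom) w) := by
  suffices h : lift C.wordHomotopy ∘ₗ prepend a =
      sgn k a.deg • (prepend (C.mulDown a) ∘ₗ lift (insertion C.up · a.dom)) from
    LinearMap.congr_fun h w
  exact hom_ext fun l => by simp [wordHomotopy_cons]

theorem mulHead_mulDown_insertion_up {a : Letter A.toGradedQuiver}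
    {l : List (Letter A.toGradedQuiver)} (hl : (a :: l).IsChain fun s t => s.dom = t.cod) :
    mulHead A (C.mulDown a) (insertion C.up l a.dom) =
      word (a :: l) - sgn k a.deg • lift C.wordHomotopy (mulHead A a (word l)) := by
  cases l with
  | nil =>
    change mulHead A (C.mulDown a) (word [C.upLetter a.dom]) = _
    simp
  | cons b l =>
    have hab : a.dom = b.cod := (List.isChain_cons_cons.1 hl).1
    simp only [insertion_up_cons, map_sub, map_smul, mulHead_prepend, mulHead_word_cons, lift_word,
      wordHomotopy_cons, mul_dom, Letter.mul_deg, C.mulDown_mul_letter hab, prepend_word]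
    rw [← hab, mulDown_mul_upLetter, sgn_add]
    linear_combination (norm := module) sgn_mul_self (k := k) a.deg •
      (sgn k b.deg • prepend (C.mulDown (a.mul A b)) (insertion C.up l b.dom))

theorem wordDiff_wordHomotopy {a : Letter A.toGradedQuiver} {l : List (Letter A.toGradedQuiver)}
    (hl : (a :: l).IsChain fun s t => s.dom = t.cod) :
    lift (wordDiff A) (C.wordHomotopy (a :: l)) + lift C.wordHomotopy (wordDiff A (a :: l)) =
      word (a :: l) - prepend (C.mulDown a) (insertion (fun y => A.d (C.up y)) l a.dom) := by
  have anticomm := congrArg (prepend (C.mulDown a)) (C.wordDiff_insertion_up hl.of_cons a.dom)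
  rw [map_add] at anticomm
  have hdiff : (a.diff A).deg = a.deg + 1 := rfl
  have hdom : (a.diff A).dom = a.dom := rfl
  simp only [wordHomotopy_cons, wordDiff, map_add, map_sub, map_smul, lift_word,
    lift_wordDiff_prepend, lift_wordHomotopy_prepend, mulHead_mulDown_insertion_up C hl,
    mulDown_diff, mulDown_deg, hdiff, hdom, sgn_add, sgn_one]
  rcases sgn_eq_one_or_eq_neg_one (k := k) a.deg with sign | sign <;>
  · rw [sign]
    linear_combination (norm := module) -anticomm

theorem isMultilinear_lift_mk_wordHomotopy :
    IsMultilinear fun l => lift mk (C.wordHomotopy l) := by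
  have hmk : IsMultilinear (mk (Q := A.toGradedQuiver)) := (respects_mk _).lin
  intro p q x y n c f g
  cases p with
  | nil =>
    have head (r) : mk (C.mulDown (Letter.of A.toGradedQuiver (c • f + g)) :: r) =
        c • mk (C.mulDown (Letter.of A.toGradedQuiver f) :: r) +
          mk (C.mulDown (Letter.of A.toGradedQuiver g) :: r) :=
      mk_mul_lin_left A [] r (C.downLetter x) x y n c f g
    simp only [List.nil_append, wordHomotopy_cons, map_smul, lift_prepend, head, lift_smul_add]
    change sgn k n • (c • lift _ (insertion C.up q x) + lift _ (insertion C.up q x)) =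
      c • (sgn k n • lift _ (insertion C.up q x)) + sgn k n • lift _ (insertion C.up q x)
    module
  | cons a p =>
    have tail := (hmk.cons (C.mulDown a)).lift_insertion C.up a.dom p q x y n c f g
    simp only [List.cons_append, wordHomotopy_cons, map_smul, lift_prepend, tail]
    module

open Classical in
theorem respects_wordHomotopy :
    Respects fun l => if IsCyclic l then lift mk (C.wordHomotopy l) else 0 where
  lin p q x y n c f g := by
    simp only [isCyclic_lin p q (c • f + g) 0, isCyclic_lin p q f 0, isCyclic_lin p q g 0]
    split_ifs
    · exact C.isMultilinear_lift_mk_wordHomotopy p q x y n c f g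
    · simp
  nc l hl := if_neg hl

/-- The homotopy from `F_*` to the identity induced by `C.wordHomotopy`. -/
noncomputable def homotopy : Module.End k (Chains A.toGradedQuiver) :=
  Chains.lift _ C.respects_wordHomotopy

theorem homotopy_mk {l : List (Letter A.toGradedQuiver)} (hl : IsCyclic l) :
    C.homotopy (mk l) = lift mk (C.wordHomotopy l) := by
  rw [homotopy, Chains.lift_mk, if_pos hl]

theorem hasDeg_homotopy :
    HasDeg (Chains.grade A.toGradedQuiver) (Chains.grade A.toGradedQuiver) C.homotopy (-1) := by
  refine HasDeg.of_words fun l hl => ?_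
  rw [homotopy_mk C hl]
  obtain ⟨a, l, rfl⟩ := hl.exists_cons
  rw [wordHomotopy_cons, map_smul, lift_prepend]
  refine Submodule.smul_mem _ _ (lift_mem (fun q hq => mk_mem_grade ?_)
    (insertion_mem_span C.up l a.dom))
  rw [sdeg_cons, sdeg_cons, show sdeg q = _ from hq, mulDown_deg]
  ring

theorem lift_mk_insertion_d_up (p l : List (Letter A.toGradedQuiver)) (x : A.Obj) :
    lift (fun q => mk (p ++ q)) (insertion (fun y => A.d (C.up y)) l x) = 0 := by
  have d_up (y : A.Obj) : A.d (C.up y) = 0 := C.d_up y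
  induction l generalizing p x with
  | nil =>
    rw [insertion, lift_word, d_up]
    exact mk_zero p [] _ _ _
  | cons a l ih =>
    have ih := ih (p ++ [F.letter a]) a.dom
    simp only [List.append_assoc, List.cons_append, List.nil_append] at ih
    rw [insertion, map_add, map_smul, lift_word, lift_prepend, ih, smul_zero, add_zero, d_up]
    exact mk_zero p _ _ _ _

theorem barB_homotopy (c : Chains A.toGradedQuiver) :
    barB A (C.homotopy c) + C.homotopy (barB A c) = c := by
  suffices h : barB A * C.homotopy + C.homotopy * barB A = 1 from LinearMap.congr_fun h c
  refine Chains.hom_ext fun l hl => ?_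
  change barB A (C.homotopy (mk l)) + C.homotopy (barB A (mk l)) = mk l
  have homotopy_wordDiff : C.homotopy (lift mk (wordDiff A l)) =
      lift mk (lift C.wordHomotopy (wordDiff A l)) := by
    rw [map_lift, map_lift]
    refine lift_congr (fun q hq => ?_) (wordDiff_mem_span A l)
    exact C.homotopy_mk (hq [] hl)
  have barB_mk_eq : barB A (mk l) = lift mk (wordDiff A l) := by
    simpa using barB_lift_mk A (word l)
  obtain ⟨a, l, rfl⟩ := hl.exists_cons
  rw [homotopy_mk C hl, barB_lift_mk, barB_mk_eq, homotopy_wordDiff, ← map_add,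
    C.wordDiff_wordHomotopy (isChain_of_isCyclic hl), map_sub, lift_word, lift_prepend]
  simpa using C.lift_mk_insertion_d_up [C.mulDown a] l a.dom

theorem mulFirst_tInv_mk_mulDown_concat_up (a : Letter A.toGradedQuiver)
    (l : List (Letter A.toGradedQuiver)) :
    mulFirst A (tInv A.toGradedQuiver
      (mk (C.mulDown a :: (l.map F.letter ++ [C.upLetter a.cod])))) =
        sgn k (sdeg (a :: l)) • mk ((a :: l).map F.letter) := by
  have hup : (C.upLetter a.cod).deg = 0 := rfl
  rw [mulFirst_tInv_mk_cons_concat, upLetter_mul_mulDown, hup, sgn_zero, mul_one, zero_sub,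
    neg_one_mul, sgn_neg, sdeg_cons, sdeg_cons, sdeg_map, mulDown_deg]
  rfl

theorem mulFirst_tInv_lift_insertion_up {a z : Letter A.toGradedQuiver} (hza : z.dom = a.cod)
    (q : List (Letter A.toGradedQuiver)) (x : A.Obj) :
    mulFirst A (tInv A.toGradedQuiver
      (lift (fun r => mk (C.mulDown a :: (r ++ [z]))) (insertion C.up q x))) =
        -(sgn k ((z.deg - 1) * sdeg (a :: q))) •
          lift (fun r => mk (C.mulDown (z.mul A a) :: r)) (insertion C.up q x) := by
  have sign (r : List (Letter A.toGradedQuiver)) (hr : sdeg r = sdeg q + (0 - 1)) :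
      sgn k ((z.deg - 1) * sdeg (C.mulDown a :: r)) * sgn k z.deg =
        -sgn k ((z.deg - 1) * sdeg (a :: q)) := by
    rw [← sgn_add, ← neg_one_mul, ← sgn_one (G := G), ← sgn_add, sdeg_cons, sdeg_cons, hr,
      mulDown_deg]
    exact sgn_eq_of_eq_add_two_mul (r := 0) (by ring)
  rw [map_lift, map_lift, smul_lift]
  refine lift_congr (fun r hr => ?_) (insertion_mem_span C.up q x)
  rw [mulFirst_tInv_mk_cons_concat, C.mul_mulDown hza, sign r hr]

theorem mulFirst_tInv_homotopy_mk_singleton {a : Letter A.toGradedQuiver} (hl : IsCyclic [a]) :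
    mulFirst A (tInv A.toGradedQuiver (C.homotopy (mk [a]))) = -mk [F.letter a] := by
  have ha : a.dom = a.cod := (List.isChain_cons_cons.1 (show List.IsChain _ [a, a] from hl)).1
  have last : mulFirst A (tInv A.toGradedQuiver (mk (C.mulDown a ::
      [Letter.of A.toGradedQuiver (C.up a.cod)]))) = _ :=
    C.mulFirst_tInv_mk_mulDown_concat_up a []
  rw [homotopy_mk C hl, wordHomotopy_cons, map_smul, lift_prepend, map_smul, map_smul, ha,
    insertion, lift_word, last, smul_smul, sdeg_cons, sdeg_nil, add_zero, sgn_sub, sgn_one,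
    List.map_singleton]
  linear_combination (norm := module) -sgn_mul_self (k := k) a.deg • mk [F.letter a]

theorem mulFirst_tInv_homotopy (c : Chains A.toGradedQuiver) :
    mulFirst A (tInv A.toGradedQuiver (C.homotopy c)) +
      C.homotopy (mulFirst A (tInv A.toGradedQuiver c)) = -Chains.map F.toQuiverHom c := by
  suffices h : mulFirst A * tInv A.toGradedQuiver * C.homotopy +
      C.homotopy * mulFirst A * tInv A.toGradedQuiver = -Chains.map F.toQuiverHom from
    LinearMap.congr_fun h c
  refine Chains.hom_ext fun l hl => ?_
  change mulFirst A (tInv A.toGradedQuiver (C.homotopy (mk l))) +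
    C.homotopy (mulFirst A (tInv A.toGradedQuiver (mk l))) = -Chains.map F.toQuiverHom (mk l)
  obtain ⟨a, l, rfl⟩ := hl.exists_cons
  rw [Chains.map_mk _ _ hl]
  rcases List.eq_nil_or_concat l with rfl | ⟨q, z, rfl⟩
  · have rotate : tInv A.toGradedQuiver (mk [a]) = _ := tInv_mk_concat [] a
    rw [C.mulFirst_tInv_homotopy_mk_singleton hl, rotate, map_smul, mulFirst_mk_singleton,
      smul_zero, map_zero, add_zero, List.map_singleton]
  · rw [List.concat_eq_append] at hl ⊢
    have hl_rot : IsCyclic (z :: a :: q) := by rwa [← List.cons_append, isCyclic_swap] at hl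
    have hza : z.dom = a.cod := isCyclic_adj (p := []) hl_rot
    have hl_mul : IsCyclic (z.mul A a :: q) :=
      (isCyclic_merge [] q z a _ hza (mul_cod A z a) (mul_dom A z a)).1 hl_rot
    have last : mulFirst A (tInv A.toGradedQuiver (mk (C.mulDown a ::
        ((q ++ [z]).map F.letter ++ [Letter.of A.toGradedQuiver (C.up a.cod)])))) = _ :=
      C.mulFirst_tInv_mk_mulDown_concat_up a (q ++ [z])
    rw [homotopy_mk C hl, wordHomotopy_cons, map_smul, lift_prepend, map_smul, map_smul,
      insertion_concat C.up (isChain_of_isCyclic hl), mulFirst_tInv_mk_cons_concat, map_smul,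
      homotopy_mk C hl_mul, wordHomotopy_cons, mul_dom, map_add, map_lift]
    simp only [map_add, map_smul, lift_word, lift_prepend]
    rw [C.mulFirst_tInv_lift_insertion_up hza, hza, last, Letter.mul_deg, zero_sub, mul_neg_one,
      sgn_neg, sdeg_cons a (q ++ [z])]
    simp only [sgn_add, sgn_sub, sgn_one]
    rcases sgn_eq_one_or_eq_neg_one (k := k) a.deg with sa | sa <;>
    rcases sgn_eq_one_or_eq_neg_one (k := k) z.deg with sz | sz <;>
    rcases sgn_eq_one_or_eq_neg_one (k := k) (sdeg (q ++ [z])) with sq | sq <;>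
    · rw [sa, sz, sq]
      module

theorem hochB_homotopy (c : Chains A.toGradedQuiver) :
    hochB A (C.homotopy c) + C.homotopy (hochB A c) = c - Chains.map F.toQuiverHom c := by
  simp only [hochB_eq, LinearMap.add_apply, Module.End.mul_apply, map_add]
  linear_combination (norm := module) C.barB_homotopy c + C.mulFirst_tInv_homotopy c

end Homotopy

end Conjugation

section Retraction

variable {A : DGCat.{u, v} k G} {B : DGCat.{u', v'} k G} {F : Semifunctor A B}
  {I : Semifunctor B A}

theorem exists_sub_map_mapU_eq_negCyc (hI : I.IsUnital)
    {H : Module.End k (Chains A.toGradedQuiver)}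
    (hdeg : HasDeg (Chains.grade A.toGradedQuiver) (Chains.grade A.toGradedQuiver) H (-1))
    (hH : ∀ c, hochB A (H c) + H (hochB A c) =
      c - Chains.map I.toQuiverHom (Chains.map F.toQuiverHom c))
    {e : G} {f : ℕ → Chains A.toGradedQuiver}
    (hf : f ∈ cocycles (Chains.grade A.toGradedQuiver) (negCyc A) e) :
    ∃ g ∈ cocycles (Chains.grade A.toGradedQuiver) (negCyc A) e,
      f - constU (Chains.map I.toQuiverHom) (F.mapU g) = negCyc A (constU H g) := by
  obtain ⟨g, hg, hfg⟩ := exists_sub_eq_negD_constU (φ := Chains.map I.toQuiverHom ∘ₗ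
      Chains.map F.toQuiverHom) (ψ := Chains.map I.toQuiverHom ∘ₗ F.mapB)
    ((hasDeg_map _).comp (hasDeg_mapB F) (add_zero _)) (hasDeg_connesB A) hdeg
    (hochB_connesB A) (connesB_connesB A)
    (fun c => by
      simp only [LinearMap.comp_apply, ← map_hochB, ← hI.map_connesB, ← map_add,
        map_connesB_add_mapB_hochB])
    (fun c => by
      simp only [LinearMap.comp_apply, mapB_connesB, ← hI.map_connesB, connesB_mapB, map_zero])
    hH hf
  refine ⟨g, hg, ?_⟩
  rw [negCyc, ← hfg]
  congr 1
  funext n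
  cases n with
  | zero => simp [mapU_zero]
  | succ n => simp [mapU_succ]

/-- As `F_*(u) I_*` is homotopic to the identity, it is enough to make `f` cohomologous to some
cocycle in the image of `I_* F_*(u)`, which the Hochschild homotopy `H` does. -/
theorem exists_negCyc_eq_sub_map_mapU (hI : I.IsUnital)
    (hFI : ∀ c, Chains.map F.toQuiverHom (Chains.map I.toQuiverHom c) = c)
    {H : Module.End k (Chains A.toGradedQuiver)}
    (hdeg : HasDeg (Chains.grade A.toGradedQuiver) (Chains.grade A.toGradedQuiver) H (-1))
    (hH : ∀ c, hochB A (H c) + H (hochB A c) =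
      c - Chains.map I.toQuiverHom (Chains.map F.toQuiverHom c))
    {e : G} {f : ℕ → Chains A.toGradedQuiver}
    (hf : f ∈ cocycles (Chains.grade A.toGradedQuiver) (negCyc A) e) :
    ∃ y ∈ gradeU (Chains.grade A.toGradedQuiver) (e - 1),
      negCyc A y = f - constU (Chains.map I.toQuiverHom) (F.mapU f) := by
  obtain ⟨g, hg, hfg⟩ := exists_sub_map_mapU_eq_negCyc hI hdeg hH hf
  have cF := isNegCycMap_mapU F
  have cI := hI.isNegCycMap
  have hFg := cF.map_cocycles _ _ hg
  have hHg : constU H g ∈ gradeU (Chains.grade A.toGradedQuiver) (e - 1) :=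
    sub_eq_add_neg e 1 ▸ hdeg.constU_mem_gradeU hg.1
  set T := mulU (k := k) (constU (tripleS B) (F.mapU g)) with hT
  refine ⟨constU H g - constU (Chains.map I.toQuiverHom) T -
    constU (Chains.map I.toQuiverHom) (F.mapU (constU H g)), sub_mem (sub_mem hHg
      (cI.map_grade _ _ (mulU_tripleS_mem_gradeU B hFg.1)))
      (cI.map_grade _ _ (cF.map_grade _ _ hHg)), ?_⟩
  have image := congrArg (constU (Chains.map I.toQuiverHom)) (congrArg F.mapU hfg)
  rw [map_sub, mapU_constU_map hI hFI, LinearMap.mem_ker.1 hFg.2, map_zero, map_zero, add_zero,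
    ← hT, map_sub, map_add, cF.comm, cI.comm, cI.comm] at image
  rw [map_sub, map_sub, ← hfg]
  linear_combination (norm := module) image

end Retraction

section Summand

variable (A : DGCat.{u, v} k G) (P N : A.Obj)

theorem isUnital_inclusion : (inclusion A P N).IsUnital := fun _ => rfl

variable {A P N} (S : DirectSummand A P N)

theorem functor_letter_inclusion_letter (a : Letter (singleCat A N).toGradedQuiver) :
    S.functor.letter ((inclusion A P N).letter a) = a := by
  have conj_N {n : G} (f : A.Hom N N n) : S.conj PN.N PN.N n f = f :=
    (congrArg _ (A.comp_one _ f)).trans (A.one_comp _ f)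
  exact congrArg (Letter.of (singleCat A N).toGradedQuiver (x := a.dom) (y := a.cod) (n := a.deg))
    (conj_N a.hom)

theorem map_functor_map_inclusion (c : Chains (singleCat A N).toGradedQuiver) :
    Chains.map S.functor.toQuiverHom (Chains.map (inclusion A P N).toQuiverHom c) = c := by
  suffices h : Chains.map S.functor.toQuiverHom ∘ₗ Chains.map (inclusion A P N).toQuiverHom =
    LinearMap.id from LinearMap.congr_fun h c
  refine Chains.hom_ext fun l hl => ?_
  rw [LinearMap.comp_apply, Chains.map_mk _ _ hl, Chains.map_mk _ _ (isCyclic_map _ hl),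
    List.map_map]
  change mk (l.map fun a => S.functor.letter ((inclusion A P N).letter a)) = mk l
  simp only [functor_letter_inclusion_letter, List.map_id']

theorem coh_map_comp_inclusion
    (hF : IsNegCycMap (pairCat A P N) (singleCat A N) S.functor.mapU)
    (hinc : IsNegCycMap (singleCat A N) (pairCat A P N)
      (constU (Chains.map (inclusion A P N).toQuiverHom))) (g : G) :
    Coh.map hF g ∘ₗ Coh.map hinc g =
      (LinearMap.id : HN (singleCat A N) g →ₗ[k] HN (singleCat A N) g) :=
  coh_map_mapU_comp_coh_map (isUnital_inclusion A P N) (map_functor_map_inclusion S) hF hinc g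

theorem functor_map_one : S.functor.map ((pairCat A P N).one PN.P) = S.idem :=
  congrArg (A.comp (zero_add 0) S.i) (A.one_comp _ S.j)

theorem quotU_mapU_functor_gammaSeries :
    quotU (singleCat A N) (S.functor.mapU (gammaSeries (pairCat A P N) PN.P)) =
      quotU (singleCat A N) (etaSeries (singleCat A N) () S.idem) :=
  (quotU_mapU_gammaSeries S.functor PN.P).trans (by rw [functor_map_one]; rfl)

theorem map_inclusion_etaSeries (π : A.Hom N N 0) :
    constU (Chains.map (inclusion A P N).toQuiverHom) (etaSeries (singleCat A N) () π) =
      etaSeries (pairCat A P N) PN.N π :=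
  (isUnital_inclusion A P N).map_etaSeries () π

theorem quotU_map_inclusion_mapU_gammaSeries :
    quotU (pairCat A P N) (constU (Chains.map (inclusion A P N).toQuiverHom)
      (S.functor.mapU (gammaSeries (pairCat A P N) PN.P))) =
        quotU (pairCat A P N) (etaSeries (pairCat A P N) PN.N S.idem) := by
  have h := (quotU_eq_iff _).1 (quotU_mapU_functor_gammaSeries S)
  rw [← map_inclusion_etaSeries, quotU_eq_iff]
  intro n
  rw [constU_apply, constU_apply, ← map_sub]
  exact (isUnital_inclusion A P N).map_mem_degenerate (h n)

/-- The composite of `S.functor` and the inclusion, an endofunctor of `{P, N}`. -/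
def endofunctor : Semifunctor (pairCat A P N) (pairCat A P N) where
  obj _ := PN.N
  map := fun {x y : PN} {n : G} => S.conj x y n
  map_d := fun {x y : PN} {n : G} f => S.conj_d x y n f
  map_comp := fun {x y z : PN} {_ _ _ : G} h f g => S.conj_comp (x := x) (y := y) (z := z) h f g

theorem map_inclusion_map_functor (c : Chains (pairCat A P N).toGradedQuiver) :
    Chains.map (inclusion A P N).toQuiverHom (Chains.map S.functor.toQuiverHom c) =
      Chains.map (endofunctor S).toQuiverHom c :=
  map_map_of_letter (fun _ => rfl) c

/-- The endofunctor `f ↦ i ∘ f ∘ j` of `{P, N}` as a conjugation by the structure maps of the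
direct summand. -/
def endofunctorConjugation : Conjugation (endofunctor S) where
  up := S.up
  down := S.down
  d_up := S.d_up
  d_down := S.d_down
  down_up := S.down_up
  map_eq := fun {x y : PN} {n : G} f => S.conj_apply x y n f

theorem exists_negCyc_eq_sub_inclusion_mapU {e : G}
    {f : ℕ → Chains (pairCat A P N).toGradedQuiver}
    (hf : f ∈ cocycles (Chains.grade (pairCat A P N).toGradedQuiver) (negCyc (pairCat A P N)) e) :
    ∃ y ∈ gradeU (Chains.grade (pairCat A P N).toGradedQuiver) (e - 1),
      negCyc (pairCat A P N) y =
        f - constU (Chains.map (inclusion A P N).toQuiverHom) (S.functor.mapU f) :=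
  exists_negCyc_eq_sub_map_mapU (isUnital_inclusion A P N) (map_functor_map_inclusion S)
    (endofunctorConjugation S).hasDeg_homotopy
    (fun c => by rw [(endofunctorConjugation S).hochB_homotopy, map_inclusion_map_functor]) hf

theorem quotU_unitSeries_mem_cocycles (B : DGCat.{u', v'} k G) (x : B.Obj) :
    quotU B (unitSeries B x) ∈ cocycles (NChains.grade B) (negCycBar B) 0 :=
  quotU_gammaSeries B x ▸ (isCochainMap_quotU B).map_cocycles _ _ (gammaSeries_mem_cocycles B x)

theorem quotU_etaSeries_mem_cocycles :
    quotU (pairCat A P N) (etaSeries (pairCat A P N) PN.N S.idem) ∈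
      cocycles (NChains.grade (pairCat A P N)) (negCycBar (pairCat A P N)) 0 :=
  quotU_map_inclusion_mapU_gammaSeries S ▸ (isCochainMap_quotU _).map_cocycles _ _
    ((isUnital_inclusion A P N).isNegCycMap.map_cocycles _ _
      ((isNegCycMap_mapU S.functor).map_cocycles _ _ (gammaSeries_mem_cocycles _ _)))

theorem cls_unitSeries_eq_cls_etaSeries
    (h1 : quotU (pairCat A P N) (unitSeries (pairCat A P N) PN.P) ∈
      cocycles (NChains.grade (pairCat A P N)) (negCycBar (pairCat A P N)) 0)
    (h2 : quotU (pairCat A P N) (etaSeries (pairCat A P N) PN.N S.idem) ∈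
      cocycles (NChains.grade (pairCat A P N)) (negCycBar (pairCat A P N)) 0) :
    (Coh.cls _ _ _ h1 : HNbar (pairCat A P N) 0) = Coh.cls _ _ _ h2 := by
  obtain ⟨y, hy, hDy⟩ := exists_negCyc_eq_sub_inclusion_mapU S
    (gammaSeries_mem_cocycles (pairCat A P N) PN.P)
  have hquot := isCochainMap_quotU (pairCat A P N)
  refine (Submodule.Quotient.eq _).2 ⟨quotU _ y, hquot.map_grade _ _ hy, ?_⟩
  rw [← hquot.comm, hDy, map_sub, quotU_map_inclusion_mapU_gammaSeries]
  exact congrArg (· - _) (quotU_gammaSeries (pairCat A P N) PN.P)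

end Summand

end NegCyc

theorem mainTheorem3 {k : Type*} [Field k] {G : Type*} [GradingRing G] (A : DGCat k G)
    {P N : A.Obj} (S : DirectSummand A P N) :
    ∃ (hF : IsNegCycMap (pairCat A P N) (singleCat A N) S.functor.mapU)
      (hinc : IsNegCycMap (singleCat A N) (pairCat A P N)
        (constU (Chains.map (inclusion A P N).toQuiverHom))),
      (∀ g : G, Coh.map hF g ∘ₗ Coh.map hinc g =
        (LinearMap.id : HN (singleCat A N) g →ₗ[k] HN (singleCat A N) g)) ∧
      (∀ f : ℕ → Chains (pairCat A P N).toGradedQuiver,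
        S.functor.mapU f 0 = Chains.map S.functor.toQuiverHom (f 0)) ∧
      quotU (singleCat A N) (S.functor.mapU (gammaSeries (pairCat A P N) PN.P)) =
        quotU (singleCat A N) (etaSeries (singleCat A N) () S.idem) ∧
      ∃ (h1 : quotU (pairCat A P N) (unitSeries (pairCat A P N) PN.P) ∈
            cocycles (NChains.grade (pairCat A P N)) (negCycBar (pairCat A P N)) 0)
        (h2 : quotU (pairCat A P N) (etaSeries (pairCat A P N) PN.N S.idem) ∈
            cocycles (NChains.grade (pairCat A P N)) (negCycBar (pairCat A P N)) 0),
        (Coh.cls _ _ _ h1 : HNbar (pairCat A P N) 0) = Coh.cls _ _ _ h2 :=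
  ⟨isNegCycMap_mapU S.functor, (isUnital_inclusion A P N).isNegCycMap,
    coh_map_comp_inclusion S _ _, mapU_zero S.functor, quotU_mapU_functor_gammaSeries S,
    quotU_unitSeries_mem_cocycles (pairCat A P N) PN.P, quotU_etaSeries_mem_cocycles S,
    cls_unitSeries_eq_cls_etaSeries S _ _⟩
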